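/- Let $d\ge 1$ and $N\in\mathbb N$. For measurable $E\subset\mathbb R^d$ and Borel $B\subset\mathbb R^d$ let $P(E,B)=|D1_E|(B)$ be the perimeter of $E$ in $B$; $B_\rho$ is the open ball of radius $\rho$ centred at $0$. An $N$-partition of $\mathbb R^d$ is an $N$-tuple $\vec F=(F_1,\dots,F_N)$ of measurable sets with $|F_j\cap F_k|=0$ for $j\ne k$ and $|\mathbb R^d\setminus\bigcup_k F_k|=0$; it is a Caccioppoli partition if $P(F_k,B_r)<+\infty$ for all $k$ and all $r>0$. Put $P(\vec F,B)=\frac12\sum_{k=1}^N P(F_k,B)$. For a closed set $X\subset\mathbb R^d$, $\vec F$ is (locally) isoperimetric in $X$ if $P(\vec F,K)\le P(\vec G,K)$ for every compact $K\subset X$ and every $N$-partition $\vec G$ with $G_k\triangle F_k\subset K$ for all $k$ and $|G_k\cap K|=|F_k\cap K|$ for all $k$ with $|F_k|<+\infty$. A set $C\subset\mathbb R^d$ is a cone if $tx\in C$ for all $x\in C$, $t>0$. Theorem. Let $\Pi\subset\mathbb R^d$ be an open cone and let $\vec F$ be a Caccioppoli $N$-partition of $\mathbb R^d$ such that each $F_k\setminus\bar\Pi$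 is a cone and $\vec F$ is locally isoperimetric in $\bar\Pi$. Let $R>0$ be such that $F_k\subset B_R$ for every $k$ with $|F_k|<+\infty$. Then: 1. the function $$\rho\mapsto \frac{P(\vec F,B_\rho\setminus \bar B_R)}{\rho^{d-1}}$$ is non-decreasing on $[R,+\infty)$; 2. if moreover $P(F_k,\partial B_R)=0$ for every $k$ with $|F_k|<+\infty$ (for instance, if these regions are compactly contained in $B_R$), then also $$\rho\mapsto \frac{P(\vec F,B_\rho\setminus B_R)}{\rho^{d-1}}=\frac{P(\vec F,B_\rho)-P(\vec F,B_R)}{\rho^{d-1}}$$ is non-decreasing on $[R,+\infty)$; 3. for every $\rho\ge R$, $$\frac{P(\vec F,B_\rho\cap\bar\Pi)}{\rho^{d-1}}=\frac{P(\vec F,B_\rho\setminus B_R)+P(\vec F,B_R)}{\rho^{d-1}}-P(\vec F,B_1\setminus\bar\Pi);$$ 4. $P(\vec F,B_\rho\cap\bar\Pi)/\rho^{d-1}$ has a finite limit as $\rho\to+\infty$. -/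

import Mathlib

open MeasureTheory Filter Topology Set
open scoped ENNReal

noncomputable section

namespace IsoPartition

/-- A set is a cone (with vertex at the origin) if it is invariant under positive dilations. -/
def IsCone {d : ℕ} (C : Set (EuclideanSpace ℝ (Fin d))) : Prop :=
  ∀ t : ℝ, 0 < t → ∀ x ∈ C, t • x ∈ C

/-- The divergence of a vector field on Euclidean space. -/
def divergence {d : ℕ} (φ : EuclideanSpace ℝ (Fin d) → EuclideanSpace ℝ (Fin d))
    (x : EuclideanSpace ℝ (Fin d)) : ℝ :=
  ∑ i, (fderiv ℝ φ x (EuclideanSpace.single i 1)) i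

/-- `C¹` vector fields with compact support in `U` and pointwise Euclidean norm at most `1`. -/
structure IsTestField {d : ℕ} (U : Set (EuclideanSpace ℝ (Fin d)))
    (φ : EuclideanSpace ℝ (Fin d) → EuclideanSpace ℝ (Fin d)) : Prop where
  contDiff : ContDiff ℝ 1 φ
  hasCompactSupport : HasCompactSupport φ
  tsupport_subset : tsupport φ ⊆ U
  norm_le_one : ∀ x, ‖φ x‖ ≤ 1

/-- The total variation in an open set `U` of the distributional derivative of the
characteristic function of `E`. -/
def perimeterOpen {d : ℕ} (E U : Set (EuclideanSpace ℝ (Fin d))) : ℝ≥0∞ :=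
  ⨆ (φ : EuclideanSpace ℝ (Fin d) → EuclideanSpace ℝ (Fin d)) (_ : IsTestField U φ),
    ENNReal.ofReal (∫ x in E, divergence φ x)

/-- The perimeter `P(E, B)` of `E` in a Borel set `B`: the value at `B` of the total variation
measure of the distributional derivative of the characteristic function of `E`, that is, of the
Borel measure whose value on every open set `U` is `perimeterOpen E U` and which is obtained from
these values by outer approximation with open sets. -/
def perimeter {d : ℕ} (E B : Set (EuclideanSpace ℝ (Fin d))) : ℝ≥0∞ :=
  ⨅ (U : Set (EuclideanSpace ℝ (Fin d))) (_ : IsOpen U) (_ : B ⊆ U), perimeterOpen E U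

theorem perimeterOpen_mono {d : ℕ} (E : Set (EuclideanSpace ℝ (Fin d)))
    {U V : Set (EuclideanSpace ℝ (Fin d))} (h : U ⊆ V) :
    perimeterOpen E U ≤ perimeterOpen E V :=
  iSup₂_le fun φ hφ => le_iSup₂_of_le φ
    ⟨hφ.contDiff, hφ.hasCompactSupport, hφ.tsupport_subset.trans h, hφ.norm_le_one⟩ le_rfl

theorem perimeter_of_isOpen {d : ℕ} (E : Set (EuclideanSpace ℝ (Fin d)))
    {U : Set (EuclideanSpace ℝ (Fin d))} (hU : IsOpen U) :
    perimeter E U = perimeterOpen E U :=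
  le_antisymm (iInf_le_of_le U (iInf_le_of_le hU (iInf_le _ subset_rfl)))
    (le_iInf fun _ => le_iInf fun _ => le_iInf fun h => perimeterOpen_mono E h)

/-- An `N`-partition of `ℝ^d`: `N` Lebesgue measurable sets, pairwise disjoint up to null sets,
that cover the space up to a null set. Regions of measure zero are allowed. -/
structure IsPartition {d N : ℕ} (E : Fin N → Set (EuclideanSpace ℝ (Fin d))) : Prop where
  nullMeasurableSet : ∀ k, NullMeasurableSet (E k) volume
  inter_null : ∀ j k, j ≠ k → volume (E j ∩ E k) = 0
  compl_iUnion_null : volume (⋃ k, E k)ᶜ = 0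

/-- A partition all of whose regions have locally finite perimeter. -/
structure IsCaccioppoliPartition {d N : ℕ} (E : Fin N → Set (EuclideanSpace ℝ (Fin d))) : Prop
    extends IsPartition E where
  perimeter_lt_top : ∀ k, ∀ r : ℝ, 0 < r → perimeter (E k) (Metric.ball 0 r) < ∞

/-- The perimeter of a partition: half the sum of the perimeters of its regions. -/
def partitionPerimeter {d N : ℕ} (E : Fin N → Set (EuclideanSpace ℝ (Fin d)))
    (B : Set (EuclideanSpace ℝ (Fin d))) : ℝ≥0∞ :=
  (∑ k, perimeter (E k) B) / 2

/-- `J`-isoperimetric partitions in a (closed) set `X`: no variation supported in a compact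
subset `K` of `X` that keeps the volumes in `K` of the regions with index in `J` decreases the
perimeter in `K`. -/
def IsJIsoperimetricIn {d N : ℕ} (J : Set (Fin N)) (X : Set (EuclideanSpace ℝ (Fin d)))
    (E : Fin N → Set (EuclideanSpace ℝ (Fin d))) : Prop :=
  ∀ K : Set (EuclideanSpace ℝ (Fin d)), IsCompact K → K ⊆ X →
    ∀ F : Fin N → Set (EuclideanSpace ℝ (Fin d)), IsPartition F →
      (∀ k, symmDiff (F k) (E k) ⊆ K) →
      (∀ j ∈ J, volume (F j ∩ K) = volume (E j ∩ K)) →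
      partitionPerimeter E K ≤ partitionPerimeter F K

/-- (Locally) isoperimetric partitions in `X`: the volume constraint is imposed exactly on the
regions of finite measure. -/
def IsIsoperimetricIn {d N : ℕ} (X : Set (EuclideanSpace ℝ (Fin d)))
    (E : Fin N → Set (EuclideanSpace ℝ (Fin d))) : Prop :=
  IsJIsoperimetricIn {j | volume (E j) < ∞} X E

end IsoPartition

end

/-! The proof compares the partition with its images under radial diffeomorphisms x ↦ h(|x|²)x. Off
the closed cone each region is conical, so such a map changes it only inside `closure P`; if h = 1
outside a ball, the images form an admissible competitor as soon as the finite volumes are kept.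

To vary along X = γ(|x|²)x, take h = (1 - s d γ)^(1/d). The Jacobian is then exactly 1 - s div X, so
a region E with ∫_E div X = 0 keeps its volume for every small s, not only to first order. The Piola
transform (`divergence_piola`, `norm_piola_le`) and the Gauss-Green inequality
`ofReal_setIntegral_divergence_le_lintegral` bound the perimeter of the image by the larger of the
area factors of h. Letting s → 0 gives `first_variation_radial`: with μ the sum of the perimeter
measures, (d-1) ∫ γ dμ ≤ ∫ 2|x|² (-γ')⁺ dμ. For fields that change the volumes, a correction by
finitely many fixed fields yields the same inequality up to a Lagrange multiplier term
(`exists_first_variation_bound`).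

Now let γ vanish near the origin, rise to b² - a², and descend to 0 with slope about -1 between t =
a² and t = b². The rising part has (-γ')⁺ = 0 and costs nothing. If m(ρ) is the μ-measure of `B_ρ`
minus the open or closed ball of radius R, this gives (d-1)(b² - a²) m(a) ≤ 2b² (m(b) - m(a)), an
integrated form of (d-1) m ≤ ρ m', and `monotoneOn_div_pow` turns it into the monotonicity of
m(ρ)/ρ^(d-1). With the closed ball removed the field never meets the regions of finite volume. With
the open ball removed it enters the ball by a thin layer, and the volume defect is bounded by the
perimeter of those regions there, which tends to 0 if the sphere carries none.

Off the closed cone the perimeter is homogeneous of degree d-1, which gives the identity in the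
cone. For the limit, boundedness comes from a second competitor (`exists_totalPerimeter_ball_le`):
inside `B_ρ` the partition is replaced by its image under a map that is the identity on `B_R` and a
dilation by 1 + ρ off `B_(R+1)`. Inside the ball, and on the sphere along which it is glued, this
costs O(ρ^(d-1)). -/

noncomputable section

namespace IsoPartition

/-- Euclidean space of dimension `d`. -/
abbrev Euc (d : ℕ) := EuclideanSpace ℝ (Fin d)

variable {d : ℕ}

/-! ### Calculus of the divergence. -/

section Divergence

theorem divergence_zero_of_notMem_tsupport {φ : Euc d → Euc d} {x : Euc d} (hx : x ∉ tsupport φ) :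
    divergence φ x = 0 := by
  have h : fderiv ℝ φ x = 0 := by
    have := notMem_tsupport_iff_eventuallyEq.1 hx
    rw [this.fderiv_eq]
    simp
  simp [divergence, h]

theorem continuous_divergence {φ : Euc d → Euc d} (hφ : ContDiff ℝ 1 φ) :
    Continuous (divergence φ) := by
  unfold divergence
  have h := hφ.continuous_fderiv one_ne_zero
  fun_prop

theorem hasCompactSupport_divergence {φ : Euc d → Euc d} (hc : HasCompactSupport φ) :
    HasCompactSupport (divergence φ) :=
  hc.of_isClosed_subset (isClosed_tsupport _)
    (closure_minimal (fun _ hx => by_contra fun h => hx (divergence_zero_of_notMem_tsupport h))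
      (isClosed_tsupport _))

theorem integrable_divergence {φ : Euc d → Euc d} (hφ : ContDiff ℝ 1 φ)
    (hc : HasCompactSupport φ) : Integrable (divergence φ) :=
  (continuous_divergence hφ).integrable_of_hasCompactSupport (hasCompactSupport_divergence hc)

theorem divergence_sum {ι : Type*} (s : Finset ι) {φ : ι → Euc d → Euc d} {x : Euc d}
    (h : ∀ i ∈ s, DifferentiableAt ℝ (φ i) x) :
    divergence (fun y => ∑ i ∈ s, φ i y) x = ∑ i ∈ s, divergence (φ i) x := by
  unfold divergence
  rw [fderiv_fun_sum h, Finset.sum_comm]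
  simp

theorem divergence_add {φ ψ : Euc d → Euc d} {x : Euc d}
    (h : DifferentiableAt ℝ φ x) (h' : DifferentiableAt ℝ ψ x) :
    divergence (fun y => φ y + ψ y) x = divergence φ x + divergence ψ x := by
  unfold divergence
  rw [fderiv_fun_add h h', ← Finset.sum_add_distrib]
  simp

theorem divergence_const_smul (c : ℝ) {φ : Euc d → Euc d} {x : Euc d}
    (h : DifferentiableAt ℝ φ x) :
    divergence (fun y => c • φ y) x = c * divergence φ x := by
  unfold divergence
  rw [fderiv_fun_const_smul h, Finset.mul_sum]
  simp

theorem sum_apply_single_mul (L : Euc d →L[ℝ] ℝ) (v : Euc d) :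
    ∑ i, L (EuclideanSpace.single i 1) * v i = L v := by
  conv_rhs => rw [← (EuclideanSpace.basisFun (Fin d) ℝ).sum_repr v]
  simp [map_sum, mul_comm]

theorem divergence_smul {χ : Euc d → ℝ} {φ : Euc d → Euc d} {x : Euc d}
    (hχ : DifferentiableAt ℝ χ x) (h : DifferentiableAt ℝ φ x) :
    divergence (fun y => χ y • φ y) x = χ x * divergence φ x + fderiv ℝ χ x (φ x) := by
  unfold divergence
  rw [fderiv_fun_smul hχ h, ← sum_apply_single_mul (fderiv ℝ χ x) (φ x), Finset.mul_sum,
    ← Finset.sum_add_distrib]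
  simp

end Divergence

/-! ### The perimeter as a Borel measure, and the Gauss-Green inequality. -/

section Total

theorem ofReal_setIntegral_divergence_le {E U : Set (Euc d)} {φ : Euc d → Euc d}
    (hφ : ContDiff ℝ 1 φ) (hc : HasCompactSupport φ) (hs : tsupport φ ⊆ U) {c : ℝ}
    (hcφ : ∀ x, ‖φ x‖ ≤ c) :
    ENNReal.ofReal (∫ x in E, divergence φ x) ≤ ENNReal.ofReal c * perimeterOpen E U := by
  have hc0 : 0 ≤ c := (norm_nonneg _).trans (hcφ 0)
  rcases hc0.eq_or_lt with rfl | hc0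
  · have : φ = 0 := by
      funext x
      simpa using hcφ x
    subst this
    have : divergence (0 : Euc d → Euc d) = 0 := by
      funext x
      exact divergence_zero_of_notMem_tsupport (by simp)
    simp [this]
  · have hT : IsTestField U (fun x => c⁻¹ • φ x) :=
      { contDiff := hφ.const_smul _
        hasCompactSupport := hc.smul_left (f := fun _ => c⁻¹)
        tsupport_subset := (tsupport_smul_subset_right (fun _ => c⁻¹) φ).trans hs
        norm_le_one := fun x => by
          rw [norm_smul, norm_inv, Real.norm_of_nonneg hc0.le, inv_mul_le_iff₀ hc0, mul_one]
          exact hcφ x }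
    have h := le_iSup₂ (f := fun (φ : Euc d → Euc d) (_ : IsTestField U φ) =>
      ENNReal.ofReal (∫ x in E, divergence φ x)) _ hT
    have hd : ∀ x, divergence φ x = c * divergence (fun x => c⁻¹ • φ x) x := fun x => by
      rw [divergence_const_smul _ (hφ.differentiable one_ne_zero x), mul_inv_cancel_left₀ hc0.ne']
    simp_rw [hd, integral_const_mul]
    rw [ENNReal.ofReal_mul hc0.le]
    gcongr
    exact h

theorem exists_smooth_partition {ι : Type*} [Fintype ι] {U : ι → Set (Euc d)}
    (hU : ∀ i, IsOpen (U i)) {K : Set (Euc d)} (hK : IsClosed K) (hKU : K ⊆ ⋃ i, U i) :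
    ∃ χ : ι → Euc d → ℝ, (∀ i, ContDiff ℝ 1 (χ i)) ∧ (∀ i x, 0 ≤ χ i x) ∧ (∀ i x, χ i x ≤ 1) ∧
      (∀ i, tsupport (χ i) ⊆ U i) ∧ ∀ x ∈ K, ∑ i, χ i x = 1 := by
  obtain ⟨f, hf⟩ := SmoothPartitionOfUnity.exists_isSubordinate
    (modelWithCornersSelf ℝ (Euc d)) hK U hU hKU
  refine ⟨fun i => f i, fun i => ?_, fun i x => f.nonneg i x, fun i x => f.le_one i x,
    hf, fun x hx => ?_⟩
  · exact (contMDiff_iff_contDiff.1 (f i).contMDiff).of_le (by exact_mod_cast le_top)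
  · rw [← f.sum_eq_one hx, finsum_eq_sum_of_fintype]

/-- A field supported in a finite union of open sets splits into fields supported in these. -/
theorem exists_field_decomposition {ι : Type*} [Fintype ι] {U : ι → Set (Euc d)}
    (hU : ∀ i, IsOpen (U i)) {φ : Euc d → Euc d} (hφ : ContDiff ℝ 1 φ) (hc : HasCompactSupport φ)
    (hs : tsupport φ ⊆ ⋃ i, U i) (E : Set (Euc d)) :
    ∃ ψ : ι → Euc d → Euc d, (∀ i, ContDiff ℝ 1 (ψ i)) ∧ (∀ i, HasCompactSupport (ψ i)) ∧
      (∀ i, tsupport (ψ i) ⊆ U i) ∧ (∀ i x, ‖ψ i x‖ ≤ ‖φ x‖) ∧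
      (∫ x in E, divergence φ x) = ∑ i, ∫ x in E, divergence (ψ i) x := by
  obtain ⟨χ, hχ, h0, h1, hsub, hsum⟩ := exists_smooth_partition hU (isClosed_tsupport φ) hs
  have hd : ∀ i, ContDiff ℝ 1 (fun x => χ i x • φ x) := fun i => (hχ i).smul hφ
  have hcs : ∀ i, HasCompactSupport (fun x => χ i x • φ x) := fun i => hc.smul_left (f := χ i)
  refine ⟨fun i x => χ i x • φ x, hd, hcs,
    fun i => (tsupport_smul_subset_left (χ i) φ).trans (hsub i), fun i x => ?_, ?_⟩
  · rw [norm_smul, Real.norm_of_nonneg (h0 i x)]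
    exact mul_le_of_le_one_left (norm_nonneg _) (h1 i x)
  · have hφd : ∀ x, divergence φ x = ∑ i, divergence (fun x => χ i x • φ x) x := by
      intro x
      have e : φ = fun x => ∑ i, χ i x • φ x := by
        funext x
        rw [← Finset.sum_smul]
        by_cases hx : x ∈ tsupport φ
        · rw [hsum x hx, one_smul]
        · rw [image_eq_zero_of_notMem_tsupport hx, smul_zero]
      calc divergence φ x = divergence (fun x => ∑ i, χ i x • φ x) x :=
            congrArg (fun ψ => divergence ψ x) e
        _ = _ := divergence_sum _ fun i _ => (hd i).differentiable one_ne_zero x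
    simp_rw [hφd]
    exact integral_finsetSum _ fun i _ => (integrable_divergence (hd i) (hcs i)).integrableOn

/-- Compactness of the support leaves finitely many open sets, and a partition of unity splits the
field among them. -/
theorem perimeterOpen_iUnion_le {E : Set (Euc d)} {U : ℕ → Set (Euc d)}
    (hU : ∀ i, IsOpen (U i)) : perimeterOpen E (⋃ i, U i) ≤ ∑' i, perimeterOpen E (U i) := by
  refine iSup₂_le fun φ hφ => ?_
  obtain ⟨t, ht⟩ := hφ.hasCompactSupport.elim_finite_subcover U hU hφ.tsupport_subset
  have ht' : tsupport φ ⊆ ⋃ i : t, U i := by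
    rwa [iUnion_subtype (fun i => i ∈ t) (fun i => U i)]
  obtain ⟨ψ, h1, h2, h3, h4, h5⟩ := exists_field_decomposition (fun i : t => hU i)
    hφ.contDiff hφ.hasCompactSupport ht' E
  rw [h5]
  refine (Finset.le_sum_of_subadditive ENNReal.ofReal ENNReal.ofReal_zero.le
    (fun _ _ => ENNReal.ofReal_add_le) _ _).trans ?_
  refine le_trans ?_ (ENNReal.sum_le_tsum t)
  rw [← Finset.sum_coe_sort t]
  refine Finset.sum_le_sum fun i _ => ?_
  exact le_iSup₂_of_le (ψ i) ⟨h1 i, h2 i, h3 i, fun x => (h4 i x).trans (hφ.norm_le_one x)⟩ le_rfl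

theorem perimeterOpen_empty (E : Set (Euc d)) : perimeterOpen E ∅ = 0 := by
  refine le_antisymm (iSup₂_le fun φ hφ => ?_) bot_le
  have : divergence φ = 0 := by
    funext x
    exact divergence_zero_of_notMem_tsupport fun h => hφ.tsupport_subset h
  simp [this]

theorem isTestField_zero (U : Set (Euc d)) : IsTestField U (0 : Euc d → Euc d) :=
  ⟨contDiff_const, HasCompactSupport.zero, by simp, by simp⟩

theorem IsTestField.add_of_disjoint {U V : Set (Euc d)} (h : Disjoint U V) {φ ψ : Euc d → Euc d}
    (hφ : IsTestField U φ) (hψ : IsTestField V ψ) :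
    IsTestField (U ∪ V) (fun x => φ x + ψ x) where
  contDiff := hφ.contDiff.add hψ.contDiff
  hasCompactSupport := hφ.hasCompactSupport.add hψ.hasCompactSupport
  tsupport_subset := (tsupport_add φ ψ).trans
    (union_subset_union hφ.tsupport_subset hψ.tsupport_subset)
  norm_le_one x := by
    by_cases hx : x ∈ tsupport φ
    · have : x ∉ tsupport ψ := fun h' =>
        disjoint_left.1 h (hφ.tsupport_subset hx) (hψ.tsupport_subset h')
      simpa [image_eq_zero_of_notMem_tsupport this] using hφ.norm_le_one x
    · simpa [image_eq_zero_of_notMem_tsupport hx] using hψ.norm_le_one x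

/-- Fields supported in disjoint open sets can be added without exceeding norm one. The cases of a
negative integral are separate because `ENNReal.ofReal` truncates. -/
theorem perimeterOpen_add_le {E U V : Set (Euc d)} (h : Disjoint U V) :
    perimeterOpen E U + perimeterOpen E V ≤ perimeterOpen E (U ∪ V) := by
  have key : ∀ φ, IsTestField U φ → ∀ ψ, IsTestField V ψ →
      ENNReal.ofReal (∫ x in E, divergence φ x) + ENNReal.ofReal (∫ x in E, divergence ψ x)
        ≤ perimeterOpen E (U ∪ V) := by
    intro φ hφ ψ hψ
    rcases le_total (∫ x in E, divergence φ x) 0 with h1 | h1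
    · rw [ENNReal.ofReal_of_nonpos h1, zero_add]
      exact (le_iSup₂_of_le ψ hψ le_rfl).trans (perimeterOpen_mono E subset_union_right)
    rcases le_total (∫ x in E, divergence ψ x) 0 with h2 | h2
    · rw [ENNReal.ofReal_of_nonpos h2, add_zero]
      exact (le_iSup₂_of_le φ hφ le_rfl).trans (perimeterOpen_mono E subset_union_left)
    rw [← ENNReal.ofReal_add h1 h2, ← integral_add
      (integrable_divergence hφ.contDiff hφ.hasCompactSupport).integrableOn
      (integrable_divergence hψ.contDiff hψ.hasCompactSupport).integrableOn]
    refine le_iSup₂_of_le _ (hφ.add_of_disjoint h hψ) ?_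
    refine le_of_eq ?_
    congr 2
    funext x
    exact (divergence_add (hφ.contDiff.differentiable one_ne_zero x)
      (hψ.contDiff.differentiable one_ne_zero x)).symm
  exact ENNReal.biSup_add_biSup_le' ⟨0, isTestField_zero U⟩ ⟨0, isTestField_zero V⟩ key

/-- The perimeter of `E` as an outer measure. -/
def perimeterOuter (E : Set (Euc d)) : OuterMeasure (Euc d) :=
  inducedOuterMeasure (fun U (_ : IsOpen U) => perimeterOpen E U) isOpen_empty
    (perimeterOpen_empty E)

theorem perimeterOuter_apply (E B : Set (Euc d)) : perimeterOuter E B = perimeter E B :=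
  inducedOuterMeasure_eq_iInf (P := IsOpen) (fun _ hf => isOpen_iUnion hf) (fun _ hf => perimeterOpen_iUnion_le hf)
    (fun _ _ _ _ h => perimeterOpen_mono E h) B

/-- Sets at positive distance have disjoint open thickenings, on which superadditivity applies. By
Carathéodory's criterion a metric outer measure makes all Borel sets measurable. -/
theorem isMetric_perimeterOuter (E : Set (Euc d)) : (perimeterOuter E).IsMetric := by
  intro A B hAB
  refine le_antisymm (measure_union_le A B) ?_
  simp only [perimeterOuter_apply]
  obtain ⟨r, hr0, hr⟩ := hAB
  obtain ⟨ε, hε, hεr⟩ : ∃ ε : ℝ, 0 < ε ∧ ENNReal.ofReal ε + ENNReal.ofReal ε ≤ r := by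
    obtain ⟨q, hq0, hq⟩ := ENNReal.lt_iff_exists_nnreal_btwn.1 (pos_iff_ne_zero.2 hr0)
    refine ⟨q / 2, by have := ENNReal.coe_pos.1 hq0; positivity, ?_⟩
    rw [← ENNReal.ofReal_add (by positivity) (by positivity), add_halves, ENNReal.ofReal_coe_nnreal]
    exact hq.le
  have hd : Disjoint (Metric.thickening ε A) (Metric.thickening ε B) := by
    rw [disjoint_left]
    intro z hzA hzB
    obtain ⟨x, hx, hzx⟩ := Metric.mem_thickening_iff.1 hzA
    obtain ⟨y, hy, hzy⟩ := Metric.mem_thickening_iff.1 hzB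
    have h1 := hr x hx y hy
    have h2 : edist x y ≤ edist x z + edist z y := edist_triangle _ _ _
    have h3 : edist x z < ENNReal.ofReal ε := by
      rwa [edist_comm, edist_dist, ENNReal.ofReal_lt_ofReal_iff hε]
    have h4 : edist z y < ENNReal.ofReal ε := by
      rwa [edist_dist, ENNReal.ofReal_lt_ofReal_iff hε]
    exact absurd (h1.trans h2) (not_le.2 ((ENNReal.add_lt_add h3 h4).trans_le hεr))
  refine le_iInf fun U => le_iInf fun hU => le_iInf fun hsub => ?_
  have hA : perimeter E A ≤ perimeterOpen E (U ∩ Metric.thickening ε A) :=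
    iInf_le_of_le _ (iInf_le_of_le (hU.inter Metric.isOpen_thickening) (iInf_le _
      (subset_inter (subset_union_left.trans hsub) (Metric.self_subset_thickening hε A))))
  have hB : perimeter E B ≤ perimeterOpen E (U ∩ Metric.thickening ε B) :=
    iInf_le_of_le _ (iInf_le_of_le (hU.inter Metric.isOpen_thickening) (iInf_le _
      (subset_inter (subset_union_right.trans hsub) (Metric.self_subset_thickening hε B))))
  calc perimeter E A + perimeter E B ≤ _ := add_le_add hA hB
    _ ≤ _ := perimeterOpen_add_le (hd.mono inter_subset_right inter_subset_right)
    _ ≤ _ := perimeterOpen_mono E (union_subset inter_subset_left inter_subset_left)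

/-- The perimeter of `E` as a Borel measure. -/
def perimeterMeasure (E : Set (Euc d)) : Measure (Euc d) :=
  (perimeterOuter E).toMeasure (isMetric_perimeterOuter E).le_caratheodory

theorem perimeterMeasure_apply (E : Set (Euc d)) {B : Set (Euc d)} (hB : MeasurableSet B) :
    perimeterMeasure E B = perimeter E B := by
  rw [perimeterMeasure, toMeasure_apply _ _ hB, perimeterOuter_apply]

theorem perimeterMeasure_isOpen (E : Set (Euc d)) {U : Set (Euc d)} (hU : IsOpen U) :
    perimeterMeasure E U = perimeterOpen E U := by
  rw [perimeterMeasure_apply E hU.measurableSet, perimeter_of_isOpen E hU]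

theorem exists_isOpen_perimeterMeasure_lt {E B : Set (Euc d)} (hB : MeasurableSet B)
    {c : ℝ≥0∞} (hc : perimeterMeasure E B < c) :
    ∃ U, IsOpen U ∧ B ⊆ U ∧ perimeterMeasure E U < c := by
  rw [perimeterMeasure_apply E hB] at hc
  simp only [perimeter, iInf_lt_iff] at hc
  obtain ⟨U, hU, hBU, h⟩ := hc
  exact ⟨U, hU, hBU, by rwa [perimeterMeasure_isOpen E hU]⟩

/-- The divergence of a test field vanishes off `U`, so only the Lebesgue class of the set inside
`U` is seen. -/
theorem perimeterOpen_congr {E F U : Set (Euc d)} (hU : MeasurableSet U)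
    (h : (E ∩ U : Set (Euc d)) =ᵐ[volume] (F ∩ U : Set (Euc d))) :
    perimeterOpen E U = perimeterOpen F U := by
  have key : ∀ (G : Set (Euc d)) (φ : Euc d → Euc d), IsTestField U φ →
      (∫ x in G, divergence φ x) = ∫ x in G ∩ U, divergence φ x := by
    intro G φ hφ
    rw [← setIntegral_indicator hU, indicator_eq_self.2]
    intro x hx
    by_contra h'
    exact hx (divergence_zero_of_notMem_tsupport fun h'' => h' (hφ.tsupport_subset h''))
  unfold perimeterOpen
  refine iSup_congr fun φ => iSup_congr fun hφ => ?_
  rw [key E φ hφ, key F φ hφ, setIntegral_congr_set h]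

/-- The Gauss-Green inequality: the flux of a compactly supported field through the boundary of
`E` is at most the integral of its norm against the perimeter measure. -/
theorem ofReal_setIntegral_divergence_le_lintegral {E : Set (Euc d)}
    (hE : ∀ r, 0 < r → perimeter E (Metric.ball 0 r) < ∞) {φ : Euc d → Euc d}
    (hφ : ContDiff ℝ 1 φ) (hc : HasCompactSupport φ) :
    ENNReal.ofReal (∫ x in E, divergence φ x) ≤ ∫⁻ x, ‖φ x‖ₑ ∂(perimeterMeasure E) := by
  obtain ⟨r, hr0, hr⟩ : ∃ r : ℝ, 0 < r ∧ tsupport φ ⊆ Metric.ball 0 r := by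
    obtain ⟨r, hr⟩ := hc.isBounded.subset_ball (0 : Euc d)
    exact ⟨max r 1, by positivity, hr.trans (Metric.ball_subset_ball (le_max_left _ _))⟩
  set U : Set (Euc d) := Metric.ball 0 r with hU
  have hUo : IsOpen U := Metric.isOpen_ball
  set μ := perimeterMeasure E with hμ
  have hfin : μ U < ∞ := by
    rw [hμ, perimeterMeasure_apply E hUo.measurableSet]
    exact hE r hr0
  obtain ⟨C, hC⟩ := hφ.continuous.bounded_above_of_compact_support hc
  have main : ∀ δ : ℝ, 0 < δ → ENNReal.ofReal (∫ x in E, divergence φ x) ≤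
      (∫⁻ x, ‖φ x‖ₑ ∂μ) + ENNReal.ofReal δ * (μ U + 1) := by
    intro δ hδ
    -- The range of `‖φ‖` is cut into `m` slices of width `δ`; `C < m * δ` makes them exhaust it.
    obtain ⟨m, hm⟩ := exists_nat_gt (max (C / δ) 1)
    have hm1 : (1 : ℝ) < m := (le_max_right _ _).trans_lt hm
    have hmC : C < m * δ := by
      have := (le_max_left _ _).trans_lt hm
      rwa [div_lt_iff₀ hδ] at this
    let B : Fin m → Set (Euc d) := fun i =>
      {x | x ∈ U ∧ (i : ℝ) * δ ≤ ‖φ x‖ ∧ ‖φ x‖ < ((i : ℝ) + 1) * δ}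
    have hcn : Continuous fun x => ‖φ x‖ := hφ.continuous.norm
    have hBm : ∀ i, MeasurableSet (B i) := fun i =>
      hUo.measurableSet.inter ((measurableSet_le measurable_const hcn.measurable).inter
        (measurableSet_lt hcn.measurable measurable_const))
    have hBU : ∀ i, B i ⊆ U := fun i x hx => hx.1
    have hBd : Pairwise (Function.onFun Disjoint B) := by
      intro i j hij
      refine disjoint_left.2 fun x hx hy => ?_
      have h1 : (i : ℝ) < (j : ℝ) + 1 := lt_of_mul_lt_mul_right (hx.2.1.trans_lt hy.2.2) hδ.le
      have h2 : (j : ℝ) < (i : ℝ) + 1 := lt_of_mul_lt_mul_right (hy.2.1.trans_lt hx.2.2) hδ.le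
      have h1' : (i : ℕ) < j + 1 := by exact_mod_cast h1
      have h2' : (j : ℕ) < i + 1 := by exact_mod_cast h2
      exact hij (Fin.ext (by omega))
    have hcover : U ⊆ ⋃ i, B i := by
      intro x hx
      have h0 : 0 ≤ ‖φ x‖ / δ := by positivity
      have hlt : ‖φ x‖ / δ < m := by
        rw [div_lt_iff₀ hδ]
        exact (hC x).trans_lt hmC
      refine mem_iUnion.2 ⟨⟨⌊‖φ x‖ / δ⌋₊, (Nat.floor_lt h0).2 hlt⟩, hx, ?_, ?_⟩
      · exact (le_div_iff₀ hδ).1 (Nat.floor_le h0)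
      · exact (div_lt_iff₀ hδ).1 (Nat.lt_floor_add_one _)
    -- Each of the `m` slices is weighted by at most `m * δ`, so an excess of `m⁻²` per slice adds
    -- up to `δ`.
    have hη : ((m : ℝ≥0∞) ^ 2)⁻¹ ≠ 0 := by simp
    have hV : ∀ i, ∃ V, IsOpen V ∧ B i ⊆ V ∧ μ V < μ (B i) + ((m : ℝ≥0∞) ^ 2)⁻¹ := fun i =>
      exists_isOpen_perimeterMeasure_lt (hBm i)
        (ENNReal.lt_add_right ((measure_mono (hBU i)).trans_lt hfin).ne hη)
    choose V hVo hBV hVlt using hV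
    -- Only the upper bound of the slice is kept, so that `W i` is open; the lower bound is used
    -- later, on `B i` itself.
    let W : Fin m → Set (Euc d) := fun i => V i ∩ {x | ‖φ x‖ < ((i : ℝ) + 1) * δ}
    have hWo : ∀ i, IsOpen (W i) := fun i => (hVo i).inter (isOpen_lt hcn continuous_const)
    have hsW : tsupport φ ⊆ ⋃ i, W i := (hr.trans hcover).trans
      (iUnion_mono fun i x hx => ⟨hBV i hx, hx.2.2⟩)
    obtain ⟨ψ, h1, h2, h3, h4, h5⟩ := exists_field_decomposition hWo hφ hc hsW E
    have hterm : ∀ i, ENNReal.ofReal (∫ x in E, divergence (ψ i) x) ≤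
        (∫⁻ x in B i, (‖φ x‖ₑ + ENNReal.ofReal δ) ∂μ) +
          ENNReal.ofReal (m * δ) * ((m : ℝ≥0∞) ^ 2)⁻¹ := by
      intro i
      have hbound : ∀ x, ‖ψ i x‖ ≤ ((i : ℝ) + 1) * δ := by
        intro x
        by_cases hx : x ∈ tsupport (ψ i)
        · exact (h4 i x).trans (h3 i hx).2.le
        · rw [image_eq_zero_of_notMem_tsupport hx, norm_zero]
          positivity
      have him : ((i : ℝ) + 1) ≤ m := by exact_mod_cast i.2
      calc ENNReal.ofReal (∫ x in E, divergence (ψ i) x)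
          ≤ ENNReal.ofReal (((i : ℝ) + 1) * δ) * perimeterOpen E (W i) :=
            ofReal_setIntegral_divergence_le (h1 i) (h2 i) (h3 i) hbound
        _ ≤ ENNReal.ofReal (((i : ℝ) + 1) * δ) * (μ (B i) + ((m : ℝ≥0∞) ^ 2)⁻¹) := by
            gcongr
            rw [← perimeterMeasure_isOpen E (hWo i)]
            exact (measure_mono inter_subset_left).trans (hVlt i).le
        _ ≤ _ := by
            rw [mul_add]
            gcongr
            rw [← setLIntegral_const]
            refine setLIntegral_mono' (hBm i) fun x hx => ?_
            rw [← ofReal_norm, ← ENNReal.ofReal_add (norm_nonneg _) hδ.le]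
            refine ENNReal.ofReal_le_ofReal ?_
            linarith [hx.2.1]
    have hm0 : (m : ℝ≥0∞) ≠ 0 := by
      have : 0 < m := by exact_mod_cast (zero_lt_one.trans hm1)
      simpa using this.ne'
    calc ENNReal.ofReal (∫ x in E, divergence φ x)
        ≤ ∑ i, ENNReal.ofReal (∫ x in E, divergence (ψ i) x) := by
          rw [h5]
          exact Finset.le_sum_of_subadditive ENNReal.ofReal ENNReal.ofReal_zero.le
            (fun _ _ => ENNReal.ofReal_add_le) _ _
      _ ≤ ∑ i, ((∫⁻ x in B i, (‖φ x‖ₑ + ENNReal.ofReal δ) ∂μ) +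
          ENNReal.ofReal (m * δ) * ((m : ℝ≥0∞) ^ 2)⁻¹) := Finset.sum_le_sum fun i _ => hterm i
      _ = (∫⁻ x in ⋃ i, B i, (‖φ x‖ₑ + ENNReal.ofReal δ) ∂μ) + ENNReal.ofReal δ := by
          rw [Finset.sum_add_distrib, lintegral_iUnion hBm hBd, tsum_fintype]
          congr 1
          rw [Finset.sum_const, Finset.card_univ, Fintype.card_fin, nsmul_eq_mul,
            ENNReal.ofReal_mul (by positivity), ENNReal.ofReal_natCast,
            show (m : ℝ≥0∞) * (m * ENNReal.ofReal δ * ((m : ℝ≥0∞) ^ 2)⁻¹) =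
              ENNReal.ofReal δ * ((m : ℝ≥0∞) ^ 2 * ((m : ℝ≥0∞) ^ 2)⁻¹) by ring,
            ENNReal.mul_inv_cancel (pow_ne_zero _ hm0) (by simp), mul_one]
      _ ≤ (∫⁻ x in U, (‖φ x‖ₑ + ENNReal.ofReal δ) ∂μ) + ENNReal.ofReal δ := by
          gcongr
          exact iUnion_subset hBU
      _ = (∫⁻ x in U, ‖φ x‖ₑ ∂μ) + ENNReal.ofReal δ * (μ U + 1) := by
          rw [lintegral_add_right _ measurable_const, setLIntegral_const, mul_add, mul_one,
            add_assoc]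
      _ ≤ _ := by
          gcongr
          exact Measure.restrict_le_self
  have hlim : Tendsto (fun δ : ℝ => (∫⁻ x, ‖φ x‖ₑ ∂μ) + ENNReal.ofReal δ * (μ U + 1))
      (𝓝[>] 0) (𝓝 ((∫⁻ x, ‖φ x‖ₑ ∂μ) + 0 * (μ U + 1))) := by
    refine tendsto_const_nhds.add (ENNReal.Tendsto.mul_const ?_ (Or.inr ?_))
    · have := (ENNReal.continuous_ofReal.tendsto 0).mono_left (nhdsWithin_le_nhds (s := Ioi 0))
      simpa using this
    · exact ENNReal.add_ne_top.2 ⟨hfin.ne, ENNReal.one_ne_top⟩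
  rw [zero_mul, add_zero] at hlim
  exact ge_of_tendsto hlim (eventually_mem_nhdsWithin.mono fun δ hδ => main δ hδ)

end Total

end IsoPartition

end

/-! ### Radial maps and the Piola transform. -/

noncomputable section

namespace IsoPartition

variable {d : ℕ}

/-- The radial map `x ↦ h(|x|²) x`. -/
def radialMap (h : ℝ → ℝ) (x : Euc d) : Euc d := h (‖x‖ ^ 2) • x

/-- The profiles `h` for which `x ↦ h(|x|²) x` is an orientation preserving diffeomorphism. -/
structure IsRadialProfile (h : ℝ → ℝ) : Prop where
  contDiff : ContDiff ℝ 2 h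
  exists_le : ∃ c, 0 < c ∧ ∀ t, c ≤ h t
  deriv_pos : ∀ t, 0 ≤ t → 0 < h t + 2 * t * deriv h t

namespace IsRadialProfile

variable {h : ℝ → ℝ}

theorem pos (H : IsRadialProfile h) (t : ℝ) : 0 < h t := by
  obtain ⟨c, hc, hle⟩ := H.exists_le
  exact hc.trans_le (hle t)

theorem differentiable (H : IsRadialProfile h) : Differentiable ℝ h :=
  H.contDiff.differentiable two_ne_zero

theorem contDiff_deriv (H : IsRadialProfile h) : ContDiff ℝ 1 (deriv h) :=
  ContDiff.iterate_deriv' 1 1 H.contDiff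

theorem contDiff_one (H : IsRadialProfile h) : ContDiff ℝ 1 h :=
  H.contDiff.of_le one_le_two

end IsRadialProfile

theorem hasFDerivAt_normSq (x : Euc d) :
    HasFDerivAt (fun y : Euc d => ‖y‖ ^ 2) ((2 : ℝ) • innerSL ℝ x) x := by
  simpa [two_smul] using (hasStrictFDerivAt_norm_sq x).hasFDerivAt

theorem hasFDerivAt_comp_normSq {g : ℝ → ℝ} {x : Euc d} (hg : DifferentiableAt ℝ g (‖x‖ ^ 2)) :
    HasFDerivAt (fun y : Euc d => g (‖y‖ ^ 2)) ((2 * deriv g (‖x‖ ^ 2)) • innerSL ℝ x) x := by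
  have := hg.hasDerivAt.comp_hasFDerivAt x (hasFDerivAt_normSq x)
  rwa [smul_smul, mul_comm] at this

theorem hasFDerivAt_radialMap {h : ℝ → ℝ} {x : Euc d} (hh : DifferentiableAt ℝ h (‖x‖ ^ 2)) :
    HasFDerivAt (radialMap h) (h (‖x‖ ^ 2) • ContinuousLinearMap.id ℝ (Euc d) +
      ((2 * deriv h (‖x‖ ^ 2)) • innerSL ℝ x).smulRight x) x :=
  (hasFDerivAt_comp_normSq hh).smul (hasFDerivAt_id x)

/-- A rank-one perturbation of a multiple of the identity: this is the matrix determinant lemma. -/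
theorem det_smul_id_add_smulRight (hd : 1 ≤ d) {a : ℝ} (ha : a ≠ 0) (b : ℝ) (x : Euc d) :
    (a • ContinuousLinearMap.id ℝ (Euc d) + (b • innerSL ℝ x).smulRight x).det =
      a ^ (d - 1) * (a + b * ‖x‖ ^ 2) := by
  have hM : LinearMap.toMatrix (EuclideanSpace.basisFun (Fin d) ℝ).toBasis
      (EuclideanSpace.basisFun (Fin d) ℝ).toBasis
      ((a • ContinuousLinearMap.id ℝ (Euc d) + (b • innerSL ℝ x).smulRight x : Euc d →L[ℝ] Euc d) :
        Euc d →ₗ[ℝ] Euc d) =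
      a • (1 + Matrix.replicateCol Unit (fun i => b / a * x i) *
        Matrix.replicateRow Unit (fun i => x i)) := by
    ext i j
    simp [LinearMap.toMatrix_apply, Matrix.one_apply, Matrix.mul_apply,
      EuclideanSpace.inner_single_right]
    field_simp
    split_ifs <;> ring
  rw [ContinuousLinearMap.det, ← LinearMap.det_toMatrix
    (EuclideanSpace.basisFun (Fin d) ℝ).toBasis, hM, Matrix.det_smul,
    Matrix.det_one_add_replicateCol_mul_replicateRow, EuclideanSpace.real_norm_sq_eq]
  simp only [dotProduct, Fintype.card_fin]
  have : ∑ i, x i * (b / a * x i) = b / a * ∑ i, x i ^ 2 := by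
    rw [Finset.mul_sum]
    exact Finset.sum_congr rfl fun i _ => by ring
  rw [this]
  obtain ⟨n, rfl⟩ : ∃ n, d = n + 1 := ⟨d - 1, by omega⟩
  simp only [Nat.add_sub_cancel, pow_succ a n]
  field_simp

theorem divergence_comp_radialMap {h : ℝ → ℝ} {φ : Euc d → Euc d} {x : Euc d}
    (hh : DifferentiableAt ℝ h (‖x‖ ^ 2)) (hφ : DifferentiableAt ℝ φ (radialMap h x)) :
    divergence (fun y => φ (radialMap h y)) x = h (‖x‖ ^ 2) * divergence φ (radialMap h x) +
      2 * deriv h (‖x‖ ^ 2) * inner ℝ x (fderiv ℝ φ (radialMap h x) x) := by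
  have e : fderiv ℝ (fun y => φ (radialMap h y)) x = _ :=
    (hφ.hasFDerivAt.comp x (hasFDerivAt_radialMap hh)).fderiv
  unfold divergence
  rw [e, PiLp.inner_apply, Finset.mul_sum, Finset.mul_sum, ← Finset.sum_add_distrib]
  refine Finset.sum_congr rfl fun i _ => ?_
  simp [EuclideanSpace.inner_single_right]
  ring

theorem divergence_id (x : Euc d) : divergence (fun y => y) x = d := by
  simp [divergence]

/-- The Piola transform of a field `φ` under the radial map of profile `h`. -/
def piola (h : ℝ → ℝ) (φ : Euc d → Euc d) (x : Euc d) : Euc d :=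
  (h (‖x‖ ^ 2) ^ (d - 1) * (1 + 2 * ‖x‖ ^ 2 * deriv h (‖x‖ ^ 2) / h (‖x‖ ^ 2))) •
      φ (radialMap h x) -
    (2 * h (‖x‖ ^ 2) ^ (d - 1) * deriv h (‖x‖ ^ 2) / h (‖x‖ ^ 2) *
      inner ℝ x (φ (radialMap h x))) • x

/-- The transform multiplies the component of `φ` along `x` by `M = h^(d-1)` and the components
orthogonal to `x` by `D`, so its norm is at most the larger factor. For `d = 1` there are no
orthogonal directions and `D` needs no bound. -/
theorem norm_piola_le {h : ℝ → ℝ} (H : IsRadialProfile h) (φ : Euc d → Euc d) {x : Euc d} {c : ℝ}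
    (h1 : h (‖x‖ ^ 2) ^ (d - 1) ≤ c)
    (h2 : d ≠ 1 → h (‖x‖ ^ 2) ^ (d - 1) *
      (1 + 2 * ‖x‖ ^ 2 * deriv h (‖x‖ ^ 2) / h (‖x‖ ^ 2)) ≤ c) :
    ‖piola h φ x‖ ≤ c * ‖φ (radialMap h x)‖ := by
  unfold piola
  set p := φ (radialMap h x)
  set t := ‖x‖ ^ 2 with ht
  have ht0 : 0 ≤ t := by positivity
  have hpos := H.pos t
  set M := h t ^ (d - 1) with hM
  have hM0 : 0 < M := pow_pos hpos _
  set L := 2 * M * deriv h t / h t with hL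
  set D := M * (1 + 2 * t * deriv h t / h t) with hD
  have hDL : D = M + t * L := by rw [hD, hL]; ring
  have hD0 : 0 < D := by
    refine mul_pos hM0 ?_
    have := div_pos (H.deriv_pos t ht0) hpos
    rwa [add_div, div_self hpos.ne'] at this
  have hc0 : 0 ≤ c := hM0.le.trans h1
  set a := inner ℝ x p with ha
  have hCS : a ^ 2 ≤ t * ‖p‖ ^ 2 := by
    rw [ht, ← mul_pow]
    exact sq_le_sq' (by linarith [neg_le_of_abs_le (abs_real_inner_le_norm x p)])
      (real_inner_le_norm x p)
  -- The right side is affine in `a ^ 2`, which ranges over `[0, t‖p‖²]`: it equals `D²‖p‖²` at one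
  -- end and `M²‖p‖²` at the other, and the sign of `L` tells which is larger.
  have hsq : ‖D • p - (L * a) • x‖ ^ 2 = D ^ 2 * ‖p‖ ^ 2 - a ^ 2 * L * (D + M) := by
    rw [norm_sub_sq_real, norm_smul, norm_smul, real_inner_smul_left, real_inner_smul_right,
      real_inner_comm, ← ha, mul_pow, mul_pow, Real.norm_eq_abs, Real.norm_eq_abs, sq_abs, sq_abs,
      ← ht]
    have : M = D - t * L := by linarith
    rw [this]
    ring
  refine le_of_sq_le_sq ?_ (by positivity)
  rw [hsq, mul_pow c]
  have hMD : 0 < M + D := by positivity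
  have hcase : D ^ 2 * ‖p‖ ^ 2 - t * ‖p‖ ^ 2 * L * (D + M) = M ^ 2 * ‖p‖ ^ 2 := by
    rw [hDL]; ring
  have hMc : M ^ 2 * ‖p‖ ^ 2 ≤ c ^ 2 * ‖p‖ ^ 2 := by gcongr
  by_cases hd1 : d = 1
  · have : a ^ 2 = t * ‖p‖ ^ 2 := by
      subst hd1
      rw [ha, ht, EuclideanSpace.real_norm_sq_eq, EuclideanSpace.real_norm_sq_eq]
      simp [PiLp.inner_apply]
      ring
    rw [this, hcase]
    exact hMc
  · rcases le_total 0 L with hL0 | hL0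
    · have : D ^ 2 * ‖p‖ ^ 2 ≤ c ^ 2 * ‖p‖ ^ 2 := by
        gcongr
        exact h2 hd1
      have : 0 ≤ a ^ 2 * L * (D + M) := by positivity
      linarith
    · have : a ^ 2 * (-L) * (D + M) ≤ t * ‖p‖ ^ 2 * (-L) * (D + M) := by
        have : 0 ≤ -L := by linarith
        gcongr
      linarith

theorem divergence_radial_combination {h D L : ℝ → ℝ} {φ : Euc d → Euc d} {x : Euc d}
    (hh : DifferentiableAt ℝ h (‖x‖ ^ 2)) (hD : DifferentiableAt ℝ D (‖x‖ ^ 2))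
    (hL : DifferentiableAt ℝ L (‖x‖ ^ 2)) (hφ : DifferentiableAt ℝ φ (radialMap h x)) :
    divergence (fun y => D (‖y‖ ^ 2) • φ (radialMap h y) -
      (L (‖y‖ ^ 2) * inner ℝ y (φ (radialMap h y))) • y) x =
    D (‖x‖ ^ 2) * (h (‖x‖ ^ 2) * divergence φ (radialMap h x) +
      2 * deriv h (‖x‖ ^ 2) * inner ℝ x (fderiv ℝ φ (radialMap h x) x)) +
    2 * deriv D (‖x‖ ^ 2) * inner ℝ x (φ (radialMap h x)) -
    (L (‖x‖ ^ 2) * inner ℝ x (φ (radialMap h x)) * d +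
      (2 * deriv L (‖x‖ ^ 2) * ‖x‖ ^ 2 * inner ℝ x (φ (radialMap h x)) +
        L (‖x‖ ^ 2) * (inner ℝ x (φ (radialMap h x)) + (h (‖x‖ ^ 2) +
          2 * deriv h (‖x‖ ^ 2) * ‖x‖ ^ 2) * inner ℝ x (fderiv ℝ φ (radialMap h x) x)))) := by
  have hp : HasFDerivAt (fun y => φ (radialMap h y)) _ x :=
    hφ.hasFDerivAt.comp x (hasFDerivAt_radialMap hh)
  have hq : HasFDerivAt (fun y => L (‖y‖ ^ 2) * inner ℝ y (φ (radialMap h y))) _ x :=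
    (hasFDerivAt_comp_normSq hL).mul ((hasFDerivAt_id x).inner ℝ hp)
  have hi : DifferentiableAt ℝ (fun y : Euc d => y) x := differentiableAt_id
  have hqs : DifferentiableAt ℝ
      (fun y => (L (‖y‖ ^ 2) * inner ℝ y (φ (radialMap h y))) • y) x :=
    hq.differentiableAt.smul hi
  have hDp := hasFDerivAt_comp_normSq hD
  have e1 : divergence (fun y => D (‖y‖ ^ 2) • φ (radialMap h y) -
      (L (‖y‖ ^ 2) * inner ℝ y (φ (radialMap h y))) • y) x =
      divergence (fun y => D (‖y‖ ^ 2) • φ (radialMap h y) +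
      (-1 : ℝ) • ((L (‖y‖ ^ 2) * inner ℝ y (φ (radialMap h y))) • y)) x := by
    simp only [neg_one_smul, sub_eq_add_neg]
  rw [e1, divergence_add (hDp.differentiableAt.fun_smul hp.differentiableAt)
    (hqs.fun_const_smul _), divergence_const_smul _ hqs,
    divergence_smul hDp.differentiableAt hp.differentiableAt,
    divergence_smul hq.differentiableAt hi, divergence_id, hDp.fderiv, hq.fderiv,
    divergence_comp_radialMap hh hφ]
  simp [real_inner_smul_right, inner_add_right]
  ring

/-- The Piola identity. With `D` and `L` the two coefficients of the transform, the terms in `⟨x, Dφ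
x⟩` cancel because `2 h' D = L (h + 2 t h')`, those in `⟨x, φ⟩` because `2 D' = (d + 1) L + 2 t L'`.
The derivative of `L` cancels without being computed. -/
theorem divergence_piola (hd : 1 ≤ d) {h : ℝ → ℝ} (H : IsRadialProfile h) {φ : Euc d → Euc d}
    (hφ : ContDiff ℝ 1 φ) (x : Euc d) :
    divergence (piola h φ) x = (h (‖x‖ ^ 2) ^ (d - 1) *
      (h (‖x‖ ^ 2) + 2 * deriv h (‖x‖ ^ 2) * ‖x‖ ^ 2)) * divergence φ (radialMap h x) := by
  set t := ‖x‖ ^ 2 with ht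
  have hh := H.differentiable t
  have hh' := (H.contDiff_deriv.differentiable one_ne_zero) t
  have hpos := H.pos t
  have hM : HasDerivAt (fun t => h t ^ (d - 1)) _ t := hh.hasDerivAt.pow (d - 1)
  have hL : DifferentiableAt ℝ (fun t => 2 * h t ^ (d - 1) * deriv h t / h t) t := by
    exact (((hh.pow _).const_mul 2).mul hh').div hh hpos.ne'
  have hDe : (fun t => h t ^ (d - 1) * (1 + 2 * t * deriv h t / h t)) =
      fun t => h t ^ (d - 1) + t * (2 * h t ^ (d - 1) * deriv h t / h t) := by
    funext t
    ring
  have hD := hM.add ((hasDerivAt_id t).mul hL.hasDerivAt)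
  have hD' := hD
  change HasDerivAt (fun t => h t ^ (d - 1) + t * (2 * h t ^ (d - 1) * deriv h t / h t)) _ t at hD'
  rw [← hDe] at hD'
  have key := divergence_radial_combination (x := x) hh hD'.differentiableAt hL
    (hφ.differentiable one_ne_zero _)
  refine (show divergence (piola h φ) x = _ from key).trans ?_
  rw [← ht, hD'.deriv]
  set L' := deriv (fun t => 2 * h t ^ (d - 1) * deriv h t / h t) t
  obtain ⟨n, rfl⟩ : ∃ n, d = n + 1 := ⟨d - 1, by omega⟩
  -- The derivative of `h ^ (d - 1)` carries the truncated exponent `d - 1 - 1`, so `d = 1` is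
  -- treated apart.
  rcases n with _ | n
  · simp
    field_simp
    ring
  · simp only [Nat.add_sub_cancel, id]
    push_cast
    field_simp
    ring

theorem contDiff_radialMap {h : ℝ → ℝ} (H : IsRadialProfile h) :
    ContDiff ℝ 1 (radialMap h : Euc d → Euc d) :=
  (H.contDiff_one.comp (contDiff_norm_sq ℝ)).smul contDiff_id

theorem contDiff_piola {h : ℝ → ℝ} (H : IsRadialProfile h) {φ : Euc d → Euc d}
    (hφ : ContDiff ℝ 1 φ) : ContDiff ℝ 1 (piola h φ) := by
  have hn : ContDiff ℝ 1 (fun x : Euc d => ‖x‖ ^ 2) := contDiff_norm_sq ℝ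
  have h1 : ContDiff ℝ 1 (fun x : Euc d => h (‖x‖ ^ 2)) := H.contDiff_one.comp hn
  have h2 : ContDiff ℝ 1 (fun x : Euc d => deriv h (‖x‖ ^ 2)) := H.contDiff_deriv.comp hn
  have h3 : ContDiff ℝ 1 (fun x : Euc d => φ (radialMap h x)) := hφ.comp (contDiff_radialMap H)
  have h0 : ∀ x : Euc d, h (‖x‖ ^ 2) ≠ 0 := fun x => (H.pos _).ne'
  refine ContDiff.sub (ContDiff.smul ((h1.pow _).mul ((contDiff_const (c := (1 : ℝ))).add
    (((contDiff_const.mul hn).mul h2).div h1 h0))) h3)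
    (ContDiff.smul ((((contDiff_const.mul (h1.pow _)).mul h2).div h1 h0).mul
      (contDiff_id.inner ℝ h3)) contDiff_id)

end IsoPartition

end

/-! ### Radial diffeomorphisms: change of variables and perimeter of images. -/

noncomputable section

namespace IsoPartition

variable {d : ℕ} {h : ℝ → ℝ}

theorem norm_radialMap (H : IsRadialProfile h) (x : Euc d) :
    ‖radialMap h x‖ = ‖x‖ * h (‖x‖ ^ 2) := by
  rw [radialMap, norm_smul, Real.norm_of_nonneg (H.pos _).le, mul_comm]

theorem IsRadialProfile.strictMonoOn (H : IsRadialProfile h) :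
    StrictMonoOn (fun r => r * h (r ^ 2)) (Ici 0) := by
  have hder : ∀ r : ℝ, HasDerivAt (fun r => r * h (r ^ 2))
      (h (r ^ 2) + 2 * r ^ 2 * deriv h (r ^ 2)) r := by
    intro r
    have := (hasDerivAt_id r).mul ((H.differentiable (r ^ 2)).hasDerivAt.comp r (hasDerivAt_pow 2 r))
    refine this.congr_deriv ?_
    simp
    ring
  refine strictMonoOn_of_deriv_pos (convex_Ici 0)
    (fun r _ => (hder r).continuousAt.continuousWithinAt) fun r _ => ?_
  rw [(hder r).deriv]
  exact H.deriv_pos _ (sq_nonneg r)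

theorem injective_radialMap (H : IsRadialProfile h) :
    Function.Injective (radialMap h : Euc d → Euc d) := by
  intro x y hxy
  have hn : ‖x‖ = ‖y‖ := by
    refine H.strictMonoOn.injOn (norm_nonneg x) (norm_nonneg y) ?_
    have := congrArg norm hxy
    rwa [norm_radialMap H, norm_radialMap H] at this
  rw [radialMap, radialMap, hn] at hxy
  exact smul_right_injective _ (H.pos _).ne' hxy

/-- The lower bound on `h` makes `r * h (r ^ 2)` reach every value, so the preimage is found on the
ray of `y` by the intermediate value theorem. -/
theorem surjective_radialMap (H : IsRadialProfile h) :
    Function.Surjective (radialMap h : Euc d → Euc d) := by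
  intro y
  obtain ⟨c, hc, hle⟩ := H.exists_le
  have hcont : ContinuousOn (fun r => r * h (r ^ 2)) (Icc 0 (‖y‖ / c)) := by
    have := H.contDiff.continuous
    fun_prop
  have hmem : ‖y‖ ∈ Icc (0 * h (0 ^ 2)) (‖y‖ / c * h ((‖y‖ / c) ^ 2)) := by
    constructor
    · simp
    · calc ‖y‖ = ‖y‖ / c * c := by field_simp
        _ ≤ _ := by gcongr; exact hle _
  obtain ⟨r, hr, hry⟩ := intermediate_value_Icc (by positivity) hcont hmem
  rcases eq_or_ne y 0 with rfl | hy
  · exact ⟨0, by simp [radialMap]⟩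
  have hy' : 0 < ‖y‖ := norm_pos_iff.2 hy
  refine ⟨(r / ‖y‖) • y, ?_⟩
  have hn : ‖(r / ‖y‖) • y‖ = r := by
    rw [norm_smul, Real.norm_of_nonneg (div_nonneg hr.1 hy'.le)]
    field_simp
  rw [radialMap, hn, smul_smul]
  have : h (r ^ 2) * (r / ‖y‖) = 1 := by
    rw [← mul_div_assoc, mul_comm]
    exact (congrArg (· / ‖y‖) hry).trans (div_self hy'.ne')
  rw [this, one_smul]

theorem continuous_radialMap (H : IsRadialProfile h) :
    Continuous (radialMap h : Euc d → Euc d) :=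
  (contDiff_radialMap H).continuous

theorem isCompact_preimage_radialMap (H : IsRadialProfile h) {K : Set (Euc d)}
    (hK : IsCompact K) : IsCompact (radialMap h ⁻¹' K) := by
  obtain ⟨c, hc, hle⟩ := H.exists_le
  obtain ⟨r, hr⟩ := hK.isBounded.subset_closedBall (0 : Euc d)
  refine (isCompact_closedBall (0 : Euc d) (r / c)).of_isClosed_subset
    (hK.isClosed.preimage (continuous_radialMap H)) fun x hx => ?_
  have h1 := hr hx
  rw [mem_closedBall_zero_iff, norm_radialMap H] at h1
  rw [mem_closedBall_zero_iff, le_div_iff₀ hc]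
  exact (mul_le_mul_of_nonneg_left (hle _) (norm_nonneg x)).trans h1

theorem tsupport_piola_subset (H : IsRadialProfile h) (φ : Euc d → Euc d) :
    tsupport (piola h φ) ⊆ radialMap h ⁻¹' tsupport φ := by
  refine closure_minimal (fun x hx => ?_)
    ((isClosed_tsupport φ).preimage (continuous_radialMap H))
  by_contra h'
  refine hx ?_
  have : φ (radialMap h x) = 0 := image_eq_zero_of_notMem_tsupport h'
  simp [piola, this]

theorem hasCompactSupport_piola (H : IsRadialProfile h) {φ : Euc d → Euc d}
    (hφ : HasCompactSupport φ) : HasCompactSupport (piola h φ) :=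
  (isCompact_preimage_radialMap H hφ).of_isClosed_subset (isClosed_tsupport _)
    (tsupport_piola_subset H φ)

theorem volume_image_radialMap_eq_zero (H : IsRadialProfile h) {E : Set (Euc d)}
    (hE : volume E = 0) : volume (radialMap h '' E) = 0 :=
  addHaar_image_eq_zero_of_differentiableOn_of_addHaar_eq_zero _
    ((contDiff_radialMap H).differentiable one_ne_zero).differentiableOn hE

/-- The regions are only null measurable while the area formula needs measurable sets; a
differentiable map sends the discarded null set to a null set. -/
theorem exists_measurableSet_image_radialMap_ae_eq (H : IsRadialProfile h) {E : Set (Euc d)}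
    (hE : NullMeasurableSet E) : ∃ E', MeasurableSet E' ∧ E =ᵐ[volume] E' ∧
      MeasurableSet (radialMap h '' E') ∧ radialMap h '' E =ᵐ[volume] radialMap h '' E' := by
  obtain ⟨E', hsub, hm, he⟩ := hE.exists_measurable_subset_ae_eq
  refine ⟨E', hm, he.symm, hm.image_of_continuousOn_injOn (continuous_radialMap H).continuousOn
    (injective_radialMap H).injOn, ?_⟩
  refine (Filter.EventuallyLE.antisymm (LE.le.eventuallyLE (image_mono hsub)) ?_).symm
  rw [ae_le_set, ← image_sdiff (injective_radialMap H)]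
  exact volume_image_radialMap_eq_zero H (ae_le_set.1 he.symm.le)

theorem nullMeasurableSet_image_radialMap (H : IsRadialProfile h) {E : Set (Euc d)}
    (hE : NullMeasurableSet E) : NullMeasurableSet (radialMap h '' E) := by
  obtain ⟨E', -, -, hm, he⟩ := exists_measurableSet_image_radialMap_ae_eq H hE
  exact ⟨_, hm, he⟩

/-- The Jacobian determinant of a radial map as a function of the squared norm. -/
def radialJacobian (d : ℕ) (h : ℝ → ℝ) (t : ℝ) : ℝ := h t ^ (d - 1) * (h t + 2 * deriv h t * t)

theorem radialJacobian_pos (H : IsRadialProfile h) {t : ℝ} (ht : 0 ≤ t) :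
    0 < radialJacobian d h t := by
  refine mul_pos (pow_pos (H.pos t) _) ?_
  have := H.deriv_pos t ht
  linarith

theorem setIntegral_image_radialMap (hd : 1 ≤ d) (H : IsRadialProfile h) {E : Set (Euc d)}
    (hE : NullMeasurableSet E) (g : Euc d → ℝ) :
    (∫ y in radialMap h '' E, g y) =
      ∫ x in E, radialJacobian d h (‖x‖ ^ 2) * g (radialMap h x) := by
  obtain ⟨E', hm, he, hm', he'⟩ := exists_measurableSet_image_radialMap_ae_eq H hE
  rw [setIntegral_congr_set he', setIntegral_congr_set he,
    integral_image_eq_integral_abs_det_fderiv_smul volume hm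
      (fun x _ => (hasFDerivAt_radialMap (H.differentiable _)).hasFDerivWithinAt)
      (injective_radialMap H).injOn]
  refine setIntegral_congr_fun hm fun x _ => ?_
  have hJ := radialJacobian_pos (d := d) H (sq_nonneg ‖x‖)
  simp only [smul_eq_mul]
  rw [det_smul_id_add_smulRight hd (H.pos _).ne']
  change |radialJacobian d h (‖x‖ ^ 2)| * _ = _
  rw [abs_of_pos hJ]

theorem volume_image_radialMap (hd : 1 ≤ d) (H : IsRadialProfile h) {E : Set (Euc d)}
    (hE : NullMeasurableSet E) :
    volume (radialMap h '' E) = ∫⁻ x in E, ENNReal.ofReal (radialJacobian d h (‖x‖ ^ 2)) := by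
  obtain ⟨E', hm, he, hm', he'⟩ := exists_measurableSet_image_radialMap_ae_eq H hE
  rw [measure_congr he', setLIntegral_congr he, ← lintegral_abs_det_fderiv_eq_addHaar_image volume hm
      (fun x _ => (hasFDerivAt_radialMap (H.differentiable _)).hasFDerivWithinAt)
      (injective_radialMap H).injOn]
  refine setLIntegral_congr_fun hm fun x _ => ?_
  have hJ := radialJacobian_pos (d := d) H (sq_nonneg ‖x‖)
  simp only
  rw [det_smul_id_add_smulRight hd (H.pos _).ne']
  change ENNReal.ofReal |radialJacobian d h (‖x‖ ^ 2)| = _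
  rw [abs_of_pos hJ]

/-- The perimeter of the image of a set under a radial map. -/
theorem perimeterOpen_image_radialMap_le (hd : 1 ≤ d) (H : IsRadialProfile h) {E : Set (Euc d)}
    (hE : NullMeasurableSet E) (hfin : ∀ r, 0 < r → perimeter E (Metric.ball 0 r) < ∞)
    {V : Set (Euc d)} (hV : IsOpen V) {J : ℝ → ℝ}
    (h1 : ∀ t, 0 ≤ t → h t ^ (d - 1) ≤ J t)
    (h2 : d ≠ 1 → ∀ t, 0 ≤ t → h t ^ (d - 1) * (1 + 2 * t * deriv h t / h t) ≤ J t) :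
    perimeterOpen (radialMap h '' E) V ≤
      ∫⁻ x in radialMap h ⁻¹' V, ENNReal.ofReal (J (‖x‖ ^ 2)) ∂(perimeterMeasure E) := by
  refine iSup₂_le fun φ hφ => ?_
  -- By the Piola identity the Jacobian of the change of variables is absorbed into the divergence
  -- of the pulled-back field.
  have e : (∫ x in radialMap h '' E, divergence φ x) = ∫ x in E, divergence (piola h φ) x := by
    rw [setIntegral_image_radialMap hd H hE]
    congr 1
    funext x
    rw [divergence_piola hd H hφ.contDiff, radialJacobian]
  rw [e]
  refine (ofReal_setIntegral_divergence_le_lintegral hfin (contDiff_piola H hφ.contDiff)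
    (hasCompactSupport_piola H hφ.hasCompactSupport)).trans ?_
  rw [← lintegral_indicator ((hV.preimage (continuous_radialMap H)).measurableSet)]
  refine lintegral_mono fun x => ?_
  by_cases hx : radialMap h x ∈ V
  · rw [indicator_of_mem (by exact hx), ← ofReal_norm]
    refine ENNReal.ofReal_le_ofReal ?_
    have hJ : 0 ≤ J (‖x‖ ^ 2) := (pow_pos (H.pos _) _).le.trans (h1 _ (sq_nonneg _))
    exact (norm_piola_le H φ (h1 _ (sq_nonneg _)) fun hd1 => h2 hd1 _ (sq_nonneg _)).trans
      (mul_le_of_le_one_right hJ (hφ.norm_le_one _))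
  · have : φ (radialMap h x) = 0 :=
      image_eq_zero_of_notMem_tsupport fun h' => hx (hφ.tsupport_subset h')
    simp [piola, this]

end IsoPartition

end

/-! ### Images of partitions as competitors. -/

noncomputable section

namespace IsoPartition

variable {d N : ℕ} {h : ℝ → ℝ}

theorem IsCone.closure {C : Set (Euc d)} (hC : IsCone C) : IsCone (closure C) := by
  intro t ht x hx
  exact map_mem_closure (continuous_const_smul t) hx (fun y hy => hC t ht y hy)

theorem IsCone.smul_mem_iff {C : Set (Euc d)} (hC : IsCone C) {t : ℝ} (ht : 0 < t) {x : Euc d} :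
    t • x ∈ C ↔ x ∈ C := by
  refine ⟨fun hx => ?_, fun hx => hC t ht x hx⟩
  have := hC t⁻¹ (inv_pos.2 ht) _ hx
  rwa [smul_smul, inv_mul_cancel₀ ht.ne', one_smul] at this

/-- A radial map does not change a set outside a cone off which the set is conical. -/
theorem mem_image_radialMap_iff_of_notMem (H : IsRadialProfile h) {C E : Set (Euc d)}
    (hC : IsCone C) (hE : IsCone (E \ C)) {x : Euc d} (hx : x ∉ C) :
    x ∈ radialMap h '' E ↔ x ∈ E := by
  obtain ⟨y, rfl⟩ := surjective_radialMap H x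
  rw [(injective_radialMap H).mem_set_image]
  have hpos := H.pos (‖y‖ ^ 2)
  have hy : y ∉ C := fun hy => hx (hC _ hpos _ hy)
  have := hE.smul_mem_iff hpos (x := y)
  rw [radialMap] at hx ⊢
  simp only [Set.mem_sdiff, hx, hy, not_false_eq_true, and_true] at this
  exact this.symm

theorem mem_image_radialMap_iff_of_eq_one (H : IsRadialProfile h) {E : Set (Euc d)} {x : Euc d}
    (hx : h (‖x‖ ^ 2) = 1) : x ∈ radialMap h '' E ↔ x ∈ E := by
  have : radialMap h x = x := by rw [radialMap, hx, one_smul]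
  conv_lhs => rw [← this]
  exact (injective_radialMap H).mem_set_image

theorem IsPartition.image_radialMap (H : IsRadialProfile h) {F : Fin N → Set (Euc d)}
    (hF : IsPartition F) : IsPartition (fun k => radialMap h '' F k) where
  nullMeasurableSet k := nullMeasurableSet_image_radialMap H (hF.nullMeasurableSet k)
  inter_null j k hjk := by
    rw [← image_inter (injective_radialMap H)]
    exact volume_image_radialMap_eq_zero H (hF.inter_null j k hjk)
  compl_iUnion_null := by
    rw [← image_iUnion,
      ← image_compl_eq ⟨injective_radialMap H, surjective_radialMap H⟩]
    exact volume_image_radialMap_eq_zero H hF.compl_iUnion_null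

/-- Comparison of perimeters in an open set that contains the support of the variation. -/
theorem IsIsoperimetricIn.sum_perimeter_le {X : Set (Euc d)} {F G : Fin N → Set (Euc d)}
    (hiso : IsIsoperimetricIn X F) (hG : IsPartition G)
    {K B : Set (Euc d)} (hK : IsCompact K) (hKX : K ⊆ X) (hKB : K ⊆ B) (hB : IsOpen B)
    (hGF : ∀ k, symmDiff (G k) (F k) ⊆ K)
    (hvol : ∀ k, volume (F k) < ∞ → volume (G k) = volume (F k)) :
    ∑ k, perimeterMeasure (F k) B ≤ ∑ k, perimeterMeasure (G k) B := by
  have hsd : ∀ k, G k \ K = F k \ K := by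
    intro k
    ext x
    have h' : x ∈ symmDiff (G k) (F k) → x ∈ K := fun hx => hGF k hx
    rw [mem_symmDiff] at h'
    simp only [Set.mem_sdiff]
    tauto
  have hKm := hK.isClosed.measurableSet
  -- The constraint concerns volumes inside `K`; it follows from equal total volumes after
  -- cancelling the finite common part outside `K`.
  have hle := hiso K hK hKX G hG hGF fun j hj => by
    have hj' : volume (F j) < ∞ := hj
    have h1 := measure_inter_add_sdiff (μ := volume) (G j) hKm
    have h2 := measure_inter_add_sdiff (μ := volume) (F j) hKm
    rw [hvol j hj', ← h2, hsd j] at h1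
    exact (ENNReal.add_left_inj (measure_ne_top_of_subset sdiff_subset hj'.ne)).1 h1
  have hle' : ∑ k, perimeterMeasure (F k) K ≤ ∑ k, perimeterMeasure (G k) K := by
    unfold partitionPerimeter at hle
    simp_rw [← perimeterMeasure_apply _ hKm] at hle
    rwa [ENNReal.div_le_iff (by simp) (by simp), ENNReal.div_mul_cancel (by simp) (by simp)] at hle
  have hsplit : ∀ E : Set (Euc d), perimeterMeasure E B =
      perimeterMeasure E K + perimeterMeasure E (B \ K) := by
    intro E
    rw [← measure_inter_add_sdiff B hKm, inter_eq_right.2 hKB]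
  -- Both partitions agree on the open set `B \ K`. Adding it passes from the compact `K` to the
  -- open set `B`, where the perimeter is a supremum over fields.
  have hout : ∀ k, perimeterMeasure (F k) (B \ K) = perimeterMeasure (G k) (B \ K) := by
    intro k
    have ho : IsOpen (B \ K) := hB.sdiff hK.isClosed
    rw [perimeterMeasure_isOpen _ ho, perimeterMeasure_isOpen _ ho]
    refine perimeterOpen_congr ho.measurableSet (Eq.eventuallyEq ?_)
    rw [← inter_sdiff_assoc, ← inter_sdiff_assoc, ← sdiff_inter_right_comm,
      ← sdiff_inter_right_comm, hsd k]
  simp_rw [hsplit, Finset.sum_add_distrib, hout]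
  gcongr

/-- The sum of the perimeter measures of the regions of a partition. -/
def totalPerimeter (F : Fin N → Set (Euc d)) : Measure (Euc d) := ∑ k, perimeterMeasure (F k)

theorem totalPerimeter_apply (F : Fin N → Set (Euc d)) (B : Set (Euc d)) :
    totalPerimeter F B = ∑ k, perimeterMeasure (F k) B := by
  simp [totalPerimeter]

theorem partitionPerimeter_eq (F : Fin N → Set (Euc d)) {B : Set (Euc d)} (hB : MeasurableSet B) :
    partitionPerimeter F B = totalPerimeter F B / 2 := by
  rw [totalPerimeter_apply, partitionPerimeter]
  simp_rw [perimeterMeasure_apply _ hB]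

theorem IsCaccioppoliPartition.totalPerimeter_ball_lt_top {F : Fin N → Set (Euc d)}
    (hF : IsCaccioppoliPartition F) (r : ℝ) : totalPerimeter F (Metric.ball 0 r) < ∞ := by
  refine (measure_mono (Metric.ball_subset_ball (le_max_left r 1))).trans_lt ?_
  rw [totalPerimeter_apply]
  refine ENNReal.sum_lt_top.2 fun k _ => ?_
  rw [perimeterMeasure_apply _ measurableSet_ball]
  exact hF.perimeter_lt_top k _ (by positivity)

theorem IsCaccioppoliPartition.isFiniteMeasureOnCompacts {F : Fin N → Set (Euc d)}
    (hF : IsCaccioppoliPartition F) : IsFiniteMeasureOnCompacts (totalPerimeter F) where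
  lt_top_of_isCompact K hK := by
    obtain ⟨r, hr⟩ := hK.isBounded.subset_ball (0 : Euc d)
    exact (measure_mono hr).trans_lt (hF.totalPerimeter_ball_lt_top r)

/-- The profile of the radial map that multiplies the volume element by `1 - s div(γ(|x|²) x)`. -/
def contraction (d : ℕ) (γ : ℝ → ℝ) (s t : ℝ) : ℝ := (1 - s * d * γ t) ^ (1 / (d : ℝ))

/-! ### The volume-adapted profile and its area factors. -/

section Contraction

variable {γ : ℝ → ℝ} {s M : ℝ}

/-- The smallness conditions that make `contraction d γ s` a radial profile. -/
structure IsSmallContraction (d : ℕ) (γ : ℝ → ℝ) (s M : ℝ) : Prop where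
  one_le : 1 ≤ d
  contDiff : ContDiff ℝ 2 γ
  norm_le : ∀ t, |γ t| ≤ M
  norm_deriv_le : ∀ t, |2 * t * deriv γ t| ≤ M
  pos : 0 < s
  small : s * (d + 1) * M ≤ 1 / 2

namespace IsSmallContraction

variable (S : IsSmallContraction d γ s M)
include S

theorem bound_nonneg : 0 ≤ M := (abs_nonneg _).trans (S.norm_le 0)

theorem small' : s * d * M ≤ 1 / 2 := by
  have h1 := S.small
  have h2 := mul_nonneg S.pos.le S.bound_nonneg
  linarith

theorem base_ge (t : ℝ) : 1 - s * d * M ≤ 1 - s * d * γ t := by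
  have := (abs_le.1 (S.norm_le t)).2
  have : s * d * γ t ≤ s * d * M := mul_le_mul_of_nonneg_left this (by have := S.pos; positivity)
  linarith

theorem base_pos (t : ℝ) : 0 < 1 - s * d * γ t := by
  linarith [S.base_ge t, S.small']

theorem d_pos : (0 : ℝ) < d := by exact_mod_cast S.one_le

theorem contraction_ge (t : ℝ) : 1 - s * d * M ≤ contraction d γ s t := by
  have h1 : 0 < 1 - s * d * M := by linarith [S.small']
  have h2 : 1 - s * d * M ≤ 1 := by
    have := mul_nonneg (mul_nonneg S.pos.le S.d_pos.le) S.bound_nonneg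
    linarith
  have hd1 : 1 / (d : ℝ) ≤ 1 := by
    rw [div_le_one S.d_pos]
    exact_mod_cast S.one_le
  calc 1 - s * d * M = (1 - s * d * M) ^ (1 : ℝ) := (Real.rpow_one _).symm
    _ ≤ (1 - s * d * M) ^ (1 / (d : ℝ)) := Real.rpow_le_rpow_of_exponent_ge h1 h2 hd1
    _ ≤ _ := Real.rpow_le_rpow h1.le (S.base_ge t) (by have := S.d_pos; positivity)

theorem contraction_pos (t : ℝ) : 0 < contraction d γ s t :=
  Real.rpow_pos_of_pos (S.base_pos t) _

theorem hasDerivAt_contraction (t : ℝ) : HasDerivAt (contraction d γ s)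
    (-s * deriv γ t * (1 - s * d * γ t) ^ (1 / (d : ℝ) - 1)) t := by
  have h1 : HasDerivAt γ (deriv γ t) t := (S.contDiff.differentiable two_ne_zero t).hasDerivAt
  have h2 := ((h1.const_mul (s * d)).const_sub 1).rpow_const (p := 1 / (d : ℝ))
    (Or.inl (S.base_pos t).ne')
  refine h2.congr_deriv ?_
  have := S.d_pos
  field_simp

theorem contraction_pow_mul_deriv (t : ℝ) :
    contraction d γ s t ^ (d - 1) * deriv (contraction d γ s) t = -s * deriv γ t := by
  rw [(S.hasDerivAt_contraction t).deriv, contraction, ← Real.rpow_mul_natCast (S.base_pos t).le,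
    mul_comm, mul_assoc, ← Real.rpow_add (S.base_pos t)]
  have hd := S.d_pos
  have : 1 / (d : ℝ) - 1 + 1 / (d : ℝ) * ((d - 1 : ℕ) : ℝ) = 0 := by
    rw [Nat.cast_sub S.one_le]
    field_simp
    push_cast
    ring
  rw [this, Real.rpow_zero, mul_one]

theorem contraction_pow (t : ℝ) : contraction d γ s t ^ d = 1 - s * d * γ t := by
  have hd := S.d_pos
  rw [contraction, ← Real.rpow_mul_natCast (S.base_pos t).le, one_div,
    inv_mul_cancel₀ hd.ne', Real.rpow_one]

/-- The Jacobian is `h^d + (2t/d)(h^d)'`, and `h^d` is affine in `γ` by the choice of the exponent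
`1 / d`. -/
theorem radialJacobian_contraction (t : ℝ) :
    radialJacobian d (contraction d γ s) t = 1 - s * (d * γ t + 2 * t * deriv γ t) := by
  have h1 := S.contraction_pow_mul_deriv t
  have h2 := S.contraction_pow t
  have h3 : contraction d γ s t ^ d = contraction d γ s t ^ (d - 1) * contraction d γ s t := by
    rw [← pow_succ, Nat.sub_add_cancel S.one_le]
  rw [radialJacobian, mul_add, ← h3, h2,
    show contraction d γ s t ^ (d - 1) * (2 * deriv (contraction d γ s) t * t) =
      2 * t * (contraction d γ s t ^ (d - 1) * deriv (contraction d γ s) t) by ring, h1]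
  ring

theorem radialJacobian_contraction_pos (t : ℝ) : 0 < radialJacobian d (contraction d γ s) t := by
  rw [S.radialJacobian_contraction]
  have h1 : s * (d * γ t + 2 * t * deriv γ t) ≤ s * ((d + 1) * M) := by
    refine mul_le_mul_of_nonneg_left ?_ S.pos.le
    have h1 := mul_le_mul_of_nonneg_left (abs_le.1 (S.norm_le t)).2 S.d_pos.le
    have h2 := (abs_le.1 (S.norm_deriv_le t)).2
    linarith
  have := S.small
  linarith

theorem isRadialProfile : IsRadialProfile (contraction d γ s) where
  contDiff := (contDiff_const.sub (contDiff_const.mul S.contDiff)).rpow_const_of_ne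
    fun t => (S.base_pos t).ne'
  exists_le := ⟨1 - s * d * M, by linarith [S.small'], S.contraction_ge⟩
  deriv_pos t _ := by
    have h1 := S.radialJacobian_contraction_pos t
    have h2 := pow_pos (S.contraction_pos t) (d - 1)
    have := (pos_iff_pos_of_mul_pos h1).1 h2
    linarith

/-- Bernoulli's inequality for the concave power `(d - 1) / d`. -/
theorem contraction_pow_pred_le (t : ℝ) :
    contraction d γ s t ^ (d - 1) ≤ 1 - s * ((d - 1 : ℕ) * γ t) := by
  have hd := S.d_pos
  have hp : 1 / (d : ℝ) * ((d - 1 : ℕ) : ℝ) ≤ 1 := by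
    rw [one_div, inv_mul_le_iff₀ hd, mul_one]
    exact_mod_cast Nat.sub_le _ _
  have := rpow_one_add_le_one_add_mul_self (s := -(s * d * γ t)) (by linarith [S.base_pos t])
    (p := 1 / (d : ℝ) * ((d - 1 : ℕ) : ℝ)) (by positivity) hp
  rw [contraction, ← Real.rpow_mul_natCast (S.base_pos t).le, sub_eq_add_neg]
  refine this.trans (le_of_eq ?_)
  field_simp
  ring

/-- Since `h^(d-1) h' = -s γ'`, the extra term is `2ts(-γ')/h`. Only its positive part is kept, and
there `h` is bounded below by `1 - s d M`. -/
theorem contraction_tangential_le {t : ℝ} (ht : 0 ≤ t) :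
    contraction d γ s t ^ (d - 1) *
      (1 + 2 * t * deriv (contraction d γ s) t / contraction d γ s t) ≤
    1 - s * ((d - 1 : ℕ) * γ t) + s / (1 - s * d * M) * (2 * t * max (-deriv γ t) 0) := by
  have h1 := S.contraction_pow_pred_le t
  have h2 := S.contraction_pow_mul_deriv t
  have hpos := S.contraction_pos t
  have e : contraction d γ s t ^ (d - 1) *
      (1 + 2 * t * deriv (contraction d γ s) t / contraction d γ s t) =
      contraction d γ s t ^ (d - 1) + 2 * t * (s * (-deriv γ t)) / contraction d γ s t := by
    rw [show s * (-deriv γ t) = -s * deriv γ t by ring, ← h2]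
    ring
  rw [e]
  refine add_le_add h1 ?_
  have hc : 0 < 1 - s * d * M := by linarith [S.small']
  have hs := S.pos
  calc 2 * t * (s * (-deriv γ t)) / contraction d γ s t
      ≤ 2 * t * (s * max (-deriv γ t) 0) / contraction d γ s t := by
        gcongr
        exact le_max_left _ _
    _ ≤ 2 * t * (s * max (-deriv γ t) 0) / (1 - s * d * M) := by
        gcongr
        exact S.contraction_ge t
    _ = _ := by ring

theorem contraction_radial_le {t : ℝ} (ht : 0 ≤ t) : contraction d γ s t ^ (d - 1) ≤
    1 - s * ((d - 1 : ℕ) * γ t) + s / (1 - s * d * M) * (2 * t * max (-deriv γ t) 0) := by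
  have hc : 0 < 1 - s * d * M := by linarith [S.small']
  have hs := S.pos
  have : 0 ≤ s / (1 - s * d * M) * (2 * t * max (-deriv γ t) 0) := by positivity
  linarith [S.contraction_pow_pred_le t]

theorem volume_image_contraction {E : Set (Euc d)} (hE : NullMeasurableSet E)
    (hfin : volume E < ∞) (hint : Integrable
      (fun x : Euc d => d * γ (‖x‖ ^ 2) + 2 * ‖x‖ ^ 2 * deriv γ (‖x‖ ^ 2)))
    (h0 : (∫ x in E, (d * γ (‖x‖ ^ 2) + 2 * ‖x‖ ^ 2 * deriv γ (‖x‖ ^ 2))) = 0) :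
    volume (radialMap (contraction d γ s) '' E) = volume E := by
  rw [volume_image_radialMap S.one_le S.isRadialProfile hE]
  have hc : IntegrableOn (fun _ : Euc d => (1 : ℝ)) E := integrableOn_const hfin.ne
  simp_rw [S.radialJacobian_contraction]
  rw [← ofReal_integral_eq_lintegral_ofReal]
  · rw [integral_sub hc (hint.integrableOn.const_mul s), integral_const_mul, h0]
    simp [Measure.real, ENNReal.ofReal_toReal hfin.ne]
  · exact hc.sub (hint.integrableOn.const_mul s)
  · refine Eventually.of_forall fun x => ?_
    have := S.radialJacobian_contraction_pos (‖x‖ ^ 2)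
    rw [S.radialJacobian_contraction] at this
    exact this.le

end IsSmallContraction

end Contraction

end IsoPartition

end

/-! ### The first variation inequality for volume-preserving radial fields. -/

noncomputable section

namespace IsoPartition

variable {d N : ℕ}

theorem continuous_comp_normSq {g : ℝ → ℝ} (hg : Continuous g) :
    Continuous (fun x : Euc d => g (‖x‖ ^ 2)) := by
  fun_prop

theorem exists_ball_of_hasCompactSupport {γ : ℝ → ℝ} (hc : HasCompactSupport γ) :
    ∃ b : ℝ, 0 < b ∧ ∀ t, b ^ 2 ≤ t → γ t = 0 ∧ deriv γ t = 0 := by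
  obtain ⟨r, hr⟩ := hc.isBounded.subset_ball (0 : ℝ)
  refine ⟨max r 1, by positivity, fun t ht => ?_⟩
  have h1 : (1 : ℝ) ≤ max r 1 := le_max_right _ _
  have : t ∉ tsupport γ := by
    intro h
    have h2 := hr h
    rw [mem_ball_zero_iff, Real.norm_eq_abs] at h2
    have h3 := (le_abs_self t).trans_lt h2
    have h4 : r ≤ max r 1 := le_max_left _ _
    nlinarith
  refine ⟨image_eq_zero_of_notMem_tsupport this, ?_⟩
  exact image_eq_zero_of_notMem_tsupport fun h' => this (tsupport_deriv_subset h')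

theorem hasCompactSupport_comp_normSq {g : ℝ → ℝ} {b : ℝ}
    (hg : ∀ t, b ^ 2 ≤ t → g t = 0) : HasCompactSupport (fun x : Euc d => g (‖x‖ ^ 2)) := by
  refine HasCompactSupport.of_support_subset_isCompact (isCompact_closedBall (0 : Euc d) |b|)
    fun x hx => ?_
  rw [mem_closedBall_zero_iff]
  by_contra h
  refine hx (hg _ ?_)
  rw [← sq_abs b]
  have := abs_nonneg b
  nlinarith

/-- The first variation of the perimeter with respect to the radial field `γ(|x|²) x`, under the
assumption that it preserves the volumes of the regions of finite volume at first order. -/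
theorem first_variation_radial (hd : 1 ≤ d) {P : Set (Euc d)} (hP : IsCone P)
    {F : Fin N → Set (Euc d)} (hF : IsCaccioppoliPartition F)
    (hF_cone : ∀ k, IsCone (F k \ closure P)) (hiso : IsIsoperimetricIn (closure P) F)
    {γ : ℝ → ℝ} (hγ : ContDiff ℝ 2 γ) (hc : HasCompactSupport γ)
    (hvol : ∀ k, volume (F k) < ∞ →
      (∫ x in F k, (d * γ (‖x‖ ^ 2) + 2 * ‖x‖ ^ 2 * deriv γ (‖x‖ ^ 2))) = 0) :
    (d - 1 : ℕ) * ∫ x, γ (‖x‖ ^ 2) ∂(totalPerimeter F) ≤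
      ∫ x, 2 * ‖x‖ ^ 2 * max (-deriv γ (‖x‖ ^ 2)) 0 ∂(totalPerimeter F) := by
  set μ := totalPerimeter F with hμ
  have : IsFiniteMeasureOnCompacts μ := hF.isFiniteMeasureOnCompacts
  obtain ⟨b, hb0, hb⟩ := exists_ball_of_hasCompactSupport hc
  have hγ' : Continuous (deriv γ) := hγ.continuous_deriv one_le_two
  obtain ⟨M₁, hM₁⟩ := hγ.continuous.bounded_above_of_compact_support hc
  obtain ⟨M₂, hM₂⟩ := (show Continuous fun t => 2 * t * deriv γ t by
    fun_prop).bounded_above_of_compact_support (hc.deriv.mul_left (f := fun t => 2 * t))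
  set M := max M₁ M₂
  have hM0 : 0 ≤ M := (norm_nonneg (γ 0)).trans ((hM₁ 0).trans (le_max_left _ _))
  set Q : Euc d → ℝ := fun x => 2 * ‖x‖ ^ 2 * max (-deriv γ (‖x‖ ^ 2)) 0 with hQ
  set Γ : Euc d → ℝ := fun x => γ (‖x‖ ^ 2) with hΓ
  have hgb : ∀ t, b ^ 2 ≤ t → 2 * t * max (-deriv γ t) 0 = 0 := fun t ht => by
    rw [(hb t ht).2]; simp
  have hQi : Integrable Q μ := by
    refine Continuous.integrable_of_hasCompactSupport ?_ ?_
    · exact continuous_comp_normSq (g := fun t => 2 * t * max (-deriv γ t) 0) (by fun_prop)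
    · exact hasCompactSupport_comp_normSq (g := fun t => 2 * t * max (-deriv γ t) 0) hgb
  have hΓi : Integrable Γ μ := by
    refine Continuous.integrable_of_hasCompactSupport ?_ ?_
    · exact continuous_comp_normSq hγ.continuous
    · exact hasCompactSupport_comp_normSq fun t ht => (hb t ht).1
  have hDi : Integrable
      (fun x : Euc d => d * γ (‖x‖ ^ 2) + 2 * ‖x‖ ^ 2 * deriv γ (‖x‖ ^ 2)) := by
    refine Continuous.integrable_of_hasCompactSupport ?_ ?_
    · exact continuous_comp_normSq (g := fun t => d * γ t + 2 * t * deriv γ t)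
        (by have := hγ.continuous; fun_prop)
    · refine hasCompactSupport_comp_normSq (g := fun t => d * γ t + 2 * t * deriv γ t) (b := b) ?_
      intro t ht
      simp [hb t ht]
  set B : Set (Euc d) := Metric.ball 0 (b + 1) with hB
  have hBo : IsOpen B := Metric.isOpen_ball
  have hBfin : μ B < ∞ := hF.totalPerimeter_ball_lt_top _
  have hsuppB : ∀ x : Euc d, x ∉ B → b ^ 2 ≤ ‖x‖ ^ 2 := by
    intro x hx
    rw [hB, mem_ball_zero_iff, not_lt] at hx
    gcongr
    linarith
  -- Below this threshold `s (d + 1) M ≤ 1 / 2`; the `+ 1` in the denominator covers `M = 0`.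
  set s₀ : ℝ := 1 / (2 * ((d + 1) * M + 1)) with hs₀
  have hs₀pos : 0 < s₀ := by positivity
  have main : ∀ s, 0 < s → s ≤ s₀ →
      (d - 1 : ℕ) * ∫ x, Γ x ∂μ ≤ 1 / (1 - s * d * M) * ∫ x, Q x ∂μ := by
    intro s hs hss
    have S : IsSmallContraction d γ s M :=
      { one_le := hd
        contDiff := hγ
        norm_le := fun t => (hM₁ t).trans (le_max_left _ _)
        norm_deriv_le := fun t => (hM₂ t).trans (le_max_right _ _)
        pos := hs
        small := by
          have h1 : s * ((d + 1) * M) ≤ s₀ * ((d + 1) * M) := by gcongr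
          have h2 : s₀ * ((d + 1) * M + 1) = 1 / 2 := by
            rw [hs₀]; field_simp
          have : s₀ * ((d + 1) * M + 1) = s₀ * ((d + 1) * M) + s₀ := by ring
          linarith [mul_assoc s ((d : ℝ) + 1) M] }
    have H := S.isRadialProfile
    set h := contraction d γ s with hh
    have hone : ∀ t, b ^ 2 ≤ t → h t = 1 := by
      intro t ht
      rw [hh, contraction, (hb t ht).1]
      simp
    have hcone := hP.closure
    set J : ℝ → ℝ := fun t => 1 - s * ((d - 1 : ℕ) * γ t) +
      s / (1 - s * d * M) * (2 * t * max (-deriv γ t) 0) with hJ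
    -- The map is the identity off `B`, so nothing enters `B` from outside.
    have hpre : radialMap h ⁻¹' B ⊆ B := by
      intro x hx
      by_contra hxB
      have : radialMap h x = x := by rw [radialMap, hone _ (hsuppB x hxB), one_smul]
      rw [mem_preimage, this] at hx
      exact hxB hx
    have hcomp : μ B ≤ ∑ k, perimeterMeasure (radialMap h '' F k) B := by
      rw [hμ, totalPerimeter_apply]
      refine hiso.sum_perimeter_le (hF.toIsPartition.image_radialMap H)
        (K := closure P ∩ Metric.closedBall 0 b)
        ((isCompact_closedBall _ _).inter_left isClosed_closure) inter_subset_left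
        (inter_subset_right.trans (Metric.closedBall_subset_ball (by linarith))) hBo
        (fun k x hx => ?_) (fun k hk => ?_)
      · by_contra hxK
        have hiff : x ∈ radialMap h '' F k ↔ x ∈ F k := by
          by_cases hxP : x ∈ closure P
          · have hxb : b < ‖x‖ := by
              by_contra! h'
              exact hxK ⟨hxP, mem_closedBall_zero_iff.2 h'⟩
            exact mem_image_radialMap_iff_of_eq_one H (hone _ (by gcongr))
          · exact mem_image_radialMap_iff_of_notMem H hcone (hF_cone k) hxP
        rw [mem_symmDiff] at hx
        tauto
      · exact S.volume_image_contraction (hF.nullMeasurableSet k) hk hDi (hvol k hk)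
    have hJ0 : ∀ t, 0 ≤ t → 0 ≤ J t := fun t ht =>
      (pow_pos (H.pos t) _).le.trans (S.contraction_radial_le ht)
    have hJe : ∀ x : Euc d, J (‖x‖ ^ 2) =
        1 - s * ((d - 1 : ℕ) * Γ x) + s / (1 - s * d * M) * Q x := fun x => rfl
    have hconst : IntegrableOn (fun _ : Euc d => (1 : ℝ)) B μ := integrableOn_const hBfin.ne
    have hJi : IntegrableOn (fun x : Euc d => J (‖x‖ ^ 2)) B μ := by
      simp_rw [hJe]
      exact (hconst.sub ((hΓi.integrableOn.const_mul _).const_mul s)).add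
        (hQi.integrableOn.const_mul _)
    have hle : μ B ≤ ENNReal.ofReal (∫ x in B, J (‖x‖ ^ 2) ∂μ) := by
      rw [ofReal_integral_eq_lintegral_ofReal hJi
        (Eventually.of_forall fun x => hJ0 _ (sq_nonneg _)), hμ, totalPerimeter,
        ← Measure.restrictₗ_apply, map_sum, lintegral_finsetSum_measure, ← totalPerimeter]
      simp only [Measure.restrictₗ_apply]
      refine hcomp.trans (Finset.sum_le_sum fun k _ => ?_)
      rw [perimeterMeasure_isOpen _ hBo]
      refine (perimeterOpen_image_radialMap_le hd H (hF.nullMeasurableSet k)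
        (hF.perimeter_lt_top k) hBo (J := J) (fun t ht => S.contraction_radial_le ht)
        (fun _ t ht => S.contraction_tangential_le ht)).trans ?_
      exact lintegral_mono_set hpre
    have hreal : μ.real B ≤ ∫ x in B, J (‖x‖ ^ 2) ∂μ :=
      (ENNReal.le_ofReal_iff_toReal_le hBfin.ne
        (integral_nonneg fun x => hJ0 _ (sq_nonneg _))).1 hle
    have hΓB : (∫ x in B, Γ x ∂μ) = ∫ x, Γ x ∂μ :=
      setIntegral_eq_integral_of_forall_compl_eq_zero fun x hx => (hb _ (hsuppB x hx)).1
    have hQB : (∫ x in B, Q x ∂μ) = ∫ x, Q x ∂μ :=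
      setIntegral_eq_integral_of_forall_compl_eq_zero fun x hx => hgb _ (hsuppB x hx)
    -- The finite term `μ.real B` stands on both sides of the comparison; after cancelling it one
    -- divides by `s`.
    have hcalc : (∫ x in B, J (‖x‖ ^ 2) ∂μ) = μ.real B - s * ((d - 1 : ℕ) * ∫ x, Γ x ∂μ) +
        s / (1 - s * d * M) * ∫ x, Q x ∂μ := by
      have hlin : IntegrableOn (fun x => 1 - s * ((d - 1 : ℕ) * Γ x)) B μ :=
        hconst.sub ((hΓi.integrableOn.const_mul _).const_mul s)
      simp_rw [hJe]
      rw [integral_add hlin (hQi.integrableOn.const_mul _), integral_sub hconst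
        ((hΓi.integrableOn.const_mul _).const_mul s), integral_const_mul, integral_const_mul,
        integral_const_mul, hΓB, hQB]
      simp
    rw [hcalc] at hreal
    have h1 : s * ((d - 1 : ℕ) * ∫ x, Γ x ∂μ) ≤ s * (1 / (1 - s * d * M) * ∫ x, Q x ∂μ) := by
      have : s * (1 / (1 - s * d * M) * ∫ x, Q x ∂μ) =
        s / (1 - s * d * M) * ∫ x, Q x ∂μ := by ring
      linarith
    exact le_of_mul_le_mul_left h1 hs
  have hlim : Tendsto (fun s : ℝ => 1 / (1 - s * d * M) * ∫ x, Q x ∂μ) (𝓝[>] 0)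
      (𝓝 (1 / (1 - 0 * d * M) * ∫ x, Q x ∂μ)) := by
    refine Tendsto.mono_left (ContinuousAt.tendsto ?_) nhdsWithin_le_nhds
    have : (1 - 0 * (d : ℝ) * M) ≠ 0 := by simp
    fun_prop (disch := exact this)
  simp only [zero_mul, sub_zero, div_one, one_mul] at hlim
  refine ge_of_tendsto hlim ?_
  filter_upwards [Ioc_mem_nhdsGT hs₀pos] with s hs
  exact main s hs.1 hs.2

end IsoPartition

end

/-! ### Test profiles, and integration of the differential inequality. -/

noncomputable section

namespace IsoPartition

/-- A smooth substitute for the function with value `B - A` up to `A`, slope `-1` on `[A, B]` and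
value `0` afterwards: the integral from `t` to `B` of a bump that equals one on the middle fraction
`θ` of the interval. -/
theorem exists_smooth_descent {A B θ : ℝ} (hAB : A < B) (hθ0 : 0 < θ) (hθ1 : θ < 1) :
    ∃ g : ℝ → ℝ, ContDiff ℝ 2 g ∧ (∀ t, 0 ≤ g t) ∧ (∀ t, g t ≤ B - A) ∧
      (∀ t ≤ A, θ * (B - A) ≤ g t) ∧ (∀ t, B ≤ t → g t = 0) ∧
      (∀ t, deriv g t ≤ 0) ∧ (∀ t, -1 ≤ deriv g t) ∧ ∀ t ∉ Ioo A B, deriv g t = 0 := by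
  let w : ContDiffBump ((A + B) / 2) :=
    { rIn := θ * ((B - A) / 2)
      rOut := (B - A) / 2
      rIn_pos := by have : 0 < B - A := by linarith
                    positivity
      rIn_lt_rOut := by nlinarith }
  have hwsupp : ∀ t, t ∉ Ioo A B → w t = 0 := by
    intro t ht
    refine w.zero_of_le_dist ?_
    change (B - A) / 2 ≤ _
    rw [Real.dist_eq]
    by_contra! h
    rw [abs_lt] at h
    exact ht ⟨by linarith, by linarith⟩
  have hwc : Continuous w := w.continuous
  have hwi : ∀ a b, IntervalIntegrable w volume a b := fun a b => hwc.intervalIntegrable a b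
  have hder : ∀ t, HasDerivAt (fun t => ∫ s in t..B, w s) (-w t) t := fun t =>
    intervalIntegral.integral_hasDerivAt_left (hwi t B)
      hwc.stronglyMeasurable.stronglyMeasurableAtFilter hwc.continuousAt
  have hd : deriv (fun t => ∫ s in t..B, w s) = fun t => -w t := funext fun t => (hder t).deriv
  have hanti : Antitone (fun t => ∫ s in t..B, w s) := antitone_of_deriv_nonpos
    (fun t => (hder t).differentiableAt) fun t => by rw [hd]; exact neg_nonpos.2 w.nonneg
  have hB : ∀ t, B ≤ t → (∫ s in t..B, w s) = 0 := by
    intro t ht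
    rw [intervalIntegral.integral_symm, neg_eq_zero]
    have : ∀ s ∈ uIcc B t, w s = 0 := fun s hs => hwsupp s fun h => by
      rw [uIcc_of_le ht] at hs
      exact absurd h.2 (not_lt.2 hs.1)
    rw [intervalIntegral.integral_congr (g := fun _ => (0 : ℝ)) this]
    simp
  have hA : ∀ t ≤ A, (∫ s in t..B, w s) = ∫ s in A..B, w s := by
    intro t ht
    rw [← intervalIntegral.integral_add_adjacent_intervals (hwi t A) (hwi A B)]
    have : ∀ s ∈ uIcc t A, w s = 0 := fun s hs => hwsupp s fun h => by
      rw [uIcc_of_le ht] at hs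
      exact absurd h.1 (not_lt.2 hs.2)
    rw [intervalIntegral.integral_congr (g := fun _ => (0 : ℝ)) this]
    simp
  have hle : (∫ s in A..B, w s) ≤ B - A := by
    have := intervalIntegral.integral_mono_on hAB.le (hwi A B)
      (intervalIntegrable_const (c := (1 : ℝ))) fun s _ => w.le_one
    simpa using this
  have hnn : ∀ t, 0 ≤ ∫ s in t..B, w s := fun t => by
    rw [← hB (max t B) (le_max_right _ _)]
    exact hanti (le_max_left _ _)
  refine ⟨fun t => ∫ s in t..B, w s, ?_, hnn, fun t => ?_, fun t ht => ?_, hB, fun t => ?_,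
    fun t => ?_, fun t ht => ?_⟩
  · rw [show (2 : WithTop ℕ∞) = 1 + 1 by norm_num, contDiff_succ_iff_deriv]
    refine ⟨fun t => (hder t).differentiableAt, by simp, ?_⟩
    rw [hd]
    exact w.contDiff.neg
  · rcases le_total t A with h | h
    · simp only [hA t h, hle]
    · exact (hanti h).trans hle
  · simp only [hA t ht]
    set p := (A + B) / 2 - θ * ((B - A) / 2) with hp
    set q := (A + B) / 2 + θ * ((B - A) / 2) with hq
    have hpA : A ≤ p := by rw [hp]; nlinarith
    have hqB : q ≤ B := by rw [hq]; nlinarith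
    have hpq : p ≤ q := by rw [hp, hq]; nlinarith
    have h1 : (∫ s in p..q, w s) = θ * (B - A) := by
      have : ∀ s ∈ uIcc p q, w s = 1 := fun s hs => w.one_of_mem_closedBall (by
        rw [uIcc_of_le hpq] at hs
        rw [Metric.mem_closedBall, Real.dist_eq]
        change _ ≤ θ * ((B - A) / 2)
        rw [abs_le]
        constructor <;> linarith [hs.1, hs.2])
      rw [intervalIntegral.integral_congr (g := fun _ => (1 : ℝ)) this]
      simp [hp, hq]
      ring
    rw [← h1]
    exact intervalIntegral.integral_mono_interval hpA hpq hqB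
      (Eventually.of_forall fun s => w.nonneg) (hwi A B)
  · rw [hd]; exact neg_nonpos.2 w.nonneg
  · rw [hd]; exact neg_le_neg w.le_one
  · rw [hd]; simp [hwsupp t ht]

/-- The descent is multiplied by a nondecreasing cutoff `χ`. The term `χ' g` is nonnegative, so
however steep the rise it does not contribute to the positive part of `-γ'`. -/
theorem exists_smooth_plateau {c₀ c₁ A B θ : ℝ} (hc : c₀ < c₁) (hAB : A < B)
    (hθ0 : 0 < θ) (hθ1 : θ < 1) :
    ∃ γ : ℝ → ℝ, ContDiff ℝ 2 γ ∧ HasCompactSupport γ ∧ (∀ t, 0 ≤ γ t) ∧ (∀ t, γ t ≤ B - A) ∧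
      (∀ t, c₁ ≤ t → t ≤ A → θ * (B - A) ≤ γ t) ∧ (∀ t ≤ c₀, γ t = 0) ∧ (∀ t, B ≤ t → γ t = 0) ∧
      (∀ t, max (-deriv γ t) 0 ≤ (Ioo A B).indicator 1 t) := by
  obtain ⟨g, hg, h0, h1, hA, hB, hneg, hge, hz⟩ := exists_smooth_descent hAB hθ0 hθ1
  set χ : ℝ → ℝ := fun t => Real.smoothTransition ((t - c₀) / (c₁ - c₀)) with hχ
  have hcc : 0 < c₁ - c₀ := by linarith
  have hχd : ContDiff ℝ 2 χ :=
    Real.smoothTransition.contDiff.comp ((contDiff_id.sub contDiff_const).div_const _)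
  have hχ0 : ∀ t, 0 ≤ χ t := fun t => Real.smoothTransition.nonneg _
  have hχ1 : ∀ t, χ t ≤ 1 := fun t => Real.smoothTransition.le_one _
  have hχm : Monotone χ := fun s t hst => Real.smoothTransition.monotone (by gcongr)
  have hχc0 : ∀ t ≤ c₀, χ t = 0 := fun t ht =>
    Real.smoothTransition.zero_of_nonpos (div_nonpos_of_nonpos_of_nonneg (by linarith) hcc.le)
  have hχc1 : ∀ t, c₁ ≤ t → χ t = 1 := fun t ht =>
    Real.smoothTransition.one_of_one_le ((one_le_div hcc).2 (by linarith))
  have hz0 : ∀ t ≤ c₀, χ t * g t = 0 := fun t ht => by rw [hχc0 t ht, zero_mul]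
  have hzB : ∀ t, B ≤ t → χ t * g t = 0 := fun t ht => by rw [hB t ht, mul_zero]
  refine ⟨fun t => χ t * g t, hχd.mul hg, ?_, fun t => mul_nonneg (hχ0 t) (h0 t), fun t => ?_,
    fun t ht htA => ?_, hz0, hzB, fun t => ?_⟩
  · refine HasCompactSupport.of_support_subset_isCompact (isCompact_Icc (a := c₀) (b := B))
      fun t ht => ?_
    by_contra h
    refine ht ?_
    rcases le_or_gt t c₀ with h' | h'
    · exact hz0 t h'
    · refine hzB t ?_
      by_contra! h''
      exact h ⟨h'.le, h''.le⟩
  · exact (mul_le_of_le_one_left (h0 t) (hχ1 t)).trans (h1 t)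
  · simp only [hχc1 t ht, one_mul]
    exact hA t htA
  · have hd : deriv (fun t => χ t * g t) t = deriv χ t * g t + χ t * deriv g t :=
      deriv_fun_mul (hχd.differentiable two_ne_zero t) (hg.differentiable two_ne_zero t)
    have hχ' : 0 ≤ deriv χ t := hχm.deriv_nonneg
    have hp := mul_nonneg hχ' (h0 t)
    rw [hd]
    by_cases ht : t ∈ Ioo A B
    · rw [indicator_of_mem ht, Pi.one_apply]
      refine max_le ?_ zero_le_one
      have : χ t * (-deriv g t) ≤ 1 * 1 := mul_le_mul (hχ1 t) (by linarith [hge t])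
        (by linarith [hneg t]) zero_le_one
      linarith
    · rw [indicator_of_notMem ht, hz t ht]
      refine max_le ?_ le_rfl
      linarith

/-- Integration of the differential inequality `n m(r) ≤ r m'(r)`, given in finite form. -/
theorem monotoneOn_div_pow {m : ℝ → ℝ} {R : ℝ} (hR : 0 < R) (n : ℕ) (hmR : m R = 0)
    (hm : ∀ ρ, 0 ≤ m ρ) (key : ∀ a b, R < a → a < b →
      n * ((b ^ 2 - a ^ 2) * m a) ≤ 2 * b ^ 2 * (m b - m a)) :
    MonotoneOn (fun ρ => m ρ / ρ ^ n) (Ici R) := by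
  intro a ha b hb hab
  have ha' : R ≤ a := ha
  have hb0 : 0 < b := hR.trans_le hb
  simp only
  -- The hypothesis `key` is available only for `a > R`; at `a = R` the quotient vanishes.
  rcases ha'.eq_or_lt with rfl | haR
  · rw [hmR, zero_div]
    exact div_nonneg (hm b) (pow_pos hb0 n).le
  rcases hab.eq_or_lt with rfl | hab
  · exact le_rfl
  have ha0 : 0 < a := hR.trans haR
  set ℓ := Real.log (b / a) with hℓ
  have hℓ0 : 0 < ℓ := Real.log_pos ((one_lt_div ha0).2 hab)
  have hexp : Real.exp ℓ = b / a := Real.exp_log (by positivity)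
  have hstep : ∀ c q, R < c → 1 < q → (1 + n / 2 * (1 - (q ^ 2)⁻¹)) * m c ≤ m (c * q) := by
    intro c q hc hq
    have hc0 : 0 < c := hR.trans hc
    have hq0 : 0 < q := zero_lt_one.trans hq
    have h := key c (c * q) hc (by nlinarith)
    have e : 2 * (c * q) ^ 2 * ((1 + n / 2 * (1 - (q ^ 2)⁻¹)) * m c) ≤
        2 * (c * q) ^ 2 * m (c * q) := by
      have : 2 * (c * q) ^ 2 * ((1 + n / 2 * (1 - (q ^ 2)⁻¹)) * m c) =
          2 * (c * q) ^ 2 * m c + n * (((c * q) ^ 2 - c ^ 2) * m c) := by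
        field_simp
      linarith
    exact le_of_mul_le_mul_left e (by positivity)
  -- The interval from `a` to `b` is divided into `k` geometric steps of ratio `(b / a)^(1/k)`. The
  -- product of the gains tends to `(b / a)^n`, so `m` is never differentiated.
  have hk : ∀ k : ℕ, 1 ≤ k →
      (1 + n / 2 * (1 - Real.exp (-(2 * ℓ) * (k : ℝ)⁻¹))) ^ k * m a ≤ m b := by
    intro k hk1
    have hk0 : (0 : ℝ) < k := by exact_mod_cast hk1
    set q := Real.exp (ℓ / k) with hq
    have hq1 : 1 < q := Real.one_lt_exp_iff.2 (by positivity)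
    have hqe : (q ^ 2)⁻¹ = Real.exp (-(2 * ℓ) * (k : ℝ)⁻¹) := by
      rw [hq, ← Real.exp_nat_mul, ← Real.exp_neg]
      congr 1
      push_cast
      field_simp
    rw [← hqe]
    have hind : ∀ i : ℕ, (1 + n / 2 * (1 - (q ^ 2)⁻¹)) ^ i * m a ≤ m (a * q ^ i) := by
      intro i
      induction i with
      | zero => simp
      | succ i ih =>
        have hf : 0 ≤ 1 + n / 2 * (1 - (q ^ 2)⁻¹) := by
          have : (q ^ 2)⁻¹ ≤ 1 := inv_le_one_of_one_le₀ (one_le_pow₀ hq1.le)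
          have : 0 ≤ 1 - (q ^ 2)⁻¹ := by linarith
          positivity
        have hRi : R < a * q ^ i := haR.trans_le (le_mul_of_one_le_right ha0.le
          (one_le_pow₀ hq1.le))
        calc (1 + n / 2 * (1 - (q ^ 2)⁻¹)) ^ (i + 1) * m a
            = (1 + n / 2 * (1 - (q ^ 2)⁻¹)) * ((1 + n / 2 * (1 - (q ^ 2)⁻¹)) ^ i * m a) := by ring
          _ ≤ (1 + n / 2 * (1 - (q ^ 2)⁻¹)) * m (a * q ^ i) := by gcongr
          _ ≤ m (a * q ^ i * q) := hstep _ _ hRi hq1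
          _ = _ := by rw [mul_assoc, ← pow_succ]
    have hqk : a * q ^ k = b := by
      rw [hq, ← Real.exp_nat_mul, mul_div_cancel₀ _ hk0.ne', hexp]
      field_simp
    have := hind k
    rwa [hqk] at this
  -- A difference quotient at `0` with increment `1 / k`; its limit `n * ℓ` is the exponent in the
  -- limit of the powers.
  have hlim1 : Tendsto (fun k : ℕ => (k : ℝ) * (n / 2 * (1 - Real.exp (-(2 * ℓ) * (k : ℝ)⁻¹))))
      atTop (𝓝 (n * ℓ)) := by
    have hder : HasDerivAt (fun u : ℝ => n / 2 * (1 - Real.exp (-(2 * ℓ) * u))) (n * ℓ) 0 := by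
      have := ((((hasDerivAt_id (0 : ℝ)).const_mul (-(2 * ℓ))).exp).const_sub 1).const_mul
        ((n : ℝ) / 2)
      refine this.congr_deriv ?_
      simp
      ring
    have h1 := hder.tendsto_slope_zero_right.comp
      (tendsto_inv_atTop_nhdsGT_zero.comp tendsto_natCast_atTop_atTop)
    refine h1.congr fun k => ?_
    simp
  have hlim2 := (Real.tendsto_one_add_pow_exp_of_tendsto hlim1).mul_const (m a)
  have hfin : Real.exp (n * ℓ) * m a ≤ m b :=
    le_of_tendsto hlim2 ((eventually_ge_atTop 1).mono fun k hk1 => hk k hk1)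
  rw [Real.exp_nat_mul, hexp, div_pow] at hfin
  rw [div_le_div_iff₀ (by positivity) (by positivity)]
  have : b ^ n / a ^ n * m a * a ^ n = m a * b ^ n := by field_simp
  rw [← this]
  gcongr

end IsoPartition

end

/-! ### Lagrange multipliers for the volume constraints. -/

noncomputable section

namespace IsoPartition

variable {d N : ℕ}

theorem integrable_comp_normSq {g : ℝ → ℝ} (hg : Continuous g) (hc : HasCompactSupport g)
    (μ : Measure (Euc d)) [IsFiniteMeasureOnCompacts μ] :
    Integrable (fun x : Euc d => g (‖x‖ ^ 2)) μ := by
  obtain ⟨b, -, hb⟩ := exists_ball_of_hasCompactSupport hc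
  exact (continuous_comp_normSq hg).integrable_of_hasCompactSupport
    (hasCompactSupport_comp_normSq fun t ht => (hb t ht).1)

/-- The first variation of the volume of `E` with respect to the radial field `γ(|x|²) x`. -/
def volumeVariation (E : Set (Euc d)) (γ : ℝ → ℝ) : ℝ :=
  ∫ x in E, (d * γ (‖x‖ ^ 2) + 2 * ‖x‖ ^ 2 * deriv γ (‖x‖ ^ 2))

theorem integrable_volumeVariation {γ : ℝ → ℝ} (hγ : ContDiff ℝ 2 γ) (hc : HasCompactSupport γ) :
    Integrable (fun x : Euc d => d * γ (‖x‖ ^ 2) + 2 * ‖x‖ ^ 2 * deriv γ (‖x‖ ^ 2)) := by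
  have h1 : Continuous (deriv γ) := hγ.continuous_deriv one_le_two
  have h2 := hγ.continuous
  exact integrable_comp_normSq (g := fun t => d * γ t + 2 * t * deriv γ t) (by fun_prop)
    ((hc.mul_left (f := fun _ => (d : ℝ))).add (hc.deriv.mul_left (f := fun t => 2 * t))) _

/-- The compactly supported `C²` functions on the line. -/
def compactlySupportedC2 : Submodule ℝ (ℝ → ℝ) where
  carrier := {γ | ContDiff ℝ 2 γ ∧ HasCompactSupport γ}
  add_mem' h h' := ⟨h.1.add h'.1, h.2.add h'.2⟩
  zero_mem' := ⟨contDiff_const, HasCompactSupport.zero⟩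
  smul_mem' c _ h := ⟨contDiff_const.smul h.1, h.2.smul_left (f := fun _ => c)⟩

open Classical in
/-- The first variations of the volumes of the regions of finite volume. -/
def volumeVariations (F : Fin N → Set (Euc d)) : compactlySupportedC2 →ₗ[ℝ] (Fin N → ℝ) where
  toFun γ k := if volume (F k) < ∞ then volumeVariation (F k) γ else 0
  map_add' γ η := by
    funext k
    simp only [Pi.add_apply]
    split_ifs
    · rw [volumeVariation, volumeVariation, volumeVariation, ← integral_add
        (integrable_volumeVariation γ.2.1 γ.2.2).integrableOn
        (integrable_volumeVariation η.2.1 η.2.2).integrableOn]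
      congr 1
      funext x
      rw [Submodule.coe_add, deriv_add (γ.2.1.differentiable two_ne_zero _)
        (η.2.1.differentiable two_ne_zero _), Pi.add_apply]
      ring
    · simp
  map_smul' c γ := by
    funext k
    simp only [Pi.smul_apply, RingHom.id_apply]
    split_ifs
    · rw [volumeVariation, volumeVariation, smul_eq_mul, ← integral_const_mul]
      congr 1
      funext x
      rw [Submodule.coe_smul, deriv_const_smul _ (γ.2.1.differentiable two_ne_zero _),
        Pi.smul_apply, smul_eq_mul, smul_eq_mul]
      ring
    · simp

/-- The first variation inequality for fields that do not preserve the volumes: the defect is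
controlled by the first variations of the volumes of the regions of finite volume. -/
theorem exists_first_variation_bound (hd : 1 ≤ d) {P : Set (Euc d)} (hP : IsCone P)
    {F : Fin N → Set (Euc d)} (hF : IsCaccioppoliPartition F)
    (hF_cone : ∀ k, IsCone (F k \ closure P)) (hiso : IsIsoperimetricIn (closure P) F) :
    ∃ C : ℝ, 0 ≤ C ∧ ∀ γ : compactlySupportedC2,
      (d - 1 : ℕ) * ∫ x, γ.1 (‖x‖ ^ 2) ∂(totalPerimeter F) ≤
        (∫ x, 2 * ‖x‖ ^ 2 * max (-deriv γ.1 (‖x‖ ^ 2)) 0 ∂(totalPerimeter F)) +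
          C * ∑ k, |volumeVariations F γ k| := by
  set μ := totalPerimeter F
  have : IsFiniteMeasureOnCompacts μ := hF.isFiniteMeasureOnCompacts
  set L := volumeVariations F
  -- The volume variations of different regions may be linearly dependent, so `L` is inverted on its
  -- range only and the inverse is then extended to all of `Fin N → ℝ`.
  obtain ⟨σ₀, hσ₀⟩ := L.rangeRestrict.exists_rightInverse_of_surjective L.range_rangeRestrict
  obtain ⟨σ, hσ⟩ := LinearMap.exists_extend σ₀
  have hLσ : ∀ γ, L (σ (L γ)) = L γ := by
    intro γ
    have h1 : σ (L γ) = σ₀ (L.rangeRestrict γ) := LinearMap.congr_fun hσ (L.rangeRestrict γ)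
    have h2 := LinearMap.congr_fun hσ₀ (L.rangeRestrict γ)
    rw [h1]
    exact congrArg Subtype.val h2
  -- Finitely many correcting fields, chosen before `γ`: the constant depends on them alone.
  let β : Fin N → compactlySupportedC2 := fun k => σ (fun j => if k = j then 1 else 0)
  have hσβ : ∀ y, σ y = ∑ k, y k • β k := fun y => σ.pi_apply_eq_sum_univ y
  let c : Fin N → ℝ := fun k => (d - 1 : ℕ) * |∫ x, (β k).1 (‖x‖ ^ 2) ∂μ| +
    ∫ x, 2 * ‖x‖ ^ 2 * |deriv (β k).1 (‖x‖ ^ 2)| ∂μ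
  have hc0 : ∀ k, 0 ≤ c k := fun k => add_nonneg (by positivity)
    (integral_nonneg fun x => by positivity)
  refine ⟨∑ k, c k, Finset.sum_nonneg fun k _ => hc0 k, fun γ => ?_⟩
  set y := L γ with hy
  -- The corrected field preserves the finite volumes, so the first variation inequality applies to
  -- it.
  set η : compactlySupportedC2 := γ - σ y with hη
  have hLη : L η = 0 := by rw [hη, map_sub, hLσ, sub_self]
  have hηe : ∀ t, η.1 t = γ.1 t - ∑ k, y k * (β k).1 t := by
    intro t
    rw [hη, hσβ]
    simp [Finset.sum_apply]
  have hηfun : η.1 = fun t => γ.1 t - ∑ k, y k * (β k).1 t := funext hηe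
  have hdiff : ∀ (ξ : compactlySupportedC2) t, DifferentiableAt ℝ ξ.1 t := fun ξ t =>
    ξ.2.1.differentiable two_ne_zero t
  have hηd : ∀ t, deriv η.1 t = deriv γ.1 t - ∑ k, y k * deriv (β k).1 t := by
    intro t
    rw [hηfun]
    refine HasDerivAt.deriv ((hdiff γ t).hasDerivAt.fun_sub
      (HasDerivAt.fun_sum fun k _ => ((hdiff (β k) t).hasDerivAt.const_mul (y k))))
  have hcd : ∀ ξ : compactlySupportedC2, Continuous (deriv ξ.1) := fun ξ =>
    ξ.2.1.continuous_deriv one_le_two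
  have hint : ∀ ξ : compactlySupportedC2, Integrable (fun x => ξ.1 (‖x‖ ^ 2)) μ := fun ξ =>
    integrable_comp_normSq ξ.2.1.continuous ξ.2.2 μ
  have hint' : ∀ ξ : compactlySupportedC2,
      Integrable (fun x : Euc d => 2 * ‖x‖ ^ 2 * |deriv ξ.1 (‖x‖ ^ 2)|) μ := fun ξ => by
    have := hcd ξ
    exact integrable_comp_normSq (g := fun t => 2 * t * |deriv ξ.1 t|) (by fun_prop)
      (ξ.2.2.deriv.norm.mul_left (f := fun t => 2 * t)) μ
  have hint'' : ∀ ξ : compactlySupportedC2,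
      Integrable (fun x : Euc d => 2 * ‖x‖ ^ 2 * max (-deriv ξ.1 (‖x‖ ^ 2)) 0) μ := fun ξ => by
    have := hcd ξ
    refine integrable_comp_normSq (g := fun t => 2 * t * max (-deriv ξ.1 t) 0) (by fun_prop)
      (HasCompactSupport.mul_left (f := fun t => 2 * t) ?_) μ
    exact ξ.2.2.deriv.comp_left (g := fun s => max (-s) 0) (by simp)
  have hvar := first_variation_radial hd hP hF hF_cone hiso η.2.1 η.2.2 fun k hk => by
    have := congrFun hLη k
    change (if volume (F k) < ∞ then volumeVariation (F k) η.1 else 0) = 0 at this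
    rwa [if_pos hk] at this
  have e1 : (∫ x, η.1 (‖x‖ ^ 2) ∂μ) =
      (∫ x, γ.1 (‖x‖ ^ 2) ∂μ) - ∑ k, y k * ∫ x, (β k).1 (‖x‖ ^ 2) ∂μ := by
    simp_rw [hηe]
    rw [integral_sub (hint γ) (integrable_finsetSum _ fun k _ => (hint (β k)).const_mul _),
      integral_finsetSum _ fun k _ => (hint (β k)).const_mul _]
    simp_rw [integral_const_mul]
  have e2 : (∫ x, 2 * ‖x‖ ^ 2 * max (-deriv η.1 (‖x‖ ^ 2)) 0 ∂μ) ≤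
      (∫ x, 2 * ‖x‖ ^ 2 * max (-deriv γ.1 (‖x‖ ^ 2)) 0 ∂μ) +
        ∑ k, |y k| * ∫ x, 2 * ‖x‖ ^ 2 * |deriv (β k).1 (‖x‖ ^ 2)| ∂μ := by
    simp_rw [← integral_const_mul |y _|]
    rw [← integral_finsetSum _ fun k _ => (hint' (β k)).const_mul _,
      ← integral_add (hint'' γ) (integrable_finsetSum _ fun k _ => (hint' (β k)).const_mul _)]
    refine integral_mono (hint'' η) ((hint'' γ).add
      (integrable_finsetSum _ fun k _ => (hint' (β k)).const_mul _)) fun x => ?_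
    simp only [hηd]
    set t := ‖x‖ ^ 2
    have ht : 0 ≤ t := sq_nonneg _
    have hs : ∑ k, y k * deriv (β k).1 t ≤ ∑ k, |y k| * |deriv (β k).1 t| :=
      Finset.sum_le_sum fun k _ => (le_abs_self _).trans (abs_mul _ _).le
    have hs0 : 0 ≤ ∑ k, |y k| * |deriv (β k).1 t| := Finset.sum_nonneg fun k _ => by positivity
    have hmax : max (-(deriv γ.1 t - ∑ k, y k * deriv (β k).1 t)) 0 ≤
        max (-deriv γ.1 t) 0 + ∑ k, |y k| * |deriv (β k).1 t| := by
      refine max_le ?_ (add_nonneg (le_max_right _ _) hs0)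
      linarith [le_max_left (-deriv γ.1 t) 0]
    calc 2 * t * max (-(deriv γ.1 t - ∑ k, y k * deriv (β k).1 t)) 0
        ≤ 2 * t * (max (-deriv γ.1 t) 0 + ∑ k, |y k| * |deriv (β k).1 t|) := by gcongr
      _ = _ := by
        rw [mul_add, Finset.mul_sum]
        congr 1
        exact Finset.sum_congr rfl fun k _ => by ring
  rw [e1, mul_sub] at hvar
  have e3 : (d - 1 : ℕ) * ∑ k, y k * ∫ x, (β k).1 (‖x‖ ^ 2) ∂μ ≤
      ∑ k, |y k| * ((d - 1 : ℕ) * |∫ x, (β k).1 (‖x‖ ^ 2) ∂μ|) := by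
    rw [Finset.mul_sum]
    refine Finset.sum_le_sum fun k _ => ?_
    have : y k * ∫ x, (β k).1 (‖x‖ ^ 2) ∂μ ≤ |y k| * |∫ x, (β k).1 (‖x‖ ^ 2) ∂μ| :=
      (le_abs_self _).trans (abs_mul _ _).le
    calc _ ≤ ((d - 1 : ℕ) : ℝ) * (|y k| * |∫ x, (β k).1 (‖x‖ ^ 2) ∂μ|) := by gcongr
      _ = _ := by ring
  have e4 : (∑ k, |y k| * ((d - 1 : ℕ) * |∫ x, (β k).1 (‖x‖ ^ 2) ∂μ|)) +
      ∑ k, |y k| * ∫ x, 2 * ‖x‖ ^ 2 * |deriv (β k).1 (‖x‖ ^ 2)| ∂μ ≤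
        (∑ k, c k) * ∑ k, |y k| := by
    rw [← Finset.sum_add_distrib, Finset.mul_sum]
    refine Finset.sum_le_sum fun k _ => ?_
    rw [← mul_add, mul_comm]
    gcongr
    exact Finset.single_le_sum (f := c) (fun k _ => hc0 k) (Finset.mem_univ k)
  linarith

/-- The first variation of the volume is controlled by the perimeter. -/
theorem abs_volumeVariation_le {E : Set (Euc d)}
    (hE : ∀ r, 0 < r → perimeter E (Metric.ball 0 r) < ∞) {γ : ℝ → ℝ} (hγ : ContDiff ℝ 2 γ)
    (hc : HasCompactSupport γ) :
    ENNReal.ofReal |volumeVariation E γ| ≤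
      ∫⁻ x, ‖γ (‖x‖ ^ 2) • x‖ₑ ∂(perimeterMeasure E) := by
  have hγ1 : ContDiff ℝ 1 γ := hγ.of_le one_le_two
  have hdiv : ∀ x : Euc d, divergence (fun x => γ (‖x‖ ^ 2) • x) x =
      d * γ (‖x‖ ^ 2) + 2 * ‖x‖ ^ 2 * deriv γ (‖x‖ ^ 2) := by
    intro x
    have h1 := hasFDerivAt_comp_normSq (x := x) (hγ1.differentiable one_ne_zero (‖x‖ ^ 2))
    rw [divergence_smul h1.differentiableAt differentiableAt_fun_id, divergence_id, h1.fderiv]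
    simp
    ring
  have hcd : ContDiff ℝ 1 (fun x : Euc d => γ (‖x‖ ^ 2) • x) :=
    (hγ1.comp (contDiff_norm_sq ℝ)).smul contDiff_id
  have hcs : HasCompactSupport (fun x : Euc d => γ (‖x‖ ^ 2) • x) := by
    obtain ⟨b, -, hb⟩ := exists_ball_of_hasCompactSupport hc
    exact (hasCompactSupport_comp_normSq fun t ht => (hb t ht).1).smul_right
  rw [volumeVariation]
  simp_rw [← hdiv]
  -- The Gauss-Green inequality is one-sided, so a negative integral is handled by reversing the
  -- field.
  rcases abs_cases (∫ x in E, divergence (fun x => γ (‖x‖ ^ 2) • x) x) with ⟨h, -⟩ | ⟨h, -⟩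
  · rw [h]
    exact ofReal_setIntegral_divergence_le_lintegral hE hcd hcs
  · have hneg : ∀ x, divergence (fun x : Euc d => (-1 : ℝ) • γ (‖x‖ ^ 2) • x) x =
        -divergence (fun x => γ (‖x‖ ^ 2) • x) x := fun x => by
      rw [divergence_const_smul _ (hcd.differentiable one_ne_zero _), neg_one_mul]
    rw [h, ← integral_neg]
    simp_rw [← hneg]
    have := ofReal_setIntegral_divergence_le_lintegral hE (hcd.const_smul (-1 : ℝ))
      (hcs.smul_left (f := fun _ => (-1 : ℝ)))
    refine this.trans (le_of_eq ?_)
    simp only [neg_one_smul, enorm_neg]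

end IsoPartition

end

/-! ### The annulus inequality and the two monotonicity statements. -/

noncomputable section

namespace IsoPartition

variable {d N : ℕ}

theorem perimeterMeasure_compl_closedBall_eq_zero {E : Set (Euc d)} {R : ℝ}
    (hE : E ⊆ Metric.ball 0 R) : perimeterMeasure E (Metric.closedBall 0 R)ᶜ = 0 := by
  have ho : IsOpen (Metric.closedBall (0 : Euc d) R)ᶜ := Metric.isClosed_closedBall.isOpen_compl
  have he : (E ∩ (Metric.closedBall 0 R)ᶜ : Set (Euc d)) = ∅ ∩ (Metric.closedBall 0 R)ᶜ := by
    rw [empty_inter, ← disjoint_iff_inter_eq_empty]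
    exact (disjoint_compl_right (a := Metric.closedBall (0 : Euc d) R)).mono_left
      (hE.trans Metric.ball_subset_closedBall)
  rw [perimeterMeasure_isOpen _ ho, perimeterOpen_congr ho.measurableSet he.eventuallyEq]
  refine le_antisymm (iSup₂_le fun φ _ => ?_) bot_le
  simp

/-- The exterior of the ball of squared radius `c`. -/
abbrev outside (d : ℕ) (c : ℝ) : Set (Euc d) := {x | c < ‖x‖ ^ 2}

theorem measurableSet_outside (c : ℝ) : MeasurableSet (outside d c) :=
  measurableSet_lt measurable_const (by fun_prop)

theorem outside_sq {R : ℝ} (hR : 0 ≤ R) : outside d (R ^ 2) = (Metric.closedBall 0 R)ᶜ := by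
  ext x
  simp [sq_lt_sq₀ hR (norm_nonneg x)]

theorem perimeterMeasure_lt_top {E : Set (Euc d)} {R : ℝ} (hR : 0 < R)
    (hE : ∀ r, 0 < r → perimeter E (Metric.ball 0 r) < ∞)
    (hsub : E ⊆ Metric.ball 0 R) (B : Set (Euc d)) : perimeterMeasure E B < ∞ := by
  refine (measure_mono (t := Metric.ball 0 (R + 1) ∪ (Metric.closedBall 0 R)ᶜ)
    fun x _ => ?_).trans_lt ((measure_union_le _ _).trans_lt ?_)
  · by_cases hx : x ∈ Metric.closedBall 0 R
    · exact Or.inl (Metric.closedBall_subset_ball (by linarith) hx)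
    · exact Or.inr hx
  · rw [perimeterMeasure_compl_closedBall_eq_zero hsub, add_zero,
      perimeterMeasure_apply _ measurableSet_ball]
    exact hE _ (by linarith)

open Classical in
/-- The perimeter outside a ball of the regions of finite volume. -/
def finitePerimeterOutside (F : Fin N → Set (Euc d)) (c : ℝ) : ℝ :=
  ∑ k, if volume (F k) < ∞ then (perimeterMeasure (F k)).real (outside d c) else 0

section Annulus

variable {P : Set (Euc d)} {F : Fin N → Set (Euc d)} {R : ℝ}

/-- The field `γ(|x|²) x` has norm at most `m * b` and vanishes where `|x|² ≤ c₀`, so its flux sees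
only the perimeter outside that ball. -/
theorem abs_volumeVariations_le (hR : 0 < R) (hF : IsCaccioppoliPartition F)
    (hF_fin : ∀ k, volume (F k) < ∞ → F k ⊆ Metric.ball 0 R) (γ : compactlySupportedC2)
    {c₀ m b : ℝ} (hb : 0 ≤ b) (h0 : ∀ t, 0 ≤ γ.1 t) (hm : ∀ t, γ.1 t ≤ m)
    (hc : ∀ t ≤ c₀, γ.1 t = 0) (hbz : ∀ t, b ^ 2 ≤ t → γ.1 t = 0) :
    ∑ k, |volumeVariations F γ k| ≤ m * b * finitePerimeterOutside F c₀ := by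
  have hm0 : 0 ≤ m := (h0 0).trans (hm 0)
  rw [finitePerimeterOutside, Finset.mul_sum]
  refine Finset.sum_le_sum fun k _ => ?_
  change |if volume (F k) < ∞ then volumeVariation (F k) γ.1 else 0| ≤ _
  split_ifs with hk
  · have h := abs_volumeVariation_le (hF.perimeter_lt_top k) γ.2.1 γ.2.2
    have h2 : ∫⁻ x, ‖γ.1 (‖x‖ ^ 2) • x‖ₑ ∂(perimeterMeasure (F k)) ≤
        ENNReal.ofReal (m * b) * perimeterMeasure (F k) (outside d c₀) := by
      rw [← setLIntegral_const, ← lintegral_indicator (measurableSet_outside c₀)]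
      refine lintegral_mono fun x => ?_
      by_cases hx : c₀ < ‖x‖ ^ 2
      · rw [indicator_of_mem (by exact hx), ← ofReal_norm, norm_smul, Real.norm_of_nonneg (h0 _)]
        refine ENNReal.ofReal_le_ofReal ?_
        rcases le_or_gt (b ^ 2) (‖x‖ ^ 2) with h' | h'
        · rw [hbz _ h', zero_mul]
          positivity
        · have : ‖x‖ ≤ b := (sq_le_sq₀ (norm_nonneg _) hb).1 h'.le
          exact mul_le_mul (hm _) this (norm_nonneg _) hm0
      · simp [hc _ (not_lt.1 hx)]
    have hfin := perimeterMeasure_lt_top hR (hF.perimeter_lt_top k) (hF_fin k hk) (outside d c₀)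
    have h3 := ENNReal.toReal_mono (ENNReal.mul_ne_top ENNReal.ofReal_ne_top hfin.ne) (h.trans h2)
    rwa [ENNReal.toReal_ofReal (abs_nonneg _), ENNReal.toReal_mul,
      ENNReal.toReal_ofReal (by positivity)] at h3
  · simp

/-- The first variation bound is tested with the plateau that rises between `c₀` and `r ^ 2` and
descends between `a ^ 2` and `b ^ 2`; then `θ → 1`. The last term is the price of changing finite
volumes. -/
theorem annulus_inequality_defect (hF : IsCaccioppoliPartition F) (hR : 0 < R)
    (hF_fin : ∀ k, volume (F k) < ∞ → F k ⊆ Metric.ball 0 R) {C : ℝ} (hC0 : 0 ≤ C)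
    (hC : ∀ γ : compactlySupportedC2,
      (d - 1 : ℕ) * ∫ x, γ.1 (‖x‖ ^ 2) ∂(totalPerimeter F) ≤
        (∫ x, 2 * ‖x‖ ^ 2 * max (-deriv γ.1 (‖x‖ ^ 2)) 0 ∂(totalPerimeter F)) +
          C * ∑ k, |volumeVariations F γ k|) {c₀ r a b : ℝ} (hr : 0 ≤ r) (hc : c₀ < r ^ 2)
    (ha : 0 ≤ a) (hab : a < b) :
    (d - 1 : ℕ) * ((b ^ 2 - a ^ 2) *
        (totalPerimeter F).real (Metric.ball 0 a \ Metric.ball 0 r)) ≤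
      2 * b ^ 2 * (totalPerimeter F).real (Metric.ball 0 b \ Metric.closedBall 0 a) +
        C * ((b ^ 2 - a ^ 2) * b * finitePerimeterOutside F c₀) := by
  set μ := totalPerimeter F
  have : IsFiniteMeasureOnCompacts μ := hF.isFiniteMeasureOnCompacts
  have hb0 : 0 < b := ha.trans_lt hab
  have hab2 : a ^ 2 < b ^ 2 := by gcongr
  have hSm : MeasurableSet (Metric.ball (0 : Euc d) a \ Metric.ball 0 r) :=
    measurableSet_ball.diff measurableSet_ball
  have hTm : MeasurableSet (Metric.ball (0 : Euc d) b \ Metric.closedBall 0 a) :=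
    measurableSet_ball.diff measurableSet_closedBall
  have hTfin : μ (Metric.ball (0 : Euc d) b \ Metric.closedBall 0 a) < ∞ :=
    (measure_mono sdiff_subset).trans_lt (hF.totalPerimeter_ball_lt_top b)
  have hSfin : μ (Metric.ball (0 : Euc d) a \ Metric.ball 0 r) < ∞ :=
    (measure_mono sdiff_subset).trans_lt (hF.totalPerimeter_ball_lt_top a)
  have main : ∀ θ : ℝ, 0 < θ → θ < 1 → (d - 1 : ℕ) * (θ * (b ^ 2 - a ^ 2) *
        μ.real (Metric.ball 0 a \ Metric.ball 0 r)) ≤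
      2 * b ^ 2 * μ.real (Metric.ball 0 b \ Metric.closedBall 0 a) +
        C * ((b ^ 2 - a ^ 2) * b * finitePerimeterOutside F c₀) := by
    intro θ hθ0 hθ1
    obtain ⟨g, hg, hgc, h0, hm, hge, hz, hzB, hneg⟩ := exists_smooth_plateau hc hab2 hθ0 hθ1
    let γ : compactlySupportedC2 := ⟨g, hg, hgc⟩
    have h1 := hC γ
    have h2 := abs_volumeVariations_le hR hF hF_fin γ hb0.le h0 hm hz hzB
    have h3 : θ * (b ^ 2 - a ^ 2) * μ.real (Metric.ball 0 a \ Metric.ball 0 r) ≤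
        ∫ x, g (‖x‖ ^ 2) ∂μ := by
      have e : θ * (b ^ 2 - a ^ 2) * μ.real (Metric.ball 0 a \ Metric.ball 0 r) =
          ∫ x, (Metric.ball (0 : Euc d) a \ Metric.ball 0 r).indicator
            (fun _ => θ * (b ^ 2 - a ^ 2)) x ∂μ := by
        rw [integral_indicator_const _ hSm, smul_eq_mul, mul_comm]
      rw [e]
      refine integral_mono ((integrable_indicator_iff hSm).2 (integrableOn_const hSfin.ne))
        (integrable_comp_normSq hg.continuous hgc μ) fun x => ?_
      by_cases hx : x ∈ Metric.ball (0 : Euc d) a \ Metric.ball 0 r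
      · rw [indicator_of_mem hx]
        have hx1 : ‖x‖ < a := mem_ball_zero_iff.1 hx.1
        have hx2 : r ≤ ‖x‖ := by simpa using hx.2
        exact hge _ (by gcongr) (by gcongr)
      · rw [indicator_of_notMem hx]
        exact h0 _
    have h4 : (∫ x, 2 * ‖x‖ ^ 2 * max (-deriv g (‖x‖ ^ 2)) 0 ∂μ) ≤
        2 * b ^ 2 * μ.real (Metric.ball 0 b \ Metric.closedBall 0 a) := by
      have e : 2 * b ^ 2 * μ.real (Metric.ball 0 b \ Metric.closedBall 0 a) =
          ∫ x, (Metric.ball (0 : Euc d) b \ Metric.closedBall 0 a).indicator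
            (fun _ => 2 * b ^ 2) x ∂μ := by
        rw [integral_indicator_const _ hTm, smul_eq_mul, mul_comm]
      rw [e]
      refine integral_mono_of_nonneg (Eventually.of_forall fun x => by positivity)
        ((integrable_indicator_iff hTm).2 (integrableOn_const hTfin.ne))
        (Eventually.of_forall fun x => ?_)
      have hn := hneg (‖x‖ ^ 2)
      by_cases hx : x ∈ Metric.ball (0 : Euc d) b \ Metric.closedBall 0 a
      · rw [indicator_of_mem hx]
        have hxb : ‖x‖ < b := mem_ball_zero_iff.1 hx.1
        have h1 : max (-deriv g (‖x‖ ^ 2)) 0 ≤ 1 :=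
          hn.trans (indicator_le_self' (fun _ _ => zero_le_one) _)
        calc 2 * ‖x‖ ^ 2 * max (-deriv g (‖x‖ ^ 2)) 0 ≤ 2 * b ^ 2 * 1 := by gcongr
          _ = 2 * b ^ 2 := mul_one _
      · rw [indicator_of_notMem hx]
        have : ‖x‖ ^ 2 ∉ Ioo (a ^ 2) (b ^ 2) := fun h' => hx
          ⟨mem_ball_zero_iff.2 (lt_of_pow_lt_pow_left₀ 2 hb0.le h'.2), fun h'' => by
            have := mem_closedBall_zero_iff.1 h''
            exact absurd h'.1 (not_lt.2 (by gcongr))⟩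
        rw [indicator_of_notMem this] at hn
        have : max (-deriv g (‖x‖ ^ 2)) 0 = 0 := le_antisymm hn (le_max_right _ _)
        simp only [this, mul_zero, le_refl]
    have h1' : ((d - 1 : ℕ) : ℝ) * ∫ x, g (‖x‖ ^ 2) ∂μ ≤
        (∫ x, 2 * ‖x‖ ^ 2 * max (-deriv g (‖x‖ ^ 2)) 0 ∂μ) +
          C * ∑ k, |volumeVariations F γ k| := h1
    have h5 := mul_le_mul_of_nonneg_left h3 (Nat.cast_nonneg (α := ℝ) (d - 1))
    have h6 := mul_le_mul_of_nonneg_left h2 hC0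
    linarith
  have hlim : Tendsto (fun θ : ℝ => (d - 1 : ℕ) * (θ * (b ^ 2 - a ^ 2) *
        μ.real (Metric.ball 0 a \ Metric.ball 0 r))) (𝓝[<] 1)
      (𝓝 ((d - 1 : ℕ) * (1 * (b ^ 2 - a ^ 2) *
        μ.real (Metric.ball 0 a \ Metric.ball 0 r)))) :=
    (Continuous.tendsto (by fun_prop) 1).mono_left nhdsWithin_le_nhds
  rw [one_mul] at hlim
  refine le_of_tendsto hlim ?_
  filter_upwards [Ioo_mem_nhdsLT (zero_lt_one (α := ℝ))] with θ hθ
  exact main θ hθ.1 hθ.2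

theorem finitePerimeterOutside_eq_zero (hR : 0 < R)
    (hF_fin : ∀ k, volume (F k) < ∞ → F k ⊆ Metric.ball 0 R) :
    finitePerimeterOutside F (R ^ 2) = 0 := by
  refine Finset.sum_eq_zero fun k _ => ?_
  split_ifs with hk
  · rw [outside_sq hR.le, Measure.real, perimeterMeasure_compl_closedBall_eq_zero (hF_fin k hk),
      ENNReal.toReal_zero]
  · rfl

/-- Continuity from above of finite measures: the exteriors shrink to the complement of the open
ball, where these regions have perimeter on the sphere at most. -/
theorem tendsto_finitePerimeterOutside (hF : IsCaccioppoliPartition F) (hR : 0 < R)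
    (hF_fin : ∀ k, volume (F k) < ∞ → F k ⊆ Metric.ball 0 R)
    (h0 : ∀ k, volume (F k) < ∞ → perimeter (F k) (Metric.sphere 0 R) = 0) :
    Tendsto (fun j : ℕ => finitePerimeterOutside F (R ^ 2 - 1 / ((j : ℝ) + 1))) atTop (𝓝 0) := by
  suffices h : ∀ k, Tendsto (fun j : ℕ => if volume (F k) < ∞ then (perimeterMeasure (F k)).real
      (outside d (R ^ 2 - 1 / ((j : ℝ) + 1))) else 0) atTop (𝓝 0) by
    simpa [finitePerimeterOutside] using tendsto_finsetSum Finset.univ fun k _ => h k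
  intro k
  split_ifs with hk
  · have hfin := perimeterMeasure_lt_top hR (hF.perimeter_lt_top k) (hF_fin k hk)
    have hanti : Antitone fun j : ℕ => outside d (R ^ 2 - 1 / ((j : ℝ) + 1)) := by
      intro i j hij x hx
      have h1 : R ^ 2 - 1 / ((j : ℝ) + 1) < ‖x‖ ^ 2 := hx
      have h2 : 1 / ((j : ℝ) + 1) ≤ 1 / ((i : ℝ) + 1) := by gcongr
      change R ^ 2 - 1 / ((i : ℝ) + 1) < ‖x‖ ^ 2
      linarith
    have hlim := tendsto_measure_iInter_atTop (μ := perimeterMeasure (F k))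
      (s := fun j : ℕ => outside d (R ^ 2 - 1 / ((j : ℝ) + 1)))
      (fun j => (measurableSet_outside _).nullMeasurableSet)
      hanti ⟨0, (hfin _).ne⟩
    have hzero : perimeterMeasure (F k) (⋂ j : ℕ, outside d (R ^ 2 - 1 / ((j : ℝ) + 1))) = 0 := by
      refine measure_mono_null (t := Metric.sphere 0 R ∪ (Metric.closedBall 0 R)ᶜ) ?_
        (measure_union_null ?_ (perimeterMeasure_compl_closedBall_eq_zero (hF_fin k hk)))
      · intro x hx
        rw [mem_iInter] at hx
        have h1 : Tendsto (fun j : ℕ => R ^ 2 - 1 / ((j : ℝ) + 1)) atTop (𝓝 (R ^ 2 - 0)) :=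
          tendsto_const_nhds.sub tendsto_one_div_add_atTop_nhds_zero_nat
        have h2 : R ^ 2 ≤ ‖x‖ ^ 2 := by
          have := le_of_tendsto h1 (Eventually.of_forall fun j => (hx j).le)
          rwa [sub_zero] at this
        have h3 : R ≤ ‖x‖ := (sq_le_sq₀ hR.le (norm_nonneg _)).1 h2
        rcases h3.eq_or_lt with h | h
        · left; simp [← h]
        · right; simpa using h
      · rw [perimeterMeasure_apply _ Metric.isClosed_sphere.measurableSet]
        exact h0 k hk
    rw [hzero] at hlim
    exact (ENNReal.tendsto_toReal ENNReal.zero_ne_top).comp hlim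
  · exact tendsto_const_nhds

theorem measureReal_annulus_le (hF : IsCaccioppoliPartition F) {a b : ℝ} (hab : a ≤ b)
    {S : Set (Euc d)} (hS : MeasurableSet S) (hSa : S ⊆ Metric.closedBall 0 a) :
    (totalPerimeter F).real (Metric.ball 0 b \ Metric.closedBall 0 a) ≤
      (totalPerimeter F).real (Metric.ball 0 b \ S) -
        (totalPerimeter F).real (Metric.ball 0 a \ S) := by
  have hfin : ∀ A ρ, (totalPerimeter F) (Metric.ball (0 : Euc d) ρ \ A) ≠ ∞ := fun A ρ =>
    ((measure_mono sdiff_subset).trans_lt (hF.totalPerimeter_ball_lt_top ρ)).ne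
  rw [le_sub_iff_add_le, ← measureReal_union ?_ (measurableSet_ball.diff hS) (hfin _ _) (hfin _ _)]
  · refine measureReal_mono ?_ (hfin _ _)
    refine union_subset (sdiff_subset_sdiff_right hSa)
      (sdiff_subset_sdiff_left (Metric.ball_subset_ball hab))
  · rw [disjoint_left]
    exact fun x hx hx' => hx.2 (Metric.ball_subset_closedBall hx'.1)

/-- With `c₀ = R ^ 2` the field vanishes on the closed ball and the volume defect is zero. The rise
ends at radius `R + 1 / (j + 1)`, and `j → ∞` recovers the complement of the closed ball. -/
theorem monotoneOn_perimeter_sdiff_closedBall (hd : 1 ≤ d) (hP : IsCone P)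
    (hF : IsCaccioppoliPartition F) (hF_cone : ∀ k, IsCone (F k \ closure P))
    (hiso : IsIsoperimetricIn (closure P) F) (hR : 0 < R)
    (hF_fin : ∀ k, volume (F k) < ∞ → F k ⊆ Metric.ball 0 R) :
    MonotoneOn (fun ρ => (totalPerimeter F).real (Metric.ball 0 ρ \ Metric.closedBall 0 R) /
      ρ ^ (d - 1)) (Ici R) := by
  obtain ⟨C, hC0, hC⟩ := exists_first_variation_bound hd hP hF hF_cone hiso
  refine monotoneOn_div_pow hR (d - 1) ?_ (fun ρ => measureReal_nonneg) fun a b hRa hab => ?_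
  · rw [sdiff_eq_empty.2 Metric.ball_subset_closedBall, measureReal_empty]
  have ha : 0 < a := hR.trans hRa
  refine le_trans ?_ (mul_le_mul_of_nonneg_left (measureReal_annulus_le hF hab.le
    measurableSet_closedBall (Metric.closedBall_subset_closedBall hRa.le)) (by positivity))
  have hlim : Tendsto (fun j : ℕ => (totalPerimeter F).real
      (Metric.ball (0 : Euc d) a \ Metric.ball 0 (R + 1 / ((j : ℝ) + 1)))) atTop
      (𝓝 ((totalPerimeter F).real (Metric.ball (0 : Euc d) a \ Metric.closedBall 0 R))) := by
    have hU : (⋃ j : ℕ, Metric.ball (0 : Euc d) a \ Metric.ball 0 (R + 1 / ((j : ℝ) + 1))) =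
        Metric.ball (0 : Euc d) a \ Metric.closedBall 0 R := by
      ext x
      simp only [mem_iUnion, Set.mem_sdiff, mem_ball_zero_iff, mem_closedBall_zero_iff, not_lt,
        not_le]
      constructor
      · rintro ⟨j, h1, h2⟩
        exact ⟨h1, lt_of_lt_of_le (by have : 0 < 1 / ((j : ℝ) + 1) := by positivity
                                      linarith) h2⟩
      · rintro ⟨h1, h2⟩
        obtain ⟨j, hj⟩ := exists_nat_one_div_lt (sub_pos.2 h2)
        exact ⟨j, h1, by linarith⟩
    have h := tendsto_measure_iUnion_atTop (μ := totalPerimeter F)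
      (s := fun j : ℕ => Metric.ball (0 : Euc d) a \ Metric.ball 0 (R + 1 / ((j : ℝ) + 1)))
      (fun i j hij => sdiff_subset_sdiff_right (Metric.ball_subset_ball (by gcongr)))
    rw [hU] at h
    exact (ENNReal.tendsto_toReal ((measure_mono sdiff_subset).trans_lt
      (hF.totalPerimeter_ball_lt_top a)).ne).comp h
  refine le_of_tendsto ((hlim.const_mul (b ^ 2 - a ^ 2)).const_mul ((d - 1 : ℕ) : ℝ))
    (Eventually.of_forall fun j => ?_)
  have hj : 0 < 1 / ((j : ℝ) + 1) := by positivity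
  have := annulus_inequality_defect hF hR hF_fin hC0 hC (c₀ := R ^ 2)
    (r := R + 1 / ((j : ℝ) + 1)) (by positivity) (by gcongr; linarith) ha.le hab
  rwa [finitePerimeterOutside_eq_zero hR hF_fin, mul_zero, mul_zero, add_zero] at this

/-- To count the perimeter on the sphere itself the plateau must start at `R`, so the rise takes
place inside the ball, from `c₀ = R ^ 2 - 1 / (j + 1)`, and the volume defect vanishes as `j → ∞`.
-/
theorem monotoneOn_perimeter_sdiff_ball (hd : 1 ≤ d) (hP : IsCone P)
    (hF : IsCaccioppoliPartition F) (hF_cone : ∀ k, IsCone (F k \ closure P))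
    (hiso : IsIsoperimetricIn (closure P) F) (hR : 0 < R)
    (hF_fin : ∀ k, volume (F k) < ∞ → F k ⊆ Metric.ball 0 R)
    (h0 : ∀ k, volume (F k) < ∞ → perimeter (F k) (Metric.sphere 0 R) = 0) :
    MonotoneOn (fun ρ => (totalPerimeter F).real (Metric.ball 0 ρ \ Metric.ball 0 R) /
      ρ ^ (d - 1)) (Ici R) := by
  obtain ⟨C, hC0, hC⟩ := exists_first_variation_bound hd hP hF hF_cone hiso
  refine monotoneOn_div_pow hR (d - 1) ?_ (fun ρ => measureReal_nonneg) fun a b hRa hab => ?_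
  · rw [sdiff_self, measureReal_empty]
  have ha : 0 < a := hR.trans hRa
  refine le_trans ?_ (mul_le_mul_of_nonneg_left (measureReal_annulus_le hF hab.le
    measurableSet_ball (Metric.ball_subset_closedBall.trans
      (Metric.closedBall_subset_closedBall hRa.le))) (by positivity))
  have hlim := (((tendsto_finitePerimeterOutside hF hR hF_fin h0).const_mul
    ((b ^ 2 - a ^ 2) * b)).const_mul C).const_add
      (2 * b ^ 2 * (totalPerimeter F).real (Metric.ball 0 b \ Metric.closedBall 0 a))
  rw [mul_zero, mul_zero, add_zero] at hlim
  refine ge_of_tendsto hlim (Eventually.of_forall fun j => ?_)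
  have hj : 0 < 1 / ((j : ℝ) + 1) := by positivity
  exact annulus_inequality_defect hF hR hF_fin hC0 hC hR.le (by linarith) ha.le hab

end Annulus

end IsoPartition

end

/-! ### Gluing along spheres and homogeneity off the cone. -/

noncomputable section

namespace IsoPartition

variable {d N : ℕ}

section Gluing

/-- Restricting a set to an open set `W` that is exhausted by cutoff functions with bounded total
variation. -/
theorem ofReal_setIntegral_inter_divergence_le {E U W : Set (Euc d)} (hW : IsOpen W)
    {φ : Euc d → Euc d} (hφ : IsTestField U φ) {χ : ℕ → Euc d → ℝ} {c : ℝ≥0∞}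
    (hχ : ∀ j, ContDiff ℝ 1 (χ j)) (h0 : ∀ j x, 0 ≤ χ j x) (h1 : ∀ j x, χ j x ≤ 1)
    (hs : ∀ j, tsupport (χ j) ⊆ W)
    (hlim : ∀ x, Tendsto (fun j => χ j x) atTop (𝓝 (W.indicator 1 x)))
    (hc : ∀ j, ∫⁻ x, ‖fderiv ℝ (χ j) x‖ₑ ≤ c) :
    ENNReal.ofReal (∫ x in E ∩ W, divergence φ x) ≤ perimeterOpen E (U ∩ W) + c := by
  have hdi := integrable_divergence hφ.contDiff hφ.hasCompactSupport
  have hdc := continuous_divergence hφ.contDiff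
  have hstep : ∀ j, ENNReal.ofReal (∫ x in E, χ j x * divergence φ x) ≤
      perimeterOpen E (U ∩ W) + c := by
    intro j
    have hcd : ContDiff ℝ 1 (fun x => χ j x • φ x) := (hχ j).smul hφ.contDiff
    have hcs : HasCompactSupport (fun x => χ j x • φ x) :=
      hφ.hasCompactSupport.smul_left (f := χ j)
    have hsub : tsupport (fun x => χ j x • φ x) ⊆ U ∩ W := subset_inter
      ((tsupport_smul_subset_right (χ j) φ).trans hφ.tsupport_subset)
      ((tsupport_smul_subset_left (χ j) φ).trans (hs j))
    have hfi : Integrable (fun x => fderiv ℝ (χ j) x (φ x)) := by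
      refine Continuous.integrable_of_hasCompactSupport
        (((hχ j).continuous_fderiv one_ne_zero).clm_apply hφ.contDiff.continuous) ?_
      refine hφ.hasCompactSupport.mono fun x hx => ?_
      contrapose! hx
      simp [Function.notMem_support.1 hx]
    -- Product rule: the first integral is the flux of a field supported in `U ∩ W`, the second is
    -- bounded by the total variation of the cutoff.
    have e : (∫ x in E, χ j x * divergence φ x) =
        (∫ x in E, divergence (fun x => χ j x • φ x) x) +
          -∫ x in E, fderiv ℝ (χ j) x (φ x) := by
      rw [← sub_eq_add_neg,
        ← integral_sub (integrable_divergence hcd hcs).integrableOn hfi.integrableOn]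
      congr 1
      funext x
      rw [divergence_smul ((hχ j).differentiable one_ne_zero x)
        (hφ.contDiff.differentiable one_ne_zero x)]
      ring
    rw [e]
    refine ENNReal.ofReal_add_le.trans (add_le_add ?_ ?_)
    · have := ofReal_setIntegral_divergence_le (E := E) hcd hcs hsub (c := 1) fun x => by
        rw [norm_smul, Real.norm_of_nonneg (h0 j x)]
        exact mul_le_one₀ (h1 j x) (norm_nonneg _) (hφ.norm_le_one x)
      simpa using this
    · refine (Real.ofReal_le_enorm _).trans ?_
      rw [enorm_neg]
      refine (enorm_integral_le_lintegral_enorm _).trans ((lintegral_mono fun x => ?_).trans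
        ((setLIntegral_le_lintegral _ _).trans (hc j)))
      rw [← ofReal_norm, ← ofReal_norm]
      refine ENNReal.ofReal_le_ofReal ((ContinuousLinearMap.le_opNorm _ _).trans ?_)
      exact mul_le_of_le_one_right (norm_nonneg _) (hφ.norm_le_one x)
  have hconv : Tendsto (fun j => ∫ x in E, χ j x * divergence φ x) atTop
      (𝓝 (∫ x in E ∩ W, divergence φ x)) := by
    rw [← setIntegral_indicator hW.measurableSet]
    refine tendsto_integral_of_dominated_convergence (fun x => ‖divergence φ x‖)
      (fun j => ((hχ j).continuous.mul hdc).aestronglyMeasurable) hdi.norm.integrableOn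
      (fun j => Eventually.of_forall fun x => ?_) (Eventually.of_forall fun x => ?_)
    · rw [norm_mul, Real.norm_of_nonneg (h0 j x)]
      exact mul_le_of_le_one_left (norm_nonneg _) (h1 j x)
    · have := (hlim x).mul_const (divergence φ x)
      convert this using 2
      by_cases hx : x ∈ W <;> simp [hx]
  exact le_of_tendsto ((ENNReal.continuous_ofReal.tendsto _).comp hconv)
    (Eventually.of_forall hstep)

/-- Only linearity in `u` matters; the constants `2 ^ (n + 1) - 2` are those of the recursion `K ↦ 2
K + 2`. -/
theorem one_add_pow_sub_one_sub_pow_le {u : ℝ} (hu0 : 0 ≤ u) (hu1 : u ≤ 1) (n : ℕ) :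
    (1 + u) ^ n - (1 - u) ^ n ≤ (2 ^ (n + 1) - 2) * u := by
  induction n with
  | zero => simp
  | succ n ih =>
    have h1 : (1 - u) ^ n ≤ 1 := pow_le_one₀ (by linarith) (by linarith)
    have h2 : (1 - u) ^ n ≤ (1 + u) ^ n := by gcongr; linarith
    have e : (1 + u) ^ (n + 1) - (1 - u) ^ (n + 1) =
        (1 + u) * ((1 + u) ^ n - (1 - u) ^ n) + 2 * u * (1 - u) ^ n := by ring
    have h3 : (1 + u) * ((1 + u) ^ n - (1 - u) ^ n) ≤ 2 * ((2 ^ (n + 1) - 2) * u) :=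
      mul_le_mul (by linarith) ih (by linarith) (by norm_num)
    have h4 : 2 * u * (1 - u) ^ n ≤ 2 * u * 1 := by gcongr
    rw [e, pow_succ 2 (n + 1)]
    linarith

theorem volume_shell_le (hd : 1 ≤ d) {ρ u : ℝ} (hρ : 0 < ρ) (hu0 : 0 ≤ u) (hu1 : u ≤ 1) :
    volume (Metric.closedBall (0 : Euc d) (ρ * (1 + u)) \ Metric.ball 0 (ρ * (1 - u))) ≤
      ENNReal.ofReal (ρ ^ d * ((2 ^ (d + 1) - 2) * u)) * volume (Metric.ball (0 : Euc d) 1) := by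
  have : Nonempty (Fin d) := ⟨⟨0, hd⟩⟩
  have hsub : Metric.ball (0 : Euc d) (ρ * (1 - u)) ⊆ Metric.closedBall 0 (ρ * (1 + u)) :=
    Metric.ball_subset_closedBall.trans (Metric.closedBall_subset_closedBall (by nlinarith))
  have hu : 0 ≤ 1 - u := by linarith
  have h1 : volume (Metric.closedBall (0 : Euc d) (ρ * (1 + u))) = _ :=
    Measure.addHaar_closedBall _ _ (by positivity)
  have h2 : volume (Metric.ball (0 : Euc d) (ρ * (1 - u))) = _ :=
    Measure.addHaar_ball _ _ (by positivity)
  rw [measure_sdiff hsub measurableSet_ball.nullMeasurableSet measure_ball_lt_top.ne, h1, h2,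
    ← ENNReal.sub_mul (fun _ _ => measure_ball_lt_top.ne), finrank_euclideanSpace_fin,
    ← ENNReal.ofReal_sub _ (by positivity)]
  gcongr
  rw [mul_pow, mul_pow, ← mul_sub]
  gcongr
  exact one_add_pow_sub_one_sub_pow_le hu0 hu1 d

theorem exists_bound_deriv_smoothTransition :
    ∃ C : ℝ, 0 ≤ C ∧ ∀ t, |deriv Real.smoothTransition t| ≤ C ∧
      (t ∉ Icc 0 1 → deriv Real.smoothTransition t = 0) := by
  have hz : ∀ t ∉ Icc (0 : ℝ) 1, deriv Real.smoothTransition t = 0 := by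
    intro t ht
    rcases lt_or_ge t 0 with h | h
    · have : Real.smoothTransition =ᶠ[𝓝 t] fun _ => 0 :=
        (eventually_lt_nhds h).mono fun s hs => Real.smoothTransition.zero_of_nonpos hs.le
      rw [this.deriv_eq, deriv_const]
    · have h1 : 1 < t := by
        by_contra! h'
        exact ht ⟨h, h'⟩
      have : Real.smoothTransition =ᶠ[𝓝 t] fun _ => 1 :=
        (eventually_gt_nhds h1).mono fun s hs => Real.smoothTransition.one_of_one_le hs.le
      rw [this.deriv_eq, deriv_const]
  have hcont : Continuous (deriv Real.smoothTransition) :=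
    (Real.smoothTransition.contDiff (n := 1)).continuous_deriv le_rfl
  have hcs : HasCompactSupport (deriv Real.smoothTransition) :=
    HasCompactSupport.of_support_subset_isCompact (isCompact_Icc (a := (0 : ℝ)) (b := 1))
      fun t ht => by_contra fun h => ht (hz t h)
  obtain ⟨C, hC⟩ := hcont.bounded_above_of_compact_support hcs
  exact ⟨C, (norm_nonneg _).trans (hC 0), fun t => ⟨hC t, hz t⟩⟩

/-- The part of a set on either side of a sphere has finite perimeter: `σ = 1` is the inside and
`σ = -1` the outside. -/
theorem exists_ofReal_setIntegral_side_le (hd : 1 ≤ d) : ∃ C : ℝ, 0 ≤ C ∧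
    ∀ (ρ : ℝ) (_ : 0 < ρ) (σ : ℝ) (_ : |σ| = 1) (E U : Set (Euc d)) (φ : Euc d → Euc d),
      IsTestField U φ →
      ENNReal.ofReal (∫ x in E ∩ {x | 0 < σ * (1 - ‖x‖ ^ 2 / ρ ^ 2)}, divergence φ x) ≤
        perimeterOpen E (U ∩ {x | 0 < σ * (1 - ‖x‖ ^ 2 / ρ ^ 2)}) +
          ENNReal.ofReal (C * ρ ^ (d - 1)) := by
  obtain ⟨M, hM0, hM⟩ := exists_bound_deriv_smoothTransition
  set v := volume.real (Metric.ball (0 : Euc d) 1)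
  have hv : ENNReal.ofReal v = volume (Metric.ball (0 : Euc d) 1) :=
    ENNReal.ofReal_toReal measure_ball_lt_top.ne
  have hK : (0 : ℝ) ≤ 2 ^ (d + 1) - 2 := by
    have : (2 : ℝ) ^ 1 ≤ 2 ^ (d + 1) := pow_le_pow_right₀ one_le_two (by omega)
    linarith
  refine ⟨8 * M * (2 ^ (d + 1) - 2) * v, by positivity, fun ρ hρ σ hσ E U φ hφ => ?_⟩
  set a : Euc d → ℝ := fun x => σ * (1 - ‖x‖ ^ 2 / ρ ^ 2) with ha
  have hac : ContDiff ℝ 1 a :=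
    contDiff_const.mul (contDiff_const.sub ((contDiff_norm_sq ℝ).div_const _))
  -- With `k = j + 2` the cutoff varies only where `1 ≤ k a ≤ 2`, within a shell of relative
  -- thickness of order `1 / k`, and its gradient there is at most `4 M k / ρ`: the factors `k`
  -- cancel and `ρ^(d-1)` remains. The shift by two ensures `2 / k ≤ 1`.
  set χ : ℕ → Euc d → ℝ := fun j x => Real.smoothTransition (((j : ℝ) + 2) * a x - 1) with hχ
  refine ofReal_setIntegral_inter_divergence_le (isOpen_lt continuous_const hac.continuous) hφ
    (χ := χ) (fun j => ?_) (fun j x => Real.smoothTransition.nonneg _)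
    (fun j x => Real.smoothTransition.le_one _) (fun j => ?_) (fun x => ?_) (fun j => ?_)
  · exact Real.smoothTransition.contDiff.comp ((contDiff_const.mul hac).sub contDiff_const)
  · have hcl : IsClosed {x | 0 ≤ ((j : ℝ) + 2) * a x - 1} :=
      isClosed_le continuous_const ((continuous_const.mul hac.continuous).sub continuous_const)
    have hsub : tsupport (χ j) ⊆ {x | 0 ≤ ((j : ℝ) + 2) * a x - 1} := by
      refine closure_minimal (fun x hx => ?_) hcl
      by_contra h
      exact hx (Real.smoothTransition.zero_of_nonpos (not_le.1 h).le)
    refine hsub.trans fun x hx => ?_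
    have hx' : 0 ≤ ((j : ℝ) + 2) * a x - 1 := hx
    change 0 < a x
    by_contra! h
    have : ((j : ℝ) + 2) * a x ≤ 0 := mul_nonpos_of_nonneg_of_nonpos (by positivity) h
    linarith
  · by_cases hx : 0 < a x
    · rw [indicator_of_mem (by exact hx)]
      refine tendsto_const_nhds.congr' ?_
      obtain ⟨n, hn⟩ := exists_nat_gt (2 / a x)
      filter_upwards [eventually_ge_atTop n] with j hj
      refine (Real.smoothTransition.one_of_one_le ?_).symm
      have h1 : (2 : ℝ) < n * a x := (div_lt_iff₀ hx).1 hn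
      have h2 : (n : ℝ) * a x ≤ ((j : ℝ) + 2) * a x := by
        gcongr
        have : (n : ℝ) ≤ j := by exact_mod_cast hj
        linarith
      linarith
    · rw [indicator_of_notMem (by exact hx)]
      refine tendsto_const_nhds.congr fun j => ?_
      refine (Real.smoothTransition.zero_of_nonpos ?_).symm
      have : ((j : ℝ) + 2) * a x ≤ 0 :=
        mul_nonpos_of_nonneg_of_nonpos (by positivity) (not_lt.1 hx)
      linarith
  · set k : ℝ := (j : ℝ) + 2 with hk
    have hk2 : 2 ≤ k := by rw [hk]; have : (0 : ℝ) ≤ j := by positivity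
                           linarith
    have hk0 : 0 < k := by linarith
    set S := Metric.closedBall (0 : Euc d) (ρ * (1 + 2 / k)) \ Metric.ball 0 (ρ * (1 - 2 / k))
      with hS
    have hu1 : 2 / k ≤ 1 := (div_le_one hk0).2 hk2
    have hSm : MeasurableSet S := measurableSet_closedBall.diff measurableSet_ball
    have hder : ∀ x, fderiv ℝ (χ j) x =
        (deriv Real.smoothTransition (k * a x - 1) * (-(2 * k * σ / ρ ^ 2))) • innerSL ℝ x := by
      intro x
      have h1 := hasFDerivAt_normSq x
      have h2 : HasFDerivAt (fun x : Euc d => k * a x - 1)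
          ((-(2 * k * σ / ρ ^ 2)) • innerSL ℝ x) x := by
        have := ((((h1.mul_const (ρ ^ 2)⁻¹).const_sub 1).const_mul σ).const_mul k).sub_const 1
        refine (this.congr_fderiv ?_)
        ext y
        simp
        ring
      have h3 : HasDerivAt Real.smoothTransition
          (deriv Real.smoothTransition (k * a x - 1)) (k * a x - 1) :=
        ((Real.smoothTransition.contDiff (n := 1)).differentiable one_ne_zero _).hasDerivAt
      have e : χ j = Real.smoothTransition ∘ fun x => k * a x - 1 := rfl
      rw [e, (h3.comp_hasFDerivAt x h2).fderiv, smul_smul]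
    have hbound : ∀ x, ‖fderiv ℝ (χ j) x‖ₑ ≤
        S.indicator (fun _ => ENNReal.ofReal (4 * M * k / ρ)) x := by
      intro x
      by_cases hx : k * a x - 1 ∈ Icc (0 : ℝ) 1
      · have hka : |k * a x| ≤ 2 := by
          rw [abs_le]
          constructor <;> linarith [hx.1, hx.2]
        have h1 : |1 - ‖x‖ ^ 2 / ρ ^ 2| ≤ 2 / k := by
          rw [abs_mul, ha, abs_mul, hσ, one_mul, abs_of_pos hk0] at hka
          rw [le_div_iff₀ hk0, mul_comm]
          exact hka
        rw [abs_le] at h1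
        have h2 : ‖x‖ ^ 2 ≤ (1 + 2 / k) * ρ ^ 2 := by
          rw [← div_le_iff₀ (by positivity)]
          linarith
        have h3 : (1 - 2 / k) * ρ ^ 2 ≤ ‖x‖ ^ 2 := by
          rw [← le_div_iff₀ (by positivity)]
          linarith
        have hk' : 0 < 2 / k := by positivity
        have hx1 : ‖x‖ ≤ ρ * (1 + 2 / k) := by
          refine le_of_sq_le_sq (h2.trans ?_) (by positivity)
          rw [mul_pow, mul_comm]
          gcongr
          nlinarith
        have hx2 : ρ * (1 - 2 / k) ≤ ‖x‖ := by
          refine le_of_sq_le_sq (le_trans ?_ h3) (norm_nonneg _)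
          rw [mul_pow, mul_comm]
          gcongr
          nlinarith
        have hxS : x ∈ S := ⟨mem_closedBall_zero_iff.2 hx1, fun h =>
          absurd (mem_ball_zero_iff.1 h) (not_lt.2 hx2)⟩
        rw [indicator_of_mem hxS, ← ofReal_norm, hder, norm_smul, innerSL_apply_norm]
        refine ENNReal.ofReal_le_ofReal ?_
        rw [norm_mul, norm_neg, norm_div, norm_mul, norm_mul, Real.norm_eq_abs σ, hσ,
          Real.norm_of_nonneg hk0.le, Real.norm_of_nonneg (sq_nonneg ρ), Real.norm_two, mul_one]
        have hx3 : ‖x‖ ≤ 2 * ρ := by nlinarith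
        calc ‖deriv Real.smoothTransition (k * a x - 1)‖ * (2 * k / ρ ^ 2) * ‖x‖
            ≤ M * (2 * k / ρ ^ 2) * (2 * ρ) := by
              gcongr
              exact (hM _).1
          _ = 4 * M * k / ρ := by
              field_simp
              ring
      · rw [← ofReal_norm, hder, (hM _).2 hx, zero_mul, zero_smul, norm_zero, ENNReal.ofReal_zero]
        exact bot_le
    calc ∫⁻ x, ‖fderiv ℝ (χ j) x‖ₑ
        ≤ ∫⁻ x, S.indicator (fun _ => ENNReal.ofReal (4 * M * k / ρ)) x := lintegral_mono hbound
      _ = ENNReal.ofReal (4 * M * k / ρ) * volume S := lintegral_indicator_const hSm _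
      _ ≤ ENNReal.ofReal (4 * M * k / ρ) *
          (ENNReal.ofReal (ρ ^ d * ((2 ^ (d + 1) - 2) * (2 / k))) * ENNReal.ofReal v) := by
          rw [hv]
          gcongr
          exact volume_shell_le hd hρ (by positivity) hu1
      _ = _ := by
          rw [← ENNReal.ofReal_mul (by positivity), ← ENNReal.ofReal_mul (by positivity)]
          congr 1
          obtain ⟨n, rfl⟩ : ∃ n, d = n + 1 := ⟨d - 1, by omega⟩
          simp only [Nat.add_sub_cancel, pow_succ ρ n]
          field_simp
          ring

/-- The one-sided estimate is applied inside and outside the sphere, which is Lebesgue null. The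
perimeter created on it is at most a multiple of `ρ^(d-1)`. -/
theorem exists_perimeterOpen_glue_le (hd : 1 ≤ d) : ∃ C : ℝ, 0 ≤ C ∧
    ∀ (ρ : ℝ) (_ : 0 < ρ) (A F U : Set (Euc d)),
      perimeterOpen ((A ∩ Metric.ball 0 ρ) ∪ (F \ Metric.ball 0 ρ)) U ≤
        perimeterOpen A (U ∩ Metric.ball 0 ρ) + perimeterOpen F (U ∩ (Metric.closedBall 0 ρ)ᶜ) +
          ENNReal.ofReal (C * ρ ^ (d - 1)) := by
  obtain ⟨C, hC0, hC⟩ := exists_ofReal_setIntegral_side_le hd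
  have : Nonempty (Fin d) := ⟨⟨0, hd⟩⟩
  refine ⟨C + C, by positivity, fun ρ hρ A F U => iSup₂_le fun φ hφ => ?_⟩
  have e1 : {x : Euc d | 0 < 1 * (1 - ‖x‖ ^ 2 / ρ ^ 2)} = Metric.ball 0 ρ := by
    ext x
    simp only [mem_ofPred_eq, mem_ball_zero_iff, one_mul, sub_pos, div_lt_one (pow_pos hρ 2)]
    exact sq_lt_sq₀ (norm_nonneg _) hρ.le
  have e2 : {x : Euc d | 0 < -1 * (1 - ‖x‖ ^ 2 / ρ ^ 2)} = (Metric.closedBall 0 ρ)ᶜ := by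
    ext x
    simp only [mem_ofPred_eq, mem_compl_iff, mem_closedBall_zero_iff, neg_one_mul, neg_sub, sub_pos,
      one_lt_div (pow_pos hρ 2), not_le]
    exact sq_lt_sq₀ hρ.le (norm_nonneg _)
  have h1 := hC ρ hρ 1 (by simp) A U φ hφ
  have h2 := hC ρ hρ (-1) (by simp) F U φ hφ
  rw [e1] at h1
  rw [e2] at h2
  set G := (A ∩ Metric.ball 0 ρ) ∪ (F \ Metric.ball 0 ρ) with hG
  have hG1 : G ∩ Metric.ball 0 ρ = A ∩ Metric.ball 0 ρ := by
    ext x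
    simp only [hG, mem_inter_iff, mem_union, Set.mem_sdiff]
    tauto
  have hG2 : G \ Metric.ball 0 ρ = F \ Metric.ball 0 ρ := by
    ext x
    simp only [hG, mem_inter_iff, mem_union, Set.mem_sdiff]
    tauto
  have hae : (F \ Metric.ball 0 ρ : Set (Euc d)) =ᵐ[volume]
      (F ∩ (Metric.closedBall 0 ρ)ᶜ : Set (Euc d)) := by
    rw [Set.sdiff_eq]
    refine (ae_eq_refl F).inter (ae_eq_set_compl_compl.2 ?_)
    refine (LE.le.eventuallyLE Metric.ball_subset_closedBall).antisymm (ae_le_set.2 ?_)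
    rw [Metric.closedBall_sdiff_ball]
    exact Measure.addHaar_sphere _ _ _
  have hsplit : (∫ x in G, divergence φ x) =
      (∫ x in A ∩ Metric.ball 0 ρ, divergence φ x) +
        ∫ x in F ∩ (Metric.closedBall 0 ρ)ᶜ, divergence φ x := by
    rw [← integral_inter_add_sdiff measurableSet_ball
      (integrable_divergence hφ.contDiff hφ.hasCompactSupport).integrableOn, hG1, hG2,
      setIntegral_congr_set hae]
  have hCρ : 0 ≤ C * ρ ^ (d - 1) := by positivity
  rw [hsplit, add_mul, ENNReal.ofReal_add hCρ hCρ]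
  refine (ENNReal.ofReal_add_le.trans (add_le_add h1 h2)).trans (le_of_eq ?_)
  abel

end Gluing

section Scaling

theorem isRadialProfile_const {c : ℝ} (hc : 0 < c) : IsRadialProfile (fun _ => c) where
  contDiff := contDiff_const
  exists_le := ⟨c, hc, fun _ => le_rfl⟩
  deriv_pos t _ := by simpa using hc

/-- The dilation by `c` is the radial map of constant profile and leaves `E` unchanged off `C`. Used
with a ratio and with its inverse, the inequality becomes an equality. -/
theorem perimeterMeasure_ball_sdiff_le (hd : 1 ≤ d) {C E : Set (Euc d)} (hC : IsCone C)
    (hCc : IsClosed C) (hE : NullMeasurableSet E) (hEC : IsCone (E \ C))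
    (hfin : ∀ r, 0 < r → perimeter E (Metric.ball 0 r) < ∞) {c : ℝ} (hc : 0 < c) (r : ℝ) :
    perimeterMeasure E (Metric.ball 0 (c * r) \ C) ≤
      ENNReal.ofReal (c ^ (d - 1)) * perimeterMeasure E (Metric.ball 0 r \ C) := by
  have H := isRadialProfile_const hc
  have ho : IsOpen (Metric.ball (0 : Euc d) (c * r) \ C) := Metric.isOpen_ball.sdiff hCc
  have he : (E ∩ (Metric.ball 0 (c * r) \ C) : Set (Euc d)) =
      radialMap (fun _ => c) '' E ∩ (Metric.ball 0 (c * r) \ C) := by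
    ext x
    simp only [mem_inter_iff, Set.mem_sdiff]
    refine and_congr_left fun hx => ?_
    exact (mem_image_radialMap_iff_of_notMem H hC hEC hx.2).symm
  rw [perimeterMeasure_isOpen _ ho, perimeterOpen_congr ho.measurableSet he.eventuallyEq]
  refine (perimeterOpen_image_radialMap_le hd H hE hfin ho (J := fun _ => c ^ (d - 1))
    (fun _ _ => le_rfl) (fun _ _ _ => by simp)).trans ?_
  rw [setLIntegral_const]
  gcongr
  intro x hx
  refine ⟨?_, fun hxC => hx.2 (hC c hc x hxC)⟩
  have h1 := mem_ball_zero_iff.1 hx.1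
  rw [norm_radialMap H, mul_comm] at h1
  exact mem_ball_zero_iff.2 (lt_of_mul_lt_mul_left h1 hc.le)

theorem perimeterMeasure_ball_sdiff (hd : 1 ≤ d) {C E : Set (Euc d)} (hC : IsCone C)
    (hCc : IsClosed C) (hE : NullMeasurableSet E) (hEC : IsCone (E \ C))
    (hfin : ∀ r, 0 < r → perimeter E (Metric.ball 0 r) < ∞) {ρ : ℝ} (hρ : 0 < ρ) :
    perimeterMeasure E (Metric.ball 0 ρ \ C) =
      ENNReal.ofReal (ρ ^ (d - 1)) * perimeterMeasure E (Metric.ball 0 1 \ C) := by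
  refine le_antisymm ?_ ?_
  · simpa using perimeterMeasure_ball_sdiff_le hd hC hCc hE hEC hfin hρ 1
  · have h := perimeterMeasure_ball_sdiff_le hd hC hCc hE hEC hfin (inv_pos.2 hρ) ρ
    rw [inv_mul_cancel₀ hρ.ne'] at h
    refine (mul_le_mul_right h _).trans (le_of_eq ?_)
    rw [← mul_assoc, ← ENNReal.ofReal_mul (by positivity), ← mul_pow, mul_inv_cancel₀ hρ.ne',
      one_pow, ENNReal.ofReal_one, one_mul]

end Scaling

end IsoPartition

end

/-! ### The dilated competitor and the growth of the perimeter. -/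

noncomputable section

namespace IsoPartition

variable {d N : ℕ}

/-- The profile of a radial map that dilates by `1 + s` outside the ball of radius `R + 1` and is
the identity in the ball of radius `R`. -/
def dilation (R s t : ℝ) : ℝ :=
  1 + s * Real.smoothTransition ((t - R ^ 2) / ((R + 1) ^ 2 - R ^ 2))

section Dilation

variable {R s : ℝ}

theorem dilation_den_pos (hR : 0 < R) : 0 < (R + 1) ^ 2 - R ^ 2 := by nlinarith

theorem dilation_of_le (hR : 0 < R) {t : ℝ} (ht : t ≤ R ^ 2) : dilation R s t = 1 := by
  rw [dilation, Real.smoothTransition.zero_of_nonpos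
    (div_nonpos_of_nonpos_of_nonneg (by linarith) (dilation_den_pos hR).le)]
  ring

theorem dilation_of_ge (hR : 0 < R) {t : ℝ} (ht : (R + 1) ^ 2 ≤ t) : dilation R s t = 1 + s := by
  rw [dilation, Real.smoothTransition.one_of_one_le
    ((one_le_div (dilation_den_pos hR)).2 (by linarith))]
  ring

theorem hasDerivAt_dilation (R s t : ℝ) : HasDerivAt (dilation R s) (s *
    (deriv Real.smoothTransition ((t - R ^ 2) / ((R + 1) ^ 2 - R ^ 2)) /
      ((R + 1) ^ 2 - R ^ 2))) t := by
  have h1 : HasDerivAt Real.smoothTransition _ ((t - R ^ 2) / ((R + 1) ^ 2 - R ^ 2)) :=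
    ((Real.smoothTransition.contDiff (n := 1)).differentiable one_ne_zero _).hasDerivAt
  have h2 := (((hasDerivAt_id t).sub_const (R ^ 2)).div_const ((R + 1) ^ 2 - R ^ 2))
  have h3 := ((h1.comp t h2).const_mul s).const_add 1
  refine h3.congr_deriv ?_
  rw [mul_one_div]

theorem isRadialProfile_dilation (hR : 0 < R) (hs : 0 ≤ s) : IsRadialProfile (dilation R s) where
  contDiff := contDiff_const.add (contDiff_const.mul (Real.smoothTransition.contDiff.comp
    ((contDiff_id.sub contDiff_const).div_const _)))
  exists_le := ⟨1, one_pos, fun t => le_add_of_nonneg_right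
    (mul_nonneg hs (Real.smoothTransition.nonneg _))⟩
  deriv_pos t ht := by
    have h1 : 0 ≤ deriv Real.smoothTransition ((t - R ^ 2) / ((R + 1) ^ 2 - R ^ 2)) :=
      Real.smoothTransition.monotone.deriv_nonneg
    have h2 := dilation_den_pos hR
    have h3 : 0 ≤ s * Real.smoothTransition ((t - R ^ 2) / ((R + 1) ^ 2 - R ^ 2)) :=
      mul_nonneg hs (Real.smoothTransition.nonneg _)
    rw [(hasDerivAt_dilation R s t).deriv, dilation]
    positivity

theorem exists_dilation_bound (hR : 0 < R) : ∃ C : ℝ, 0 ≤ C ∧ ∀ s, 0 ≤ s → ∀ t, 0 ≤ t →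
    2 * t * deriv (dilation R s) t ≤ C * s := by
  obtain ⟨M, hM0, hM⟩ := exists_bound_deriv_smoothTransition
  have hD := dilation_den_pos hR
  refine ⟨2 * (R + 1) ^ 2 * (M / ((R + 1) ^ 2 - R ^ 2)), by positivity, fun s hs t ht => ?_⟩
  rw [(hasDerivAt_dilation R s t).deriv]
  set D := (R + 1) ^ 2 - R ^ 2
  by_cases h : (t - R ^ 2) / D ∈ Icc (0 : ℝ) 1
  · have h1 : t ≤ (R + 1) ^ 2 := by
      have := (div_le_one hD).1 h.2
      linarith
    have h2 := (le_abs_self _).trans (hM ((t - R ^ 2) / D)).1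
    calc 2 * t * (s * (deriv Real.smoothTransition ((t - R ^ 2) / D) / D))
        ≤ 2 * t * (s * (M / D)) := by gcongr
      _ ≤ 2 * (R + 1) ^ 2 * (s * (M / D)) := by gcongr
      _ = _ := by ring
  · rw [(hM _).2 h]
    simp only [zero_div, mul_zero]
    positivity

/-- The image of a set under the dilation has, in the ball of radius `s`, a perimeter of order
`s ^ (d - 1)`. -/
theorem exists_perimeter_image_dilation_le (hd : 1 ≤ d) (hR : 0 < R) : ∃ C : ℝ, 0 ≤ C ∧
    ∀ s, 1 ≤ s → ∀ E : Set (Euc d), NullMeasurableSet E →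
      (∀ r, 0 < r → perimeter E (Metric.ball 0 r) < ∞) →
      perimeterOpen (radialMap (dilation R s) '' E) (Metric.ball 0 s) ≤
        ENNReal.ofReal (C * s ^ (d - 1)) * perimeterMeasure E (Metric.ball 0 (R + 1)) := by
  obtain ⟨M, hM0, hM⟩ := exists_dilation_bound hR
  refine ⟨(1 + M) * 2 ^ (d - 1), by positivity, fun s hs E hE hfin => ?_⟩
  have hs0 : 0 ≤ s := zero_le_one.trans hs
  have H := isRadialProfile_dilation hR hs0
  have hle : ∀ t, dilation R s t ≤ 2 * s := fun t => by
    have h1 := mul_le_mul_of_nonneg_left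
      (Real.smoothTransition.le_one ((t - R ^ 2) / ((R + 1) ^ 2 - R ^ 2))) hs0
    rw [dilation]
    linarith
  have hpow : ∀ t, dilation R s t ^ (d - 1) ≤ 2 ^ (d - 1) * s ^ (d - 1) := fun t => by
    rw [← mul_pow]
    exact pow_le_pow_left₀ (H.pos t).le (hle t) _
  refine (perimeterOpen_image_radialMap_le hd H hE hfin Metric.isOpen_ball
    (J := fun _ => (1 + M) * 2 ^ (d - 1) * s ^ (d - 1)) (fun t ht => ?_)
    (fun hd1 t ht => ?_)).trans ?_
  · refine (hpow t).trans ?_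
    rw [mul_assoc]
    exact le_mul_of_one_le_left (by positivity) (by linarith)
  -- For `d ≥ 2` one factor of `h^(d-1)` absorbs the division by `h`, and what is left is bounded by
  -- powers of `s`.
  · obtain ⟨n, rfl⟩ : ∃ n, d = n + 2 := ⟨d - 2, by omega⟩
    have hpos := H.pos t
    have e : dilation R s t ^ (n + 2 - 1) *
        (1 + 2 * t * deriv (dilation R s) t / dilation R s t) =
        dilation R s t ^ n * (dilation R s t + 2 * t * deriv (dilation R s) t) := by
      simp only [show n + 2 - 1 = n + 1 by omega, pow_succ]
      field_simp
    have h1 : dilation R s t ^ n ≤ (2 * s) ^ n := pow_le_pow_left₀ hpos.le (hle t) n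
    have h2 : dilation R s t + 2 * t * deriv (dilation R s) t ≤ (1 + M) * (2 * s) := by
      have h3 := hM s hs0 t ht
      have h4 := hle t
      nlinarith
    rw [e]
    calc dilation R s t ^ n * (dilation R s t + 2 * t * deriv (dilation R s) t)
        ≤ (2 * s) ^ n * ((1 + M) * (2 * s)) :=
          mul_le_mul h1 h2 (H.deriv_pos t ht).le (by positivity)
      _ = _ := by
          simp only [show n + 2 - 1 = n + 1 by omega, mul_pow, pow_succ]
          ring
  · rw [setLIntegral_const]
    gcongr
    intro x hx
    have h1 := mem_ball_zero_iff.1 hx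
    rw [norm_radialMap H] at h1
    by_contra h
    -- Such a point is sent to norm `(1 + s) ‖x‖ > s`, so only the perimeter in the ball of radius
    -- `R + 1` reaches the ball of radius `s`.
    have h2 : R + 1 ≤ ‖x‖ := by simpa using h
    rw [dilation_of_ge hR (by gcongr)] at h1
    nlinarith

end Dilation

theorem IsPartition.glue {A F : Fin N → Set (Euc d)} (hA : IsPartition A) (hF : IsPartition F)
    {B : Set (Euc d)} (hB : MeasurableSet B) : IsPartition (fun k => (A k ∩ B) ∪ (F k \ B)) where
  nullMeasurableSet k := ((hA.nullMeasurableSet k).inter hB.nullMeasurableSet).union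
    ((hF.nullMeasurableSet k).diff hB.nullMeasurableSet)
  inter_null j k hjk := by
    refine measure_mono_null (t := (A j ∩ A k) ∪ (F j ∩ F k)) ?_
      (measure_union_null (hA.inter_null j k hjk) (hF.inter_null j k hjk))
    intro x hx
    simp only [mem_inter_iff, mem_union, Set.mem_sdiff] at hx ⊢
    tauto
  compl_iUnion_null := by
    refine measure_mono_null (t := (⋃ k, A k)ᶜ ∪ (⋃ k, F k)ᶜ) ?_
      (measure_union_null hA.compl_iUnion_null hF.compl_iUnion_null)
    intro x hx
    simp only [mem_union, mem_compl_iff, mem_iUnion, mem_inter_iff, Set.mem_sdiff, not_exists]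
      at hx ⊢
    by_cases hxB : x ∈ B
    · exact Or.inl fun k hk => hx k (Or.inl ⟨hk, hxB⟩)
    · exact Or.inr fun k hk => hx k (Or.inr ⟨hk, hxB⟩)

section Growth

variable {P : Set (Euc d)} {F : Fin N → Set (Euc d)} {R : ℝ}

/-- The perimeter of an isoperimetric partition in a ball grows at most like the area of the
sphere. -/
theorem exists_totalPerimeter_ball_le (hd : 1 ≤ d) (hP : IsCone P)
    (hF : IsCaccioppoliPartition F) (hF_cone : ∀ k, IsCone (F k \ closure P))
    (hiso : IsIsoperimetricIn (closure P) F) (hR : 0 < R)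
    (hF_fin : ∀ k, volume (F k) < ∞ → F k ⊆ Metric.ball 0 R) :
    ∃ C : ℝ, ∀ ρ, max R 1 ≤ ρ →
      (totalPerimeter F).real (Metric.ball 0 ρ) ≤ C * ρ ^ (d - 1) := by
  obtain ⟨C₁, hC₁0, hC₁⟩ := exists_perimeter_image_dilation_le hd hR
  obtain ⟨C₂, hC₂0, hC₂⟩ := exists_perimeterOpen_glue_le hd
  set μ := totalPerimeter F
  refine ⟨C₁ * μ.real (Metric.ball 0 (R + 1)) + N * C₂, fun ρ hρ => ?_⟩
  have hRρ : R ≤ ρ := (le_max_left _ _).trans hρ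
  have h1ρ : 1 ≤ ρ := (le_max_right _ _).trans hρ
  have hρ0 : 0 < ρ := zero_lt_one.trans_le h1ρ
  have H := isRadialProfile_dilation hR hρ0.le
  set f : Euc d → Euc d := radialMap (dilation R ρ) with hf
  -- Dilated regions inside the ball, the original ones outside. Off the closed cone both coincide,
  -- so the variation lies in `closure P ∩ Metric.closedBall 0 ρ`.
  set G : Fin N → Set (Euc d) := fun k =>
    (f '' F k ∩ Metric.ball 0 ρ) ∪ (F k \ Metric.ball 0 ρ) with hG
  have hGP : IsPartition G :=
    (hF.toIsPartition.image_radialMap H).glue hF.toIsPartition measurableSet_ball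
  have hfix : ∀ x : Euc d, ‖x‖ ≤ R → ∀ k, x ∈ f '' F k ↔ x ∈ F k := fun x hx k =>
    mem_image_radialMap_iff_of_eq_one H (dilation_of_le hR (by gcongr))
  set B : Set (Euc d) := Metric.ball 0 (ρ + 1) with hB
  have hcomp : μ B ≤ ∑ k, perimeterMeasure (G k) B := by
    rw [totalPerimeter_apply]
    refine hiso.sum_perimeter_le hGP (K := closure P ∩ Metric.closedBall 0 ρ)
      ((isCompact_closedBall _ _).inter_left isClosed_closure) inter_subset_left
      (inter_subset_right.trans (Metric.closedBall_subset_ball (by linarith))) Metric.isOpen_ball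
      (fun k x hx => ?_) (fun k hk => ?_)
    · by_contra hxK
      have hiff : x ∈ G k ↔ x ∈ F k := by
        by_cases hxb : x ∈ Metric.ball (0 : Euc d) ρ
        · have hxP : x ∉ closure P := fun h => hxK ⟨h, Metric.ball_subset_closedBall hxb⟩
          have := mem_image_radialMap_iff_of_notMem H hP.closure (hF_cone k) hxP
          simp only [hG, mem_union, mem_inter_iff, Set.mem_sdiff, hxb, and_true, not_true,
            and_false, or_false]
          exact this
        · simp [hG, hxb]
      rw [mem_symmDiff] at hx
      tauto
    -- A region of finite volume lies in the ball of radius `R`, where the map is the identity, so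
    -- it is not changed at all.
    · have : G k = F k := by
        ext x
        by_cases hx : ‖x‖ < R
        · have hxb : x ∈ Metric.ball (0 : Euc d) ρ := mem_ball_zero_iff.2 (hx.trans_le hRρ)
          simp only [hG, mem_union, mem_inter_iff, Set.mem_sdiff, hxb, and_true, not_true,
            and_false, or_false]
          exact hfix x hx.le k
        · have hxF : x ∉ F k := fun h => hx (mem_ball_zero_iff.1 (hF_fin k hk h))
          have hxf : x ∉ f '' F k := by
            rintro ⟨y, hy, rfl⟩
            have hy' := mem_ball_zero_iff.1 (hF_fin k hk hy)
            have : f y = y := by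
              rw [hf, radialMap, dilation_of_le hR (by gcongr), one_smul]
            rw [this] at hx
            exact hx hy'
          simp [hG, hxF, hxf]
      rw [this]
  have hGk : ∀ k, perimeterMeasure (G k) B ≤
      ENNReal.ofReal (C₁ * ρ ^ (d - 1)) * perimeterMeasure (F k) (Metric.ball 0 (R + 1)) +
        perimeterMeasure (F k) (B \ Metric.closedBall 0 ρ) +
          ENNReal.ofReal (C₂ * ρ ^ (d - 1)) := by
    intro k
    rw [perimeterMeasure_isOpen _ Metric.isOpen_ball]
    refine (hC₂ ρ hρ0 (f '' F k) (F k) B).trans ?_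
    gcongr
    · exact (perimeterOpen_mono _ inter_subset_right).trans
        (hC₁ ρ h1ρ (F k) (hF.nullMeasurableSet k) (hF.perimeter_lt_top k))
    · rw [Set.sdiff_eq, perimeterMeasure_isOpen]
      exact Metric.isOpen_ball.inter Metric.isClosed_closedBall.isOpen_compl
  have hsum : μ B ≤ ENNReal.ofReal (C₁ * ρ ^ (d - 1)) * μ (Metric.ball 0 (R + 1)) +
      N * ENNReal.ofReal (C₂ * ρ ^ (d - 1)) + μ (B \ Metric.closedBall 0 ρ) := by
    refine (hcomp.trans (Finset.sum_le_sum fun k _ => hGk k)).trans (le_of_eq ?_)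
    rw [Finset.sum_add_distrib, Finset.sum_add_distrib, ← Finset.mul_sum, ← totalPerimeter_apply,
      ← totalPerimeter_apply, Finset.sum_const, Finset.card_univ, Fintype.card_fin, nsmul_eq_mul]
    abel
  have hBfin : μ (B \ Metric.closedBall 0 ρ) ≠ ∞ :=
    ((measure_mono sdiff_subset).trans_lt (hF.totalPerimeter_ball_lt_top _)).ne
  have hcb : Metric.closedBall (0 : Euc d) ρ ⊆ B := Metric.closedBall_subset_ball (by linarith)
  rw [← measure_inter_add_sdiff B measurableSet_closedBall, inter_eq_right.2 hcb] at hsum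
  -- The perimeter in the outer shell is common to both partitions and finite, hence cancels.
  have hmain := (ENNReal.add_le_add_iff_right hBfin).1 hsum
  have hfinal := (measure_mono (μ := μ) Metric.ball_subset_closedBall).trans hmain
  have h1 := (hF.totalPerimeter_ball_lt_top (R + 1)).ne
  have hreal := ENNReal.toReal_mono (ENNReal.add_ne_top.2
    ⟨ENNReal.mul_ne_top ENNReal.ofReal_ne_top h1,
      ENNReal.mul_ne_top (ENNReal.natCast_ne_top N) ENNReal.ofReal_ne_top⟩) hfinal
  rw [ENNReal.toReal_add (ENNReal.mul_ne_top ENNReal.ofReal_ne_top h1)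
    (ENNReal.mul_ne_top (ENNReal.natCast_ne_top N) ENNReal.ofReal_ne_top), ENNReal.toReal_mul,
    ENNReal.toReal_mul, ENNReal.toReal_ofReal (by positivity),
    ENNReal.toReal_ofReal (by positivity), ENNReal.toReal_natCast] at hreal
  refine hreal.trans (le_of_eq ?_)
  rw [← Measure.real]
  ring

end Growth

end IsoPartition

end

/-! ### The perimeter in the cone and the conclusion. -/

noncomputable section

namespace IsoPartition

variable {d N : ℕ}

theorem toReal_partitionPerimeter (F : Fin N → Set (Euc d)) {B : Set (Euc d)}
    (hB : MeasurableSet B) :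
    (partitionPerimeter F B).toReal = (totalPerimeter F).real B / 2 := by
  rw [partitionPerimeter_eq F hB, ENNReal.toReal_div, measureReal_def]
  rfl

theorem exists_tendsto_atTop_of_monotoneOn {f : ℝ → ℝ} {a b C : ℝ} (hf : MonotoneOn f (Ici a))
    (hC : ∀ x, b ≤ x → f x ≤ C) : ∃ L, Tendsto f atTop (𝓝 L) := by
  have hmono : Monotone fun x => f (max x (max a b)) := fun x y hxy =>
    hf ((le_max_left a b).trans (le_max_right _ _)) ((le_max_left a b).trans (le_max_right _ _))
      (max_le_max hxy le_rfl)
  have hbdd : BddAbove (range fun x => f (max x (max a b))) := by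
    refine ⟨C, ?_⟩
    rintro _ ⟨x, rfl⟩
    exact hC _ ((le_max_right a b).trans (le_max_right _ _))
  refine ⟨_, (tendsto_atTop_ciSup hmono hbdd).congr' ?_⟩
  filter_upwards [eventually_ge_atTop (max a b)] with x hx
  rw [max_eq_left hx]

theorem exists_tendsto_div_pow (c : ℝ) (n : ℕ) :
    ∃ L, Tendsto (fun ρ : ℝ => c / ρ ^ n) atTop (𝓝 L) := by
  rcases eq_or_ne n 0 with rfl | hn
  · exact ⟨c, by simp⟩
  · exact ⟨0, tendsto_const_nhds.div_atTop (tendsto_pow_atTop hn)⟩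

variable {F : Fin N → Set (Euc d)} {P : Set (Euc d)}

theorem totalPerimeter_ball_sdiff (hd : 1 ≤ d) (hP : IsCone P)
    (hF : IsCaccioppoliPartition F) (hF_cone : ∀ k, IsCone (F k \ closure P)) {ρ : ℝ}
    (hρ : 0 < ρ) :
    (totalPerimeter F).real (Metric.ball 0 ρ \ closure P) =
      ρ ^ (d - 1) * (totalPerimeter F).real (Metric.ball 0 1 \ closure P) := by
  have h : totalPerimeter F (Metric.ball 0 ρ \ closure P) =
      ENNReal.ofReal (ρ ^ (d - 1)) * totalPerimeter F (Metric.ball 0 1 \ closure P) := by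
    simp_rw [totalPerimeter_apply, Finset.mul_sum]
    exact Finset.sum_congr rfl fun k _ => perimeterMeasure_ball_sdiff hd hP.closure
      isClosed_closure (hF.nullMeasurableSet k) (hF_cone k) (hF.perimeter_lt_top k) hρ
  rw [measureReal_def, h, ENNReal.toReal_mul, ENNReal.toReal_ofReal (by positivity),
    measureReal_def]

/-- The part off the cone is homogeneous of degree `d - 1` and becomes a constant after division.
The set `A` is the open ball for the identity in the cone and the closed ball for the limit. -/
theorem totalPerimeter_ball_inter_div (hd : 1 ≤ d) (hP : IsCone P)
    (hF : IsCaccioppoliPartition F) (hF_cone : ∀ k, IsCone (F k \ closure P)) {ρ : ℝ}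
    (hρ : 0 < ρ) {A : Set (Euc d)} (hA : MeasurableSet A) (hAρ : A ⊆ Metric.ball 0 ρ) :
    (totalPerimeter F).real (Metric.ball 0 ρ ∩ closure P) / ρ ^ (d - 1) =
      ((totalPerimeter F).real (Metric.ball 0 ρ \ A) + (totalPerimeter F).real A) /
        ρ ^ (d - 1) - (totalPerimeter F).real (Metric.ball 0 1 \ closure P) := by
  have hfin := (hF.totalPerimeter_ball_lt_top ρ).ne
  have h1 := measureReal_inter_add_sdiff (μ := totalPerimeter F) (s := Metric.ball (0 : Euc d) ρ)
    (t := closure P) isClosed_closure.measurableSet hfin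
  have h2 := measureReal_inter_add_sdiff (μ := totalPerimeter F) (s := Metric.ball (0 : Euc d) ρ)
    (t := A) hA hfin
  rw [inter_eq_right.2 hAρ] at h2
  rw [totalPerimeter_ball_sdiff hd hP hF hF_cone hρ] at h1
  have hρn : ρ ^ (d - 1) ≠ 0 := (pow_pos hρ _).ne'
  field_simp
  linarith

end IsoPartition

end

theorem theorem4p3 {d N : ℕ} (hd : 1 ≤ d)
    (P : Set (EuclideanSpace ℝ (Fin d))) (hP_open : IsOpen P) (hP_cone : IsoPartition.IsCone P)
    (F : Fin N → Set (EuclideanSpace ℝ (Fin d)))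
    (hF : IsoPartition.IsCaccioppoliPartition F)
    (hF_cone : ∀ k, IsoPartition.IsCone (F k \ closure P))
    (hF_iso : IsoPartition.IsIsoperimetricIn (closure P) F)
    (R : ℝ) (hR : 0 < R)
    (hF_fin : ∀ k, volume (F k) < ∞ → F k ⊆ Metric.ball 0 R) :
    -- monotonicity, with the closed ball of radius `R` removed
    MonotoneOn
      (fun ρ : ℝ =>
        (IsoPartition.partitionPerimeter F (Metric.ball 0 ρ \ Metric.closedBall 0 R)).toReal
          / ρ ^ (d - 1))
      (Ici R) ∧
    -- monotonicity, with the open ball of radius `R` removed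
    ((∀ k, volume (F k) < ∞ → IsoPartition.perimeter (F k) (Metric.sphere 0 R) = 0) →
      MonotoneOn
        (fun ρ : ℝ =>
          (IsoPartition.partitionPerimeter F (Metric.ball 0 ρ \ Metric.ball 0 R)).toReal
            / ρ ^ (d - 1))
        (Ici R)) ∧
    -- the perimeter in the closed cone
    (∀ ρ : ℝ, R ≤ ρ →
      (IsoPartition.partitionPerimeter F (Metric.ball 0 ρ ∩ closure P)).toReal / ρ ^ (d - 1) =
        ((IsoPartition.partitionPerimeter F (Metric.ball 0 ρ \ Metric.ball 0 R)).toReal +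
            (IsoPartition.partitionPerimeter F (Metric.ball 0 R)).toReal) / ρ ^ (d - 1) -
          (IsoPartition.partitionPerimeter F (Metric.ball 0 1 \ closure P)).toReal) ∧
    -- existence of the (finite) limit
    ∃ L : ℝ, Tendsto
      (fun ρ : ℝ =>
        (IsoPartition.partitionPerimeter F (Metric.ball 0 ρ ∩ closure P)).toReal / ρ ^ (d - 1))
      atTop (𝓝 L) := by
  have hCm : MeasurableSet (closure P) := isClosed_closure.measurableSet
  have hb (r : ℝ) : MeasurableSet (Metric.ball (0 : EuclideanSpace ℝ (Fin d)) r) :=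
    measurableSet_ball
  have hmono := IsoPartition.monotoneOn_perimeter_sdiff_closedBall hd hP_cone hF hF_cone hF_iso hR
    hF_fin
  simp_rw [IsoPartition.toReal_partitionPerimeter F ((hb _).diff measurableSet_closedBall),
    IsoPartition.toReal_partitionPerimeter F ((hb _).diff (hb _)),
    IsoPartition.toReal_partitionPerimeter F ((hb _).diff hCm),
    IsoPartition.toReal_partitionPerimeter F ((hb _).inter hCm),
    IsoPartition.toReal_partitionPerimeter F (hb _), div_right_comm _ (2 : ℝ)]
  refine ⟨fun a ha b hb' hab => ?_, fun h0 a ha b hb' hab => ?_, fun ρ hρ => ?_, ?_⟩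
  · exact div_le_div_of_nonneg_right (hmono ha hb' hab) zero_le_two
  · exact div_le_div_of_nonneg_right (IsoPartition.monotoneOn_perimeter_sdiff_ball hd hP_cone hF
      hF_cone hF_iso hR hF_fin h0 ha hb' hab) zero_le_two
  · rw [IsoPartition.totalPerimeter_ball_inter_div hd hP_cone hF hF_cone (hR.trans_le hρ) (hb R)
      (Metric.ball_subset_ball hρ)]
    ring
  -- The closed ball is removed here because the corresponding monotonicity needs no assumption on
  -- the sphere. The quotient is monotone and bounded, and the fixed perimeter of the closed ball
  -- divided by `ρ ^ (d - 1)` converges as well.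
  · obtain ⟨C, hC⟩ := IsoPartition.exists_totalPerimeter_ball_le hd hP_cone hF hF_cone hF_iso hR
      hF_fin
    obtain ⟨L₁, hL₁⟩ := IsoPartition.exists_tendsto_atTop_of_monotoneOn (b := max R 1) (C := C) hmono
      fun ρ hρ => by
        have hρ0 : 0 < ρ := zero_lt_one.trans_le ((le_max_right _ _).trans hρ)
        rw [div_le_iff₀ (pow_pos hρ0 _)]
        exact (measureReal_mono sdiff_subset (hF.totalPerimeter_ball_lt_top ρ).ne).trans (hC ρ hρ)
    obtain ⟨L₂, hL₂⟩ := IsoPartition.exists_tendsto_div_pow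
      ((IsoPartition.totalPerimeter F).real (Metric.closedBall 0 R)) (d - 1)
    refine ⟨_, (((hL₁.add hL₂).sub_const
      ((IsoPartition.totalPerimeter F).real (Metric.ball 0 1 \ closure P))).div_const 2).congr' ?_⟩
    filter_upwards [eventually_gt_atTop R] with ρ hρ
    rw [IsoPartition.totalPerimeter_ball_inter_div hd hP_cone hF hF_cone (hR.trans hρ)
      measurableSet_closedBall (Metric.closedBall_subset_ball hρ), add_div]
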